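/- **Setting.** Let $n\ge 2$, let $U\subset\mathbb R^n$ be a bounded open set (for instance a bounded domain with $C^1$ boundary), let $N\ge 1$ and let $0=\alpha_0<\alpha_1<\dots<\alpha_N$ be real numbers. Put $a=\frac{\alpha_N}{\alpha_N+1}\in(0,1)$ and $\kappa_0=\frac{2+a}{2(2-a)}$. Let $\phi:U\to(0,1]$ be measurable, and let $a_0,\dots,a_N:U\to[0,\infty)$ be measurable with $a_0,a_N>0$. Define $$g(x,s)=\sum_{i=0}^N a_i(x)s^{\alpha_i},\qquad K(x,\xi)=\frac1{g(x,s(x,\xi))},\qquad W_1(x)=\frac{a_N(x)^a}{2N\max_j a_j(x)},$$ where $s=s(x,\xi)$ is the unique non-negative solution of $s\,g(x,s)=\xi$. Write $\|u\|_{L^2_\phi}^2=\int_U\phi|u|^2dx$, and call $\mathcal E(q)=\int_U K(x,|q|)|q|^2dx$ the energy of a vector field $q$ on $U$. Gradients are weak gradients on $U$, and a time derivative $u_t(t)\in L^2_\phi$ is the limit in $L^2_\phi$ of the difference quotients of $u$ at $t$. A function $u(x,t)$ is called *regular* if at each $t>0$ the derivatives $\nabla u$, $u_t$, $\nabla u_t$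 exist, $\mathcal E(\nabla u(t))<\infty$, and $$\mathcal E\Big(\frac{\nabla u(s)-\nabla u(t)}{s-t}-\nabla u_t(t)\Big)\to0\quad\text{as } s\to t.$$ A function $v$ on $U$ *vanishes on* $\partial U$ if there are $\eta_k\in C_c^\infty(U)$ with $\|\eta_k-v\|_{L^2_\phi}\to0$ and $\mathcal E(\nabla\eta_k-\nabla v)\to0$. For $i=1,2$ let $\Psi_i(x,t)$ be regular (an extension to $U$ of the boundary data), and let $p_i$ be a solution of $$\phi\,\partial_t p_i=\nabla\cdot\big(K(x,|\nabla p_i|)\nabla p_i\big)\ \text{on }U\times(0,\infty),\qquad p_i=\Psi_i\ \text{on }\partial U\times(0,\infty),\qquad p_i(\cdot,0)=p_{i,0}\ \text{on } U,$$ in the following sense, with $\bar p_i=p_i-\Psi_i$: $p_i$ is regular; $\bar p_i(t)\in L^2_\phi$ for all $t\ge0$, with $\bar p_i(t)\to\bar p_i(0)$ in $L^2_\phi$ as $t\to0^+$; for each $t>0$, $\bar p_i(t)$ vanishes on $\partial U$ and $\int_U\phi\, p_{i,t}\,\eta\,dx=-\int_U K(x,|\nabla p_i|)\nabla p_i\cdot\nabla\eta\,dx$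 for all $\eta\in C_c^\infty(U)$ with $\mathcal E(\nabla\eta)<\infty$; and $p_i(\cdot,0)=p_{i,0}$ a.e. on $U$. Put $\bar P=\bar p_1-\bar p_2$ and $\Phi=\Psi_1-\Psi_2$. Let $c_P>0$ be such that the two-weight Poincaré–Sobolev inequality $$\Big(\int_U|u|^2\phi\,dx\Big)^{1/2}\le c_P\Big(\int_U W_1|\nabla u|^{2-a}dx\Big)^{\frac1{2-a}}$$ holds for $u=\bar p_1(t),\ \bar p_2(t),\ \bar P(t)$ and all $t>0$. With $B_*=\max\{\int_U a_N\,dx,\,1\}$ define, with values in $[0,\infty]$, $$G[\Psi](t)=B_*+\int_U a_0^{-1}|\nabla\Psi|^2dx+\int_U W_1|\nabla\Psi|^{2-a}dx+\Big(\int_U|\Psi_t|^2\phi\,dx\Big)^{\frac{2-a}{2(1-a)}},\qquad G_1[\Psi](t)=\int_U a_0^{-1}|\nabla\Psi_t|^2dx,$$ $$D(t)=\int_U a_0^{-1}|\nabla\Phi|^2dx+\Big(\int_U a_0^{-1}|\nabla\Phi|^2dx\Big)^{1/2}+\Big(\int_U|\Phi_t|^2\phi\,dx\Big)^{1/2},$$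 $$\tilde{\mathcal A}=\sum_{i=1}^2\limsup_{t\to\infty}G[\Psi_i](t),\qquad \mathcal G_1=\sum_{i=1}^2\limsup_{t\to\infty}G_1[\Psi_i](t),\qquad \mathcal D=\limsup_{t\to\infty}D(t).$$ **Theorem.** There is a constant $C>0$ depending only on $n$, $U$, $N$, the exponents $\alpha_0,\dots,\alpha_N$ and $c_P$ (and not on $\phi$, the coefficients $a_i$, the functions $\Psi_i$, the solutions $p_i$ or the initial data $p_{i,0}$) such that, whenever $\tilde{\mathcal A}<\infty$ and $\mathcal G_1<\infty$, $$\limsup_{t\to\infty}\|\bar P(t)\|_{L^2_\phi}^2\le C\big(\tilde{\mathcal A}^{\frac{2}{2-a}}+\mathcal G_1\big)^{\kappa_0}\,\mathcal D.$$ -/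

import Mathlib

open MeasureTheory Filter Topology Set
open scoped ENNReal ContDiff

noncomputable section

namespace Forchheimer

/-- Euclidean space `ℝⁿ`. -/
abbrev Space (n : ℕ) : Type := EuclideanSpace ℝ (Fin n)

/-! ### The constitutive law -/

/-- `g(x,s) = a₀(x) s^{α₀} + ⋯ + a_N(x) s^{α_N}`. -/
def g {n N : ℕ} (α : Fin (N + 1) → ℝ) (a : Fin (N + 1) → Space n → ℝ)
    (x : Space n) (s : ℝ) : ℝ :=
  ∑ i, a i x * s ^ α i

/-- The non-negative solution `s = s(x,ξ)` of `s g(x,s) = ξ`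
(it exists and is unique, see `existsUnique_root`). -/
def root {n N : ℕ} (α : Fin (N + 1) → ℝ) (a : Fin (N + 1) → Space n → ℝ)
    (x : Space n) (ξ : ℝ) : ℝ :=
  Function.invFunOn (fun s : ℝ => s * g α a x s) (Ici 0) ξ

/-- `K(x,ξ) = 1 / g(x, s(x,ξ))`. -/
def K {n N : ℕ} (α : Fin (N + 1) → ℝ) (a : Fin (N + 1) → Space n → ℝ)
    (x : Space n) (ξ : ℝ) : ℝ :=
  1 / g α a x (root α a x ξ)

/-- The exponent `a = α_N / (α_N + 1)`. -/
def degExp {N : ℕ} (α : Fin (N + 1) → ℝ) : ℝ :=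
  α (Fin.last N) / (α (Fin.last N) + 1)

/-- `M(x) = max_j a_j(x)`. -/
def maxCoeff {n N : ℕ} (a : Fin (N + 1) → Space n → ℝ) (x : Space n) : ℝ :=
  Finset.univ.sup' Finset.univ_nonempty (fun j => a j x)

/-- The weight `W₁(x) = a_N(x)^a / (2 N M(x))`. -/
def W1 {n N : ℕ} (α : Fin (N + 1) → ℝ) (a : Fin (N + 1) → Space n → ℝ) (x : Space n) : ℝ :=
  a (Fin.last N) x ^ degExp α / (2 * N * maxCoeff a x)

/-- Standing assumptions on the exponents: `N ≥ 1` and `0 = α₀ < α₁ < ⋯ < α_N`. -/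
structure IsExponents {N : ℕ} (α : Fin (N + 1) → ℝ) : Prop where
  one_le : 1 ≤ N
  zero : α 0 = 0
  strictMono : StrictMono α

/-- Standing assumptions on the coefficients: measurable, non-negative, and `a₀, a_N > 0`. -/
structure IsCoeff {n N : ℕ} (U : Set (Space n)) (a : Fin (N + 1) → Space n → ℝ) : Prop where
  measurable : ∀ i, AEMeasurable (a i) (volume.restrict U)
  nonneg : ∀ i, ∀ x ∈ U, 0 ≤ a i x
  pos_zero : ∀ x ∈ U, 0 < a 0 x
  pos_last : ∀ x ∈ U, 0 < a (Fin.last N) x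

/-- Standing assumptions on the porosity: measurable with values in `(0,1]`. -/
structure IsPorosity {n : ℕ} (U : Set (Space n)) (φ : Space n → ℝ) : Prop where
  measurable : AEMeasurable φ (volume.restrict U)
  pos : ∀ x ∈ U, 0 < φ x
  le_one : ∀ x ∈ U, φ x ≤ 1

/-- The equation `s g(x,s) = ξ` has exactly one non-negative solution. -/
theorem existsUnique_root {n N : ℕ} {U : Set (Space n)} {α : Fin (N + 1) → ℝ}
    {a : Fin (N + 1) → Space n → ℝ} (hα : IsExponents α) (ha : IsCoeff U a)
    {x : Space n} (hx : x ∈ U) {ξ : ℝ} (hξ : 0 ≤ ξ) :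
    ∃! s : ℝ, 0 ≤ s ∧ s * g α a x s = ξ := by
  have hα0 : ∀ i, 0 ≤ α i := fun i => by
    have := hα.strictMono.monotone (Fin.zero_le i)
    rwa [hα.zero] at this
  have hmono : ∀ s t : ℝ, 0 ≤ s → s ≤ t → g α a x s ≤ g α a x t := fun s t hs hst =>
    Finset.sum_le_sum fun i _ =>
      mul_le_mul_of_nonneg_left (Real.rpow_le_rpow hs hst (hα0 i)) (ha.nonneg i x hx)
  have hlow : ∀ s : ℝ, 0 ≤ s → a 0 x ≤ g α a x s := fun s hs => by
    have h := Finset.single_le_sum (f := fun i => a i x * s ^ α i)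
      (fun i _ => mul_nonneg (ha.nonneg i x hx) (Real.rpow_nonneg hs _)) (Finset.mem_univ 0)
    simpa [hα.zero, g] using h
  have h0 := ha.pos_zero x hx
  have hstrict : ∀ s t : ℝ, 0 ≤ s → s < t → s * g α a x s < t * g α a x t :=
    fun s t hs hst =>
      calc s * g α a x s ≤ s * g α a x t := mul_le_mul_of_nonneg_left (hmono s t hs hst.le) hs
        _ < t * g α a x t :=
          mul_lt_mul_of_pos_right hst (h0.trans_le (hlow t (hs.trans hst.le)))
  have hcont : ContinuousOn (fun s : ℝ => s * g α a x s) (Icc 0 (ξ / a 0 x)) := by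
    refine continuousOn_id.mul (continuousOn_finsetSum _ fun i _ => continuousOn_const.mul ?_)
    exact (Real.continuous_rpow_const (hα0 i)).continuousOn
  have hb : 0 ≤ ξ / a 0 x := div_nonneg hξ h0.le
  have hmem : ξ ∈ Icc ((fun s : ℝ => s * g α a x s) 0)
      ((fun s : ℝ => s * g α a x s) (ξ / a 0 x)) := by
    refine ⟨by simpa using hξ, ?_⟩
    calc ξ = ξ / a 0 x * a 0 x := by field_simp
      _ ≤ _ := mul_le_mul_of_nonneg_left (hlow _ hb) hb
  obtain ⟨s, hs, hsξ⟩ := intermediate_value_Icc hb hcont hmem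
  refine ⟨s, ⟨hs.1, hsξ⟩, ?_⟩
  rintro t ⟨ht, htξ⟩
  have hsξ' : s * g α a x s = ξ := hsξ
  rcases lt_trichotomy t s with h | h | h
  · have := hstrict t s ht h
    linarith
  · exact h
  · have := hstrict s t hs.1 h
    linarith

/-- `root` is that solution. -/
theorem root_spec {n N : ℕ} {U : Set (Space n)} {α : Fin (N + 1) → ℝ}
    {a : Fin (N + 1) → Space n → ℝ} (hα : IsExponents α) (ha : IsCoeff U a)
    {x : Space n} (hx : x ∈ U) {ξ : ℝ} (hξ : 0 ≤ ξ) :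
    0 ≤ root α a x ξ ∧ root α a x ξ * g α a x (root α a x ξ) = ξ := by
  have h : ∃ s ∈ Ici (0 : ℝ), (fun s : ℝ => s * g α a x s) s = ξ := by
    obtain ⟨s, ⟨h1, h2⟩, -⟩ := existsUnique_root hα ha hx hξ
    exact ⟨s, h1, h2⟩
  exact ⟨Function.invFunOn_mem h, Function.invFunOn_eq h⟩

/-! ### Derivatives and function classes -/

/-- Test functions `η ∈ C_c^∞(U)`. -/
structure IsTest {n : ℕ} (U : Set (Space n)) (η : Space n → ℝ) : Prop where
  smooth : ContDiff ℝ ∞ η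
  compact : HasCompactSupport η
  support : tsupport η ⊆ U

/-- `q` is a weak gradient of `u` on `U`. -/
structure HasWeakGrad {n : ℕ} (U : Set (Space n)) (u : Space n → ℝ)
    (q : Space n → Space n) : Prop where
  locInt : LocallyIntegrableOn u U
  locInt_grad : LocallyIntegrableOn q U
  parts : ∀ η : Space n → ℝ, IsTest U η →
    ∫ x in U, u x • gradient η x = - ∫ x in U, η x • q x

open Classical in
/-- The weak gradient `∇u` on `U` (unique up to null sets; `0` if there is none). -/
def weakGrad {n : ℕ} (U : Set (Space n)) (u : Space n → ℝ) : Space n → Space n :=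
  if h : ∃ q, HasWeakGrad U u q then h.choose else 0

theorem hasWeakGrad_weakGrad {n : ℕ} {U : Set (Space n)} {u : Space n → ℝ}
    (h : ∃ q, HasWeakGrad U u q) : HasWeakGrad U u (weakGrad U u) := by
  rw [weakGrad, dif_pos h]
  exact h.choose_spec

/-- `‖u‖²_{L²_φ(U)} = ∫_U φ |u|² dx`. -/
def normSq {n : ℕ} (U : Set (Space n)) (φ u : Space n → ℝ) : ℝ≥0∞ :=
  ∫⁻ x in U, ENNReal.ofReal (φ x * u x ^ 2)

/-- `u ∈ L²_φ(U)`. -/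
def MemL2 {n : ℕ} (U : Set (Space n)) (φ u : Space n → ℝ) : Prop :=
  AEStronglyMeasurable u (volume.restrict U) ∧ normSq U φ u < ⊤

/-- `w ∈ L²_φ(U)` is the time derivative of `u` at time `t`: the difference quotients
of `u` at `t` converge to `w` in `L²_φ(U)`. -/
def HasTimeDeriv {n : ℕ} (U : Set (Space n)) (φ : Space n → ℝ) (u : ℝ → Space n → ℝ) (t : ℝ)
    (w : Space n → ℝ) : Prop :=
  MemL2 U φ w ∧
    Tendsto (fun s => normSq U φ (fun x => (u s x - u t x) / (s - t) - w x)) (𝓝[≠] t) (𝓝 0)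

open Classical in
/-- The time derivative `u_t(·,t)` (unique up to null sets; `0` if there is none). -/
def timeDeriv {n : ℕ} (U : Set (Space n)) (φ : Space n → ℝ) (u : ℝ → Space n → ℝ) (t : ℝ) :
    Space n → ℝ :=
  if h : ∃ w, HasTimeDeriv U φ u t w then h.choose else 0

theorem hasTimeDeriv_timeDeriv {n : ℕ} {U : Set (Space n)} {φ : Space n → ℝ}
    {u : ℝ → Space n → ℝ} {t : ℝ} (h : ∃ w, HasTimeDeriv U φ u t w) :
    HasTimeDeriv U φ u t (timeDeriv U φ u t) := by
  rw [timeDeriv, dif_pos h]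
  exact h.choose_spec

/-- The energy `∫_U K(x,|q|) |q|² dx` of a vector field `q`. -/
def energy {n N : ℕ} (U : Set (Space n)) (α : Fin (N + 1) → ℝ)
    (a : Fin (N + 1) → Space n → ℝ) (q : Space n → Space n) : ℝ≥0∞ :=
  ∫⁻ x in U, ENNReal.ofReal (K α a x ‖q x‖ * ‖q x‖ ^ 2)

/-- `v = 0` on `∂U`: `v` is the limit of functions in `C_c^∞(U)`, in `L²_φ(U)` and,
for the gradients, in energy. -/
def VanishesOnBoundary {n N : ℕ} (U : Set (Space n)) (φ : Space n → ℝ) (α : Fin (N + 1) → ℝ)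
    (a : Fin (N + 1) → Space n → ℝ) (v : Space n → ℝ) : Prop :=
  ∃ η : ℕ → Space n → ℝ, (∀ k, IsTest U (η k)) ∧
    Tendsto (fun k => normSq U φ (fun x => η k x - v x)) atTop (𝓝 0) ∧
    Tendsto (fun k => energy U α a (fun x => gradient (η k) x - weakGrad U v x)) atTop (𝓝 0)

/-- Regularity in space and time: at each time `t > 0`, `∇u` exists and has finite energy,
`u_t` exists, has a weak gradient, and `∇(u_t)` is the time derivative of `∇u`
with respect to convergence in energy. -/
structure IsRegular {n N : ℕ} (U : Set (Space n)) (φ : Space n → ℝ) (α : Fin (N + 1) → ℝ)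
    (a : Fin (N + 1) → Space n → ℝ) (u : ℝ → Space n → ℝ) : Prop where
  grad : ∀ t, 0 < t → ∃ q, HasWeakGrad U (u t) q
  energy_lt_top : ∀ t, 0 < t → energy U α a (weakGrad U (u t)) < ⊤
  deriv : ∀ t, 0 < t → ∃ w, HasTimeDeriv U φ u t w
  grad_deriv : ∀ t, 0 < t → ∃ q, HasWeakGrad U (timeDeriv U φ u t) q
  deriv_grad : ∀ t, 0 < t →
    Tendsto (fun s => energy U α a (fun x =>
        (s - t)⁻¹ • (weakGrad U (u s) x - weakGrad U (u t) x)
          - weakGrad U (timeDeriv U φ u t) x))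
      (𝓝[≠] t) (𝓝 0)

/-- `p` is a solution of `φ p_t = ∇ · (K(x,|∇p|) ∇p)` on `U × (0,∞)` with the boundary values
of `Ψ` on `∂U × (0,∞)` and with `p(·,0) = p₀`. The equation holds in the sense of distributions
on `U` at each time `t > 0`. -/
structure IsSolution {n N : ℕ} (U : Set (Space n)) (φ : Space n → ℝ) (α : Fin (N + 1) → ℝ)
    (a : Fin (N + 1) → Space n → ℝ) (Ψ : ℝ → Space n → ℝ) (p₀ : Space n → ℝ)
    (p : ℝ → Space n → ℝ) : Prop where
  regular : IsRegular U φ α a p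
  memL2 : ∀ t, 0 ≤ t → MemL2 U φ (p t - Ψ t)
  equation : ∀ t, 0 < t → ∀ η : Space n → ℝ, IsTest U η → energy U α a (gradient η) < ⊤ →
    ∫ x in U, φ x * timeDeriv U φ p t x * η x =
      - ∫ x in U, K α a x ‖weakGrad U (p t) x‖ * inner ℝ (weakGrad U (p t) x) (gradient η x)
  boundary : ∀ t, 0 < t → VanishesOnBoundary U φ α a (p t - Ψ t)
  initial : ∀ᵐ x ∂(volume.restrict U), p 0 x = p₀ x
  continuous_zero :
    Tendsto (fun t => normSq U φ ((p t - Ψ t) - (p 0 - Ψ 0))) (𝓝[>] 0) (𝓝 0)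

/-- The two-weight Poincaré–Sobolev inequality for `u` with constant `c`:
`(∫_U φ |u|²)^{1/2} ≤ c (∫_U W₁ |∇u|^{2-a})^{1/(2-a)}`. -/
def PoincareSobolev {n N : ℕ} (U : Set (Space n)) (φ : Space n → ℝ) (α : Fin (N + 1) → ℝ)
    (a : Fin (N + 1) → Space n → ℝ) (c : ℝ) (u : Space n → ℝ) : Prop :=
  normSq U φ u ^ (1 / 2 : ℝ) ≤
    ENNReal.ofReal c *
      (∫⁻ x in U, ENNReal.ofReal (W1 α a x * ‖weakGrad U u x‖ ^ (2 - degExp α)))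
        ^ (1 / (2 - degExp α))

/-! ### The quantities measuring the boundary data -/

/-- `∫_U a₀(x)⁻¹ |q(x)|² dx`. -/
def darcySq {n N : ℕ} (U : Set (Space n)) (a : Fin (N + 1) → Space n → ℝ)
    (q : Space n → Space n) : ℝ≥0∞ :=
  ∫⁻ x in U, ENNReal.ofReal ((a 0 x)⁻¹ * ‖q x‖ ^ 2)

/-- `B_* = max {∫_U a_N dx, 1}`. -/
def BStar {n N : ℕ} (U : Set (Space n)) (a : Fin (N + 1) → Space n → ℝ) : ℝ≥0∞ :=
  max (∫⁻ x in U, ENNReal.ofReal (a (Fin.last N) x)) 1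

/-- `G[Ψ](t)`. -/
def G {n N : ℕ} (U : Set (Space n)) (φ : Space n → ℝ) (α : Fin (N + 1) → ℝ)
    (a : Fin (N + 1) → Space n → ℝ) (Ψ : ℝ → Space n → ℝ) (t : ℝ) : ℝ≥0∞ :=
  BStar U a + darcySq U a (weakGrad U (Ψ t))
    + (∫⁻ x in U, ENNReal.ofReal (W1 α a x * ‖weakGrad U (Ψ t) x‖ ^ (2 - degExp α)))
    + normSq U φ (timeDeriv U φ Ψ t) ^ ((2 - degExp α) / (2 * (1 - degExp α)))

/-- `G₁[Ψ](t)`. -/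
def G1 {n N : ℕ} (U : Set (Space n)) (φ : Space n → ℝ)
    (a : Fin (N + 1) → Space n → ℝ) (Ψ : ℝ → Space n → ℝ) (t : ℝ) : ℝ≥0∞ :=
  darcySq U a (weakGrad U (timeDeriv U φ Ψ t))

/-- `D(t)`, for `Φ = Ψ₁ - Ψ₂`. -/
def D {n N : ℕ} (U : Set (Space n)) (φ : Space n → ℝ)
    (a : Fin (N + 1) → Space n → ℝ) (Φ : ℝ → Space n → ℝ) (t : ℝ) : ℝ≥0∞ :=
  darcySq U a (weakGrad U (Φ t)) + darcySq U a (weakGrad U (Φ t)) ^ (1 / 2 : ℝ)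
    + normSq U φ (timeDeriv U φ Φ t) ^ (1 / 2 : ℝ)

/-- `𝓐̃ = limsup G[Ψ₁](t) + limsup G[Ψ₂](t)`. -/
def calA {n N : ℕ} (U : Set (Space n)) (φ : Space n → ℝ) (α : Fin (N + 1) → ℝ)
    (a : Fin (N + 1) → Space n → ℝ) (Ψ₁ Ψ₂ : ℝ → Space n → ℝ) : ℝ≥0∞ :=
  limsup (G U φ α a Ψ₁) atTop + limsup (G U φ α a Ψ₂) atTop

/-- `𝓖₁ = limsup G₁[Ψ₁](t) + limsup G₁[Ψ₂](t)`. -/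
def calG1 {n N : ℕ} (U : Set (Space n)) (φ : Space n → ℝ)
    (a : Fin (N + 1) → Space n → ℝ) (Ψ₁ Ψ₂ : ℝ → Space n → ℝ) : ℝ≥0∞ :=
  limsup (G1 U φ a Ψ₁) atTop + limsup (G1 U φ a Ψ₂) atTop

/-- `𝓓 = limsup D(t)`. -/
def calD {n N : ℕ} (U : Set (Space n)) (φ : Space n → ℝ)
    (a : Fin (N + 1) → Space n → ℝ) (Ψ₁ Ψ₂ : ℝ → Space n → ℝ) : ℝ≥0∞ :=
  limsup (D U φ a (Ψ₁ - Ψ₂)) atTop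

/-- `κ₀ = (2 + a) / (2 (2 - a))`. -/
def kappa {N : ℕ} (α : Fin (N + 1) → ℝ) : ℝ :=
  (2 + degExp α) / (2 * (2 - degExp α))

end Forchheimer

end

/-!
Testing the equation of `pᵢ` with `p̄ᵢ` bounds `∂ₜ‖p̄ᵢ‖²` by minus the energy of `∇pᵢ` plus terms
in the data `G[Ψᵢ]`. The weighted Poincaré–Sobolev inequality bounds the power `2 - a > 1` of
`‖p̄ᵢ‖` by that energy, so `‖p̄ᵢ‖` eventually enters a ball whose radius depends on the data only.
Testing with `∂ₜp̄ᵢ` controls the time derivative of the integral of the convex potential of the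
flux, which is comparable with the energy. The sum of this integral and `‖p̄ᵢ‖²` is then a Lyapunov
function, and for large times it is bounded by a multiple of `X`, which is `𝓐̃^{2/(2-a)} + 𝓖₁` up
to a constant.

For the difference, the flux `K(x,|q|) q` is strongly monotone with modulus
`(1 - a) K(x, max(|q|,|r|))`. The modulus degenerates for large gradients, but Young's inequality
with an optimised parameter and the energy bounds turn the Poincaré–Sobolev inequality into
`‖P̄‖² ≲ X^{a/(2-a)} (J + D)`, where `J` is the dissipation. The boundary data contribute terms of
size `√X D` to the derivative of `‖P̄‖²`, so `‖P̄‖²` decreases at a definite rate as long as it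
exceeds a multiple of `X^{a/(2-a)} √X D = X^{κ₀} D`.
-/

namespace Forchheimer

section ConstitutiveLaw

variable {n N : ℕ} {U : Set (Space n)} {α : Fin (N + 1) → ℝ} {a : Fin (N + 1) → Space n → ℝ}
  {x : Space n} {s t ξ ζ : ℝ}

theorem rpow_sub_rpow_le_mul_sub {p : ℝ} (hp : 1 ≤ p) (hs : 0 ≤ s) (ht : 0 ≤ t) :
    s ^ p - t ^ p ≤ p * s ^ (p - 1) * (s - t) := by
  have hderiv := Real.hasDerivAt_rpow_const (x := s) (Or.inr hp)
  rcases lt_trichotomy t s with h | rfl | h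
  · have hslope := (convexOn_rpow hp).slope_le_of_hasDerivAt ht hs h hderiv
    rwa [slope_def_field, div_le_iff₀ (sub_pos.2 h)] at hslope
  · simp
  · have hslope := (convexOn_rpow hp).le_slope_of_hasDerivAt hs ht h hderiv
    rw [slope_def_field, le_div_iff₀ (sub_pos.2 h)] at hslope
    linarith

theorem IsExponents.nonneg (hα : IsExponents α) (i : Fin (N + 1)) : 0 ≤ α i :=
  hα.zero ▸ hα.strictMono.monotone (Fin.zero_le i)

theorem IsExponents.le_last (hα : IsExponents α) (i : Fin (N + 1)) : α i ≤ α (Fin.last N) :=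
  hα.strictMono.monotone (Fin.le_last i)

theorem IsExponents.last_pos (hα : IsExponents α) : 0 < α (Fin.last N) := by
  have hlast : (0 : Fin (N + 1)) < Fin.last N := by
    simpa [Fin.lt_def] using Nat.lt_of_succ_le hα.one_le
  simpa only [hα.zero] using hα.strictMono hlast

theorem degExp_pos (hα : IsExponents α) : 0 < degExp α :=
  div_pos hα.last_pos (by linarith [hα.last_pos])

theorem degExp_lt_one (hα : IsExponents α) : degExp α < 1 :=
  (div_lt_one (by linarith [hα.last_pos])).2 (lt_add_one _)

theorem one_sub_degExp (hα : IsExponents α) : 1 - degExp α = (α (Fin.last N) + 1)⁻¹ := by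
  have := hα.last_pos
  rw [degExp]
  field_simp
  ring

theorem g_mono (hα : IsExponents α) (ha : IsCoeff U a) (hx : x ∈ U) (hs : 0 ≤ s) (hst : s ≤ t) :
    g α a x s ≤ g α a x t :=
  Finset.sum_le_sum fun i _ =>
    mul_le_mul_of_nonneg_left (Real.rpow_le_rpow hs hst (hα.nonneg i)) (ha.nonneg i x hx)

theorem coeff_mul_rpow_le_g (ha : IsCoeff U a) (hx : x ∈ U) (hs : 0 ≤ s) (i : Fin (N + 1)) :
    a i x * s ^ α i ≤ g α a x s :=
  Finset.single_le_sum (f := fun i => a i x * s ^ α i)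
    (fun i _ => mul_nonneg (ha.nonneg i x hx) (Real.rpow_nonneg hs _)) (Finset.mem_univ i)

theorem coeff_zero_le_g (hα : IsExponents α) (ha : IsCoeff U a) (hx : x ∈ U) (hs : 0 ≤ s) :
    a 0 x ≤ g α a x s := by
  simpa [hα.zero] using coeff_mul_rpow_le_g (α := α) ha hx hs 0

theorem g_pos (hα : IsExponents α) (ha : IsCoeff U a) (hx : x ∈ U) (hs : 0 ≤ s) :
    0 < g α a x s :=
  (ha.pos_zero x hx).trans_le (coeff_zero_le_g hα ha hx hs)

theorem mul_g_strictMonoOn (hα : IsExponents α) (ha : IsCoeff U a) (hx : x ∈ U) :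
    StrictMonoOn (fun s => s * g α a x s) (Ici 0) := fun s hs t _ hst =>
  calc s * g α a x s ≤ s * g α a x t := mul_le_mul_of_nonneg_left (g_mono hα ha hx hs hst.le) hs
    _ < t * g α a x t := mul_lt_mul_of_pos_right hst (g_pos hα ha hx (hs.trans hst.le))

theorem root_nonneg (hα : IsExponents α) (ha : IsCoeff U a) (hx : x ∈ U) (hξ : 0 ≤ ξ) :
    0 ≤ root α a x ξ :=
  (root_spec hα ha hx hξ).1

theorem root_mul_g (hα : IsExponents α) (ha : IsCoeff U a) (hx : x ∈ U) (hξ : 0 ≤ ξ) :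
    root α a x ξ * g α a x (root α a x ξ) = ξ :=
  (root_spec hα ha hx hξ).2

theorem root_le_iff (hα : IsExponents α) (ha : IsCoeff U a) (hx : x ∈ U) (hξ : 0 ≤ ξ)
    (hs : 0 ≤ s) : root α a x ξ ≤ s ↔ ξ ≤ s * g α a x s := by
  conv_rhs => rw [← root_mul_g hα ha hx hξ]
  exact ((mul_g_strictMonoOn hα ha hx).le_iff_le (root_nonneg hα ha hx hξ) hs).symm

theorem root_mono (hα : IsExponents α) (ha : IsCoeff U a) (hx : x ∈ U) (hξ : 0 ≤ ξ)
    (h : ξ ≤ ζ) : root α a x ξ ≤ root α a x ζ := by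
  have hζ := hξ.trans h
  rwa [root_le_iff hα ha hx hξ (root_nonneg hα ha hx hζ), root_mul_g hα ha hx hζ]

theorem K_pos (hα : IsExponents α) (ha : IsCoeff U a) (hx : x ∈ U) (hξ : 0 ≤ ξ) :
    0 < K α a x ξ :=
  one_div_pos.2 (g_pos hα ha hx (root_nonneg hα ha hx hξ))

theorem K_mul_self (hα : IsExponents α) (ha : IsCoeff U a) (hx : x ∈ U) (hξ : 0 ≤ ξ) :
    K α a x ξ * ξ = root α a x ξ := by
  have hg := g_pos hα ha hx (root_nonneg hα ha hx hξ)
  rw [K, one_div, inv_mul_eq_iff_eq_mul₀ hg.ne', mul_comm, root_mul_g hα ha hx hξ]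

theorem K_anti (hα : IsExponents α) (ha : IsCoeff U a) (hx : x ∈ U) (hξ : 0 ≤ ξ) (h : ξ ≤ ζ) :
    K α a x ζ ≤ K α a x ξ :=
  one_div_le_one_div_of_le (g_pos hα ha hx (root_nonneg hα ha hx hξ))
    (g_mono hα ha hx (root_nonneg hα ha hx hξ) (root_mono hα ha hx hξ h))

theorem K_le_inv_coeff_zero (hα : IsExponents α) (ha : IsCoeff U a) (hx : x ∈ U) (hξ : 0 ≤ ξ) :
    K α a x ξ ≤ (a 0 x)⁻¹ := by
  rw [← one_div]
  exact one_div_le_one_div_of_le (ha.pos_zero x hx)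
    (coeff_zero_le_g hα ha hx (root_nonneg hα ha hx hξ))

theorem K_mul_sq_nonneg (hα : IsExponents α) (ha : IsCoeff U a) (hx : x ∈ U) (hξ : 0 ≤ ξ) :
    0 ≤ K α a x ξ * ξ ^ 2 :=
  mul_nonneg (K_pos hα ha hx hξ).le (sq_nonneg _)

theorem K_mul_sq (hα : IsExponents α) (ha : IsCoeff U a) (hx : x ∈ U) (hξ : 0 ≤ ξ) :
    K α a x ξ * ξ ^ 2 = root α a x ξ * ξ := by
  rw [sq, ← mul_assoc, K_mul_self hα ha hx hξ]

theorem K_mul_sq_mono (hα : IsExponents α) (ha : IsCoeff U a) (hx : x ∈ U) (hξ : 0 ≤ ξ)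
    (h : ξ ≤ ζ) : K α a x ξ * ξ ^ 2 ≤ K α a x ζ * ζ ^ 2 := by
  rw [K_mul_sq hα ha hx hξ, K_mul_sq hα ha hx (hξ.trans h)]
  exact mul_le_mul (root_mono hα ha hx hξ h) h hξ (root_nonneg hα ha hx (hξ.trans h))

theorem root_mul_le (hα : IsExponents α) (ha : IsCoeff U a) (hx : x ∈ U) {c : ℝ} (hc : 0 ≤ c)
    (hc1 : c ≤ 1) (hξ : 0 ≤ ξ) : root α a x (c * ξ) ≤ c ^ (1 - degExp α) * root α a x ξ := by
  have hs := root_nonneg hα ha hx hξ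
  have hσ : 0 ≤ c ^ (1 - degExp α) := Real.rpow_nonneg hc _
  have hσ1 : c ^ (1 - degExp α) ≤ 1 :=
    Real.rpow_le_one hc hc1 (sub_nonneg.2 (degExp_lt_one hα).le)
  have hc_eq : c ^ (1 - degExp α) * (c ^ (1 - degExp α)) ^ α (Fin.last N) = c := by
    have hL := hα.last_pos
    rw [mul_comm, ← Real.rpow_add_one' hσ (by linarith), ← Real.rpow_mul hc, one_sub_degExp hα,
      inv_mul_cancel₀ (by linarith), Real.rpow_one]
  rw [root_le_iff hα ha hx (mul_nonneg hc hξ) (mul_nonneg hσ hs)]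
  set σ := c ^ (1 - degExp α)
  set s := root α a x ξ with hs_def
  calc c * ξ = σ * s * (σ ^ α (Fin.last N) * g α a x s) := by
        nth_rw 1 [← hc_eq, ← root_mul_g hα ha hx hξ, ← hs_def]; ring
    _ ≤ σ * s * g α a x (σ * s) := by
        gcongr
        simp only [g, Finset.mul_sum]
        refine Finset.sum_le_sum fun i _ => ?_
        rw [Real.mul_rpow hσ hs, mul_left_comm]
        have hpow : σ ^ α (Fin.last N) ≤ σ ^ α i :=
          Real.rpow_le_rpow_of_exponent_ge' hσ hσ1 (hα.nonneg i) (hα.le_last i)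
        have := ha.nonneg i x hx
        gcongr

theorem K_mul_mul_sq_le (hα : IsExponents α) (ha : IsCoeff U a) (hx : x ∈ U) {c : ℝ}
    (hc : 0 ≤ c) (hξ : 0 ≤ ξ) :
    K α a x (c * ξ) * (c * ξ) ^ 2 ≤ (c ^ (2 - degExp α) + c ^ 2) * (K α a x ξ * ξ ^ 2) := by
  have hE := K_mul_sq_nonneg hα ha hx hξ
  have hcξ := mul_nonneg hc hξ
  have hpow : 0 ≤ c ^ (2 - degExp α) := Real.rpow_nonneg hc _
  rcases le_total c 1 with h | h
  · have he := degExp_lt_one hα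
    calc K α a x (c * ξ) * (c * ξ) ^ 2 = root α a x (c * ξ) * (c * ξ) := K_mul_sq hα ha hx hcξ
      _ ≤ c ^ (1 - degExp α) * root α a x ξ * (c * ξ) := by
          gcongr
          exact root_mul_le hα ha hx hc h hξ
      _ = c ^ (1 - degExp α) * c * (K α a x ξ * ξ ^ 2) := by rw [K_mul_sq hα ha hx hξ]; ring
      _ = c ^ (2 - degExp α) * (K α a x ξ * ξ ^ 2) := by
          rw [← Real.rpow_add_one' hc (by linarith)]; ring_nf
      _ ≤ _ := by gcongr; exact le_add_of_nonneg_right (sq_nonneg c)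
  · have hK := K_anti hα ha hx hξ (le_mul_of_one_le_left hξ h)
    calc K α a x (c * ξ) * (c * ξ) ^ 2 ≤ K α a x ξ * (c * ξ) ^ 2 := by gcongr
      _ = c ^ 2 * (K α a x ξ * ξ ^ 2) := by ring
      _ ≤ _ := by gcongr; exact le_add_of_nonneg_left hpow

/- Young's inequality for the degenerate energy: either `ζ ≤ δ ξ`, or `ξ ≤ δ⁻¹ ζ` and then
`K(ξ) ξ ≤ K(δ⁻¹ ζ) δ⁻¹ ζ ≤ δ⁻¹ K(ζ) ζ`. -/
theorem K_mul_mul_le_add (hα : IsExponents α) (ha : IsCoeff U a) (hx : x ∈ U) {δ : ℝ}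
    (hδ : 0 < δ) (hδ1 : δ ≤ 1) (hξ : 0 ≤ ξ) (hζ : 0 ≤ ζ) :
    K α a x ξ * (ξ * ζ) ≤ δ * (K α a x ξ * ξ ^ 2) + δ⁻¹ * (K α a x ζ * ζ ^ 2) := by
  have hK := K_pos hα ha hx hξ
  have hξE := mul_nonneg hδ.le (K_mul_sq_nonneg hα ha hx hξ)
  have hζE := mul_nonneg (inv_nonneg.2 hδ.le) (K_mul_sq_nonneg hα ha hx hζ)
  rcases le_total ζ (δ * ξ) with h | h
  · calc K α a x ξ * (ξ * ζ) ≤ K α a x ξ * (ξ * (δ * ξ)) := by gcongr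
      _ = δ * (K α a x ξ * ξ ^ 2) := by ring
      _ ≤ _ := le_add_of_nonneg_right hζE
  · have hδζ : 0 ≤ δ⁻¹ * ζ := by positivity
    have hflux : K α a x ξ * ξ ≤ K α a x (δ⁻¹ * ζ) * (δ⁻¹ * ζ) := by
      rw [K_mul_self hα ha hx hξ, K_mul_self hα ha hx hδζ]
      exact root_mono hα ha hx hξ (by rwa [inv_mul_eq_div, le_div_iff₀' hδ])
    have hKζ : K α a x (δ⁻¹ * ζ) ≤ K α a x ζ :=
      K_anti hα ha hx hζ (le_mul_of_one_le_left hζ ((one_le_inv₀ hδ).2 hδ1))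
    calc K α a x ξ * (ξ * ζ) = K α a x ξ * ξ * ζ := by ring
      _ ≤ K α a x (δ⁻¹ * ζ) * (δ⁻¹ * ζ) * ζ := by gcongr
      _ ≤ K α a x ζ * (δ⁻¹ * ζ) * ζ := by gcongr
      _ = δ⁻¹ * (K α a x ζ * ζ ^ 2) := by ring
      _ ≤ _ := le_add_of_nonneg_left hξE

theorem K_norm_add_mul_sq_le {E : Type*} [SeminormedAddGroup E] (hα : IsExponents α)
    (ha : IsCoeff U a) (hx : x ∈ U) (u v : E) :
    K α a x ‖u + v‖ * ‖u + v‖ ^ 2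
      ≤ 4 * (K α a x ‖u‖ * ‖u‖ ^ 2 + K α a x ‖v‖ * ‖v‖ ^ 2) := by
  have hmax : 0 ≤ max ‖u‖ ‖v‖ := le_max_of_le_left (norm_nonneg u)
  have hadd : ‖u + v‖ ≤ 2 * max ‖u‖ ‖v‖ := by
    linarith [norm_add_le u v, le_max_left ‖u‖ ‖v‖, le_max_right ‖u‖ ‖v‖]
  have hE : K α a x (max ‖u‖ ‖v‖) * max ‖u‖ ‖v‖ ^ 2
      ≤ K α a x ‖u‖ * ‖u‖ ^ 2 + K α a x ‖v‖ * ‖v‖ ^ 2 := by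
    rcases max_choice ‖u‖ ‖v‖ with h | h <;> rw [h]
    · exact le_add_of_nonneg_right (K_mul_sq_nonneg hα ha hx (norm_nonneg v))
    · exact le_add_of_nonneg_left (K_mul_sq_nonneg hα ha hx (norm_nonneg u))
  calc K α a x ‖u + v‖ * ‖u + v‖ ^ 2
      ≤ K α a x (2 * max ‖u‖ ‖v‖) * (2 * max ‖u‖ ‖v‖) ^ 2 :=
        K_mul_sq_mono hα ha hx (norm_nonneg _) hadd
    _ ≤ K α a x (max ‖u‖ ‖v‖) * (2 * max ‖u‖ ‖v‖) ^ 2 := by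
        gcongr
        exact K_anti hα ha hx hmax (by linarith)
    _ = 4 * (K α a x (max ‖u‖ ‖v‖) * max ‖u‖ ‖v‖ ^ 2) := by ring
    _ ≤ _ := by gcongr

theorem mul_g_sub_mul_g_le (hα : IsExponents α) (ha : IsCoeff U a) (hx : x ∈ U) (ht : 0 ≤ t)
    (hts : t ≤ s) :
    s * g α a x s - t * g α a x t ≤ (α (Fin.last N) + 1) * g α a x s * (s - t) := by
  have hs := ht.trans hts
  simp only [g, Finset.mul_sum, Finset.sum_mul, ← Finset.sum_sub_distrib]
  refine Finset.sum_le_sum fun i _ => ?_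
  have hi := hα.nonneg i
  have htangent := rpow_sub_rpow_le_mul_sub (p := α i + 1) (by linarith) hs ht
  rw [add_sub_cancel_right, Real.rpow_add_one' hs (by linarith),
    Real.rpow_add_one' ht (by linarith)] at htangent
  have hlast : (α i + 1) * s ^ α i * (s - t) ≤ (α (Fin.last N) + 1) * s ^ α i * (s - t) :=
    mul_le_mul_of_nonneg_right (mul_le_mul_of_nonneg_right
      (by linarith [hα.le_last i]) (Real.rpow_nonneg hs _)) (sub_nonneg.2 hts)
  linarith [mul_le_mul_of_nonneg_left (htangent.trans hlast) (ha.nonneg i x hx)]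

theorem le_root_sub_root (hα : IsExponents α) (ha : IsCoeff U a) (hx : x ∈ U) (hζ : 0 ≤ ζ)
    (h : ζ ≤ ξ) :
    (1 - degExp α) * K α a x ξ * (ξ - ζ) ≤ root α a x ξ - root α a x ζ := by
  have hξ := hζ.trans h
  have hL := hα.last_pos
  have hg := g_pos hα ha hx (root_nonneg hα ha hx hξ)
  have hsub := mul_g_sub_mul_g_le hα ha hx (root_nonneg hα ha hx hζ) (root_mono hα ha hx hζ h)
  rw [root_mul_g hα ha hx hξ, root_mul_g hα ha hx hζ] at hsub
  rw [one_sub_degExp hα, K, mul_one_div, inv_eq_one_div, div_div, div_mul_eq_mul_div, one_mul,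
    div_le_iff₀ (by positivity)]
  linarith

theorem flux_strongly_monotone {E : Type*} [NormedAddCommGroup E] [InnerProductSpace ℝ E]
    (hα : IsExponents α) (ha : IsCoeff U a) (hx : x ∈ U) (u v : E) :
    (1 - degExp α) * (K α a x (max ‖u‖ ‖v‖) * ‖u - v‖ ^ 2)
      ≤ K α a x ‖u‖ * inner ℝ u (u - v) - K α a x ‖v‖ * inner ℝ v (u - v) := by
  wlog huv : ‖v‖ ≤ ‖u‖ generalizing u v
  · have hswap := this v u (le_of_not_ge huv)
    rw [max_comm, norm_sub_rev, ← neg_sub u v, inner_neg_right, inner_neg_right] at hswap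
    linarith
  rw [max_eq_left huv, inner_sub_right, inner_sub_right, real_inner_self_eq_norm_sq,
    real_inner_self_eq_norm_sq, real_inner_comm, norm_sub_sq_real, real_inner_comm v u]
  have hroot := le_root_sub_root hα ha hx (norm_nonneg v) huv
  rw [← K_mul_self hα ha hx (norm_nonneg u), ← K_mul_self hα ha hx (norm_nonneg v)] at hroot
  -- The bound is affine in `⟪v, u⟫` with this non-negative slope, so the worst case is
  -- `⟪v, u⟫ = ‖v‖ ‖u‖`, where it is the scalar inequality `hroot`.
  have hslope : 0 ≤ K α a x ‖v‖ - K α a x ‖u‖ + 2 * degExp α * K α a x ‖u‖ := by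
    have := mul_pos (degExp_pos hα) (K_pos hα ha hx (norm_nonneg u))
    linarith [K_anti hα ha hx (norm_nonneg v) huv]
  linarith [mul_le_mul_of_nonneg_right hroot (sub_nonneg.2 huv),
    mul_le_mul_of_nonneg_left (real_inner_le_norm v u) hslope]

theorem flux_sub_flux_le {E : Type*} [NormedAddCommGroup E] [InnerProductSpace ℝ E]
    (hα : IsExponents α) (ha : IsCoeff U a) (hx : x ∈ U) (u v : E) :
    K α a x ‖u‖ * inner ℝ u (u - v) - K α a x ‖v‖ * inner ℝ v (u - v)
      ≤ 4 * (K α a x ‖u - v‖ * ‖u - v‖ ^ 2) := by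
  wlog huv : ‖v‖ ≤ ‖u‖ generalizing u v
  · have hswap := this v u (le_of_not_ge huv)
    rw [norm_sub_rev, ← neg_sub u v, inner_neg_right, inner_neg_right] at hswap
    linarith
  have hKu := K_pos hα ha hx (norm_nonneg u)
  have hw := norm_nonneg (u - v)
  have hflux : (K α a x ‖v‖ - K α a x ‖u‖) * ‖v‖ ≤ K α a x ‖u‖ * ‖u - v‖ := by
    have hroot := root_mono hα ha hx (norm_nonneg v) huv
    rw [← K_mul_self hα ha hx (norm_nonneg u), ← K_mul_self hα ha hx (norm_nonneg v)] at hroot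
    linarith [mul_le_mul_of_nonneg_left (norm_sub_norm_le u v) hKu.le]
  have hinner : -((K α a x ‖v‖ - K α a x ‖u‖) * inner ℝ v (u - v))
      ≤ (K α a x ‖v‖ - K α a x ‖u‖) * (‖v‖ * ‖u - v‖) := by
    rw [← mul_neg]
    exact mul_le_mul_of_nonneg_left ((neg_le_abs _).trans (abs_real_inner_le_norm _ _))
      (sub_nonneg.2 (K_anti hα ha hx (norm_nonneg v) huv))
  have hK : K α a x ‖u‖ * ‖u - v‖ ≤ 2 * (K α a x ‖u - v‖ * ‖u - v‖) := by
    have hhalf : 0 ≤ ‖u - v‖ / 2 := by positivity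
    have hroot := root_mono hα ha hx hhalf (half_le_self hw)
    rw [← K_mul_self hα ha hx hw, ← K_mul_self hα ha hx hhalf] at hroot
    have hanti := K_anti hα ha hx hhalf (ζ := ‖u‖) (by linarith [norm_sub_le u v])
    linarith [mul_le_mul_of_nonneg_right hanti hw]
  have hexpand : inner ℝ u (u - v) = ‖u - v‖ ^ 2 + inner ℝ v (u - v) := by
    rw [← real_inner_self_eq_norm_sq, ← inner_add_left, sub_add_cancel]
  rw [hexpand]
  nlinarith [mul_le_mul_of_nonneg_right hflux hw, mul_le_mul_of_nonneg_right hK hw]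

/-- The potential `h(x,ξ) = ∫₀^ξ K(x,σ) σ dσ` of the flux. It is written in the closed form
`ξ s - ∫₀ˢ τ g(x,τ) dτ` with `s = s(x,ξ)`, which makes its measurability in `x` evident. -/
noncomputable def potential (α : Fin (N + 1) → ℝ) (a : Fin (N + 1) → Space n → ℝ)
    (x : Space n) (ξ : ℝ) : ℝ :=
  root α a x ξ * ξ - ∑ i, a i x * (root α a x ξ ^ (α i + 2) / (α i + 2))

theorem potential_sub_le (hα : IsExponents α) (ha : IsCoeff U a) (hx : x ∈ U) (hξ : 0 ≤ ξ)
    (hζ : 0 ≤ ζ) : potential α a x ξ - potential α a x ζ ≤ root α a x ξ * (ξ - ζ) := by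
  rw [potential, potential]
  have hs := root_nonneg hα ha hx hξ
  have ht := root_nonneg hα ha hx hζ
  have hroot := root_mul_g hα ha hx hζ
  set s := root α a x ξ
  set t := root α a x ζ
  suffices ∑ i, a i x * (t ^ (α i + 2) / (α i + 2)) - ∑ i, a i x * (s ^ (α i + 2) / (α i + 2))
      ≤ (t - s) * ζ by linarith
  simp only [← hroot, g, ← Finset.sum_sub_distrib, Finset.mul_sum]
  refine Finset.sum_le_sum fun i _ => ?_
  have hi := hα.nonneg i
  have htangent := rpow_sub_rpow_le_mul_sub (p := α i + 2) (by linarith) ht hs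
  rw [show α i + 2 - 1 = α i + 1 by ring, Real.rpow_add_one' ht (by linarith)] at htangent
  have hdiv : t ^ (α i + 2) / (α i + 2) - s ^ (α i + 2) / (α i + 2) ≤ t ^ α i * t * (t - s) := by
    rw [← sub_div, div_le_iff₀ (by linarith)]
    linarith
  linarith [mul_le_mul_of_nonneg_left hdiv (ha.nonneg i x hx)]

theorem potential_le_K_mul_sq (hα : IsExponents α) (ha : IsCoeff U a) (hx : x ∈ U)
    (hξ : 0 ≤ ξ) : potential α a x ξ ≤ K α a x ξ * ξ ^ 2 := by
  rw [K_mul_sq hα ha hx hξ, potential]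
  exact sub_le_self _ (Finset.sum_nonneg fun i _ => mul_nonneg (ha.nonneg i x hx)
    (div_nonneg (Real.rpow_nonneg (root_nonneg hα ha hx hξ) _) (by linarith [hα.nonneg i])))

theorem K_mul_sq_le_two_mul_potential (hα : IsExponents α) (ha : IsCoeff U a) (hx : x ∈ U)
    (hξ : 0 ≤ ξ) : K α a x ξ * ξ ^ 2 ≤ 2 * potential α a x ξ := by
  rw [K_mul_sq hα ha hx hξ, potential]
  have hs := root_nonneg hα ha hx hξ
  have hroot := root_mul_g hα ha hx hξ
  set s := root α a x ξ
  suffices ∑ i, a i x * (s ^ (α i + 2) / (α i + 2)) ≤ s * ξ / 2 by linarith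
  rw [← hroot, g, Finset.mul_sum, Finset.mul_sum, Finset.sum_div]
  refine Finset.sum_le_sum fun i _ => ?_
  have hi := hα.nonneg i
  have hpow : s ^ (α i + 2) = s ^ α i * s ^ 2 := by
    rw [Real.rpow_add_of_nonneg hs hi zero_le_two, Real.rpow_two]
  calc a i x * (s ^ (α i + 2) / (α i + 2)) ≤ a i x * (s ^ (α i + 2) / 2) := by
        have := ha.nonneg i x hx
        gcongr
        linarith
    _ = s * (s * (a i x * s ^ α i)) / 2 := by rw [hpow]; ring

theorem potential_norm_sub_le {E : Type*} [SeminormedAddCommGroup E] [InnerProductSpace ℝ E]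
    (hα : IsExponents α) (ha : IsCoeff U a) (hx : x ∈ U) (u v : E) :
    potential α a x ‖u‖ - potential α a x ‖v‖ ≤ K α a x ‖u‖ * inner ℝ u (u - v) := by
  have hconvex := potential_sub_le hα ha hx (norm_nonneg u) (norm_nonneg v)
  rw [← K_mul_self hα ha hx (norm_nonneg u)] at hconvex
  rw [inner_sub_right, real_inner_self_eq_norm_sq]
  linarith [mul_le_mul_of_nonneg_left (real_inner_le_norm u v) (K_pos hα ha hx (norm_nonneg u)).le]

theorem coeff_le_maxCoeff (i : Fin (N + 1)) : a i x ≤ maxCoeff a x :=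
  Finset.le_sup' (fun j => a j x) (Finset.mem_univ i)

theorem maxCoeff_pos (ha : IsCoeff U a) (hx : x ∈ U) : 0 < maxCoeff a x :=
  (ha.pos_zero x hx).trans_le (coeff_le_maxCoeff 0)

theorem W1_pos (hα : IsExponents α) (ha : IsCoeff U a) (hx : x ∈ U) : 0 < W1 α a x := by
  have hM := maxCoeff_pos ha hx
  have hb := ha.pos_last x hx
  have hN : (0 : ℝ) < N := by exact_mod_cast hα.one_le
  rw [W1]
  positivity

theorem coeff_last_rpow_mul_root_rpow_le (hα : IsExponents α) (ha : IsCoeff U a) (hx : x ∈ U)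
    (hξ : 0 ≤ ξ) :
    a (Fin.last N) x ^ degExp α * root α a x ξ ^ α (Fin.last N) ≤ ξ ^ degExp α := by
  have hs := root_nonneg hα ha hx hξ
  have hroot := root_mul_g hα ha hx hξ
  have hL := hα.last_pos
  have hb := ha.pos_last x hx
  set s := root α a x ξ
  have hterm : a (Fin.last N) x * s ^ (α (Fin.last N) + 1) ≤ ξ := by
    rw [Real.rpow_add_one' hs (by linarith), ← mul_assoc, mul_comm, ← hroot]
    exact mul_le_mul_of_nonneg_left (coeff_mul_rpow_le_g ha hx hs _) hs
  have hpow := Real.rpow_le_rpow (by positivity) hterm (degExp_pos hα).le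
  rwa [Real.mul_rpow hb.le (by positivity), ← Real.rpow_mul hs, degExp,
    mul_div_cancel₀ _ (by linarith)] at hpow

theorem g_le_maxCoeff_mul (hα : IsExponents α) (ha : IsCoeff U a) (hx : x ∈ U) (hs : 0 ≤ s) :
    g α a x s ≤ (N + 1) * (maxCoeff a x * (s ^ α (Fin.last N) + 1)) := by
  have hterm (i : Fin (N + 1)) : a i x * s ^ α i ≤ maxCoeff a x * (s ^ α (Fin.last N) + 1) := by
    refine mul_le_mul (coeff_le_maxCoeff i) ?_ (Real.rpow_nonneg hs _) (maxCoeff_pos ha hx).le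
    rcases le_total s 1 with h | h
    · linarith [Real.rpow_le_one hs h (hα.nonneg i), Real.rpow_nonneg hs (α (Fin.last N))]
    · linarith [Real.rpow_le_rpow_of_exponent_le h (hα.le_last i)]
  simpa [g] using Finset.sum_le_card_nsmul Finset.univ _ _ fun i _ => hterm i

theorem W1_le_K_mul (hα : IsExponents α) (ha : IsCoeff U a) (hx : x ∈ U) (hξ : 0 ≤ ξ) :
    W1 α a x ≤ K α a x ξ * (ξ ^ degExp α + a (Fin.last N) x ^ degExp α) := by
  have hs := root_nonneg hα ha hx hξ
  have hM := maxCoeff_pos ha hx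
  have hb := Real.rpow_pos_of_pos (ha.pos_last x hx) (degExp α)
  have hN : (1 : ℝ) ≤ N := by exact_mod_cast hα.one_le
  have hL := coeff_last_rpow_mul_root_rpow_le hα ha hx hξ
  rw [W1, K, one_div, inv_mul_eq_div, div_le_div_iff₀ (by positivity) (g_pos hα ha hx hs)]
  set s := root α a x ξ
  set b := a (Fin.last N) x ^ degExp α
  calc b * g α a x s ≤ b * ((N + 1) * (maxCoeff a x * (s ^ α (Fin.last N) + 1))) := by
        gcongr
        exact g_le_maxCoeff_mul hα ha hx hs
    _ ≤ b * ((N + N) * (maxCoeff a x * (s ^ α (Fin.last N) + 1))) := by gcongr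
    _ = (b * s ^ α (Fin.last N) + b) * (2 * N * maxCoeff a x) := by ring
    _ ≤ _ := by gcongr

theorem W1_le_two_mul_K_mul_max_rpow (hα : IsExponents α) (ha : IsCoeff U a) (hx : x ∈ U)
    (hξ : 0 ≤ ξ) :
    W1 α a x ≤ 2 * (K α a x ξ * max ξ (a (Fin.last N) x) ^ degExp α) := by
  have hK := K_pos hα ha hx hξ
  have hb := (ha.pos_last x hx).le
  have he := degExp_pos hα
  calc W1 α a x ≤ K α a x ξ * (ξ ^ degExp α + a (Fin.last N) x ^ degExp α) :=
        W1_le_K_mul hα ha hx hξ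
    _ ≤ K α a x ξ * (max ξ (a (Fin.last N) x) ^ degExp α
          + max ξ (a (Fin.last N) x) ^ degExp α) := by
        gcongr
        exacts [le_max_left _ _, le_max_right _ _]
    _ = _ := by ring

theorem rpow_mul_rpow_two_sub {y e : ℝ} (hy : 0 ≤ y) : y ^ e * y ^ (2 - e) = y ^ 2 := by
  rw [← Real.rpow_add' hy (by norm_num), add_sub_cancel, Real.rpow_two]

theorem W1_mul_coeff_last_rpow_le (hα : IsExponents α) (ha : IsCoeff U a) (hx : x ∈ U) :
    W1 α a x * a (Fin.last N) x ^ (2 - degExp α) ≤ a (Fin.last N) x := by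
  have hM := maxCoeff_pos ha hx
  have hb := ha.pos_last x hx
  have hN : (1 : ℝ) ≤ N := by exact_mod_cast hα.one_le
  rw [W1, div_mul_eq_mul_div, rpow_mul_rpow_two_sub hb.le, div_le_iff₀ (by positivity)]
  calc a (Fin.last N) x ^ 2 = a (Fin.last N) x * a (Fin.last N) x := sq _
    _ ≤ a (Fin.last N) x * maxCoeff a x := by gcongr; exact coeff_le_maxCoeff _
    _ ≤ a (Fin.last N) x * (2 * N * maxCoeff a x) := by
        gcongr
        exact le_mul_of_one_le_left hM.le (by linarith)

theorem W1_mul_rpow_le (hα : IsExponents α) (ha : IsCoeff U a) (hx : x ∈ U) (hξ : 0 ≤ ξ) :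
    W1 α a x * ξ ^ (2 - degExp α) ≤ 2 * (K α a x ξ * ξ ^ 2) + a (Fin.last N) x := by
  have he := degExp_lt_one hα
  have hW := W1_pos hα ha hx
  have hE := K_mul_sq_nonneg hα ha hx hξ
  have hb := ha.pos_last x hx
  rcases le_total ξ (a (Fin.last N) x) with h | h
  · calc W1 α a x * ξ ^ (2 - degExp α)
        ≤ W1 α a x * a (Fin.last N) x ^ (2 - degExp α) := by gcongr; linarith
      _ ≤ a (Fin.last N) x := W1_mul_coeff_last_rpow_le hα ha hx
      _ ≤ _ := by linarith
  · have hWK := W1_le_two_mul_K_mul_max_rpow hα ha hx hξ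
    rw [max_eq_left h] at hWK
    calc W1 α a x * ξ ^ (2 - degExp α)
        ≤ 2 * (K α a x ξ * ξ ^ degExp α) * ξ ^ (2 - degExp α) := by gcongr
      _ = 2 * (K α a x ξ * (ξ ^ degExp α * ξ ^ (2 - degExp α))) := by ring
      _ = 2 * (K α a x ξ * ξ ^ 2) := by rw [rpow_mul_rpow_two_sub hξ]
      _ ≤ _ := le_add_of_nonneg_right hb.le

/- With `m = max ξ a_N`, the two terms dominate according to whether `σ m ≤ ρ` or `ρ ≤ σ m`. -/
theorem W1_mul_rpow_le_young (hα : IsExponents α) (ha : IsCoeff U a) (hx : x ∈ U) {ρ σ : ℝ}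
    (hξ : 0 ≤ ξ) (hρ : 0 ≤ ρ) (hσ : 0 < σ) :
    W1 α a x * ρ ^ (2 - degExp α) ≤ 2 * σ ^ (-degExp α) * (K α a x ξ * ρ ^ 2)
      + 2 * σ ^ (2 - degExp α) * (K α a x ξ * ξ ^ 2 + a (Fin.last N) x) := by
  have he := degExp_pos hα
  have he1 := degExp_lt_one hα
  have hW := W1_pos hα ha hx
  have hK := K_pos hα ha hx hξ
  have hb := ha.pos_last x hx
  have hWm := W1_le_two_mul_K_mul_max_rpow hα ha hx hξ
  have hWm' : W1 α a x * max ξ (a (Fin.last N) x) ^ (2 - degExp α)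
      ≤ 2 * (K α a x ξ * ξ ^ 2) + a (Fin.last N) x := by
    rcases max_choice ξ (a (Fin.last N) x) with h | h <;> rw [h]
    · exact W1_mul_rpow_le hα ha hx hξ
    · exact (W1_mul_coeff_last_rpow_le hα ha hx).trans (le_add_of_nonneg_left (by positivity))
  set m := max ξ (a (Fin.last N) x)
  have hm : 0 ≤ m := hξ.trans (le_max_left _ _)
  rcases le_total (σ * m) ρ with h | h
  · have hme : m ^ degExp α ≤ σ ^ (-degExp α) * ρ ^ degExp α := by
      rw [Real.rpow_neg hσ.le, inv_mul_eq_div, le_div_iff₀' (by positivity),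
        ← Real.mul_rpow hσ.le hm]
      gcongr
    calc W1 α a x * ρ ^ (2 - degExp α)
        ≤ 2 * (K α a x ξ * (σ ^ (-degExp α) * ρ ^ degExp α)) * ρ ^ (2 - degExp α) := by
          gcongr
          exact hWm.trans (by gcongr)
      _ = 2 * σ ^ (-degExp α) * (K α a x ξ * (ρ ^ degExp α * ρ ^ (2 - degExp α))) := by ring
      _ = 2 * σ ^ (-degExp α) * (K α a x ξ * ρ ^ 2) := by rw [rpow_mul_rpow_two_sub hρ]
      _ ≤ _ := le_add_of_nonneg_right (by positivity)
  · calc W1 α a x * ρ ^ (2 - degExp α) ≤ W1 α a x * (σ * m) ^ (2 - degExp α) := by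
          gcongr
          linarith
      _ = σ ^ (2 - degExp α) * (W1 α a x * m ^ (2 - degExp α)) := by
          rw [Real.mul_rpow hσ.le hm]
          ring
      _ ≤ σ ^ (2 - degExp α) * (2 * (K α a x ξ * ξ ^ 2) + 2 * a (Fin.last N) x) := by
          gcongr
          linarith
      _ = 2 * σ ^ (2 - degExp α) * (K α a x ξ * ξ ^ 2 + a (Fin.last N) x) := by ring
      _ ≤ _ := le_add_of_nonneg_left (by positivity)

end ConstitutiveLaw

section Energy

variable {n N : ℕ} {U : Set (Space n)} {α : Fin (N + 1) → ℝ} {a : Fin (N + 1) → Space n → ℝ}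
  {q r w : Space n → Space n}

/-- A measurable region together with admissible exponents and coefficients: what the energy and
its flux depend on. -/
structure IsMedium (U : Set (Space n)) (α : Fin (N + 1) → ℝ) (a : Fin (N + 1) → Space n → ℝ) :
    Prop where
  measurableSet : MeasurableSet U
  exponents : IsExponents α
  coeff : IsCoeff U a

theorem IsMedium.aemeasurable_root (hM : IsMedium U α a) {ξ : Space n → ℝ}
    (hξ : AEMeasurable ξ (volume.restrict U)) (hξ0 : ∀ x, 0 ≤ ξ x) :
    AEMeasurable (fun x => root α a x (ξ x)) (volume.restrict U) := by
  suffices hsublevel : ∀ c, NullMeasurableSet ((fun x => root α a x (ξ x)) ⁻¹' Iic c)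
      (volume.restrict U) from
    NullMeasurable.aemeasurable (@measurable_of_Iic ℝ
      (NullMeasurableSpace (Space n) (volume.restrict U)) _ _ _ _ _ _ _ _ hsublevel)
  intro c
  rcases lt_or_ge c 0 with hc | hc
  · refine (nullMeasurableSet_empty (μ := volume.restrict U)).congr ?_
    filter_upwards [ae_restrict_mem hM.measurableSet] with x hx
    have hroot := root_nonneg hM.exponents hM.coeff hx (hξ0 x)
    exact propext (iff_of_false id fun h => hc.not_ge (hroot.trans h))
  · have hg : AEMeasurable (fun x => c * g α a x c) (volume.restrict U) :=
      (Finset.aemeasurable_fun_sum _ fun i _ => (hM.coeff.measurable i).mul_const _).const_mul c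
    refine (nullMeasurableSet_le hξ hg).congr ?_
    filter_upwards [ae_restrict_mem hM.measurableSet] with x hx
    exact propext (root_le_iff hM.exponents hM.coeff hx (hξ0 x) hc).symm

theorem IsMedium.aemeasurable_K (hM : IsMedium U α a) {ξ : Space n → ℝ}
    (hξ : AEMeasurable ξ (volume.restrict U)) (hξ0 : ∀ x, 0 ≤ ξ x) :
    AEMeasurable (fun x => K α a x (ξ x)) (volume.restrict U) :=
  (Finset.aemeasurable_fun_sum _ fun i _ =>
    (hM.coeff.measurable i).mul ((hM.aemeasurable_root hξ hξ0).pow_const _)).const_div 1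

/-- Measurable fields of finite energy, the analogue of `MemL2` for gradients. -/
structure MemEnergy (U : Set (Space n)) (α : Fin (N + 1) → ℝ) (a : Fin (N + 1) → Space n → ℝ)
    (q : Space n → Space n) : Prop where
  aestronglyMeasurable : AEStronglyMeasurable q (volume.restrict U)
  energy_lt_top : energy U α a q < ⊤

/-- The energy as a real number, `0` if it is infinite. -/
noncomputable def energyReal (U : Set (Space n)) (α : Fin (N + 1) → ℝ)
    (a : Fin (N + 1) → Space n → ℝ) (q : Space n → Space n) : ℝ :=
  (energy U α a q).toReal

/-- The integral of the flux `K(x,|q|) q` of `q` against the field `r`, as in the weak form of the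
equation. -/
noncomputable def fluxPairing (U : Set (Space n)) (α : Fin (N + 1) → ℝ)
    (a : Fin (N + 1) → Space n → ℝ) (q r : Space n → Space n) : ℝ :=
  ∫ x in U, K α a x ‖q x‖ * inner ℝ (q x) (r x)

theorem energy_congr (h : q =ᵐ[volume.restrict U] r) : energy U α a q = energy U α a r :=
  lintegral_congr_ae (h.mono fun x hx => by simp only [hx])

theorem energy_neg : energy U α a (-q) = energy U α a q := by
  simp [energy]

theorem IsMedium.aestronglyMeasurable_energyDensity (hM : IsMedium U α a)
    (hq : AEStronglyMeasurable q (volume.restrict U)) :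
    AEStronglyMeasurable (fun x => K α a x ‖q x‖ * ‖q x‖ ^ 2) (volume.restrict U) :=
  ((hM.aemeasurable_K hq.norm.aemeasurable fun _ => norm_nonneg _).mul
    (hq.norm.aemeasurable.pow_const 2)).aestronglyMeasurable

theorem IsMedium.energyDensity_nonneg (hM : IsMedium U α a) (q : Space n → Space n) :
    0 ≤ᵐ[volume.restrict U] fun x => K α a x ‖q x‖ * ‖q x‖ ^ 2 :=
  ae_restrict_of_forall_mem hM.measurableSet fun _ hx =>
    K_mul_sq_nonneg hM.exponents hM.coeff hx (norm_nonneg _)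

theorem MemEnergy.integrable (hM : IsMedium U α a) (hq : MemEnergy U α a q) :
    Integrable (fun x => K α a x ‖q x‖ * ‖q x‖ ^ 2) (volume.restrict U) :=
  (lintegral_ofReal_ne_top_iff_integrable
    (hM.aestronglyMeasurable_energyDensity hq.aestronglyMeasurable)
    (hM.energyDensity_nonneg q)).1 hq.energy_lt_top.ne

theorem energyReal_eq_integral (hM : IsMedium U α a)
    (hq : AEStronglyMeasurable q (volume.restrict U)) :
    energyReal U α a q = ∫ x in U, K α a x ‖q x‖ * ‖q x‖ ^ 2 :=
  (integral_eq_lintegral_of_nonneg_ae (hM.energyDensity_nonneg q)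
    (hM.aestronglyMeasurable_energyDensity hq)).symm

theorem energy_add_le (hM : IsMedium U α a) (hq : AEStronglyMeasurable q (volume.restrict U)) :
    energy U α a (q + r) ≤ 4 * (energy U α a q + energy U α a r) := by
  have hmeas := (hM.aestronglyMeasurable_energyDensity hq).aemeasurable.ennreal_ofReal
  rw [energy, energy, energy, ← lintegral_add_left' hmeas, ← lintegral_const_mul' _ _ (by simp)]
  refine setLIntegral_mono' hM.measurableSet fun x hx => ?_
  have hE (v : Space n) := K_mul_sq_nonneg hM.exponents hM.coeff hx (norm_nonneg v)
  rw [← ENNReal.ofReal_add (hE _) (hE _), ← ENNReal.ofReal_ofNat 4,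
    ← ENNReal.ofReal_mul (by norm_num)]
  exact ENNReal.ofReal_le_ofReal (K_norm_add_mul_sq_le hM.exponents hM.coeff hx (q x) (r x))

theorem energy_sub_le (hM : IsMedium U α a) (hq : AEStronglyMeasurable q (volume.restrict U)) :
    energy U α a (q - r) ≤ 4 * (energy U α a q + energy U α a r) := by
  simpa only [← sub_eq_add_neg, energy_neg] using energy_add_le (r := -r) hM hq

theorem energy_smul_le (hM : IsMedium U α a) (c : ℝ) :
    energy U α a (c • q) ≤ ENNReal.ofReal (|c| ^ (2 - degExp α) + |c| ^ 2) * energy U α a q := by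
  rw [energy, energy, ← lintegral_const_mul' _ _ ENNReal.ofReal_ne_top]
  refine setLIntegral_mono' hM.measurableSet fun x hx => ?_
  rw [← ENNReal.ofReal_mul (by positivity), Pi.smul_apply, norm_smul, Real.norm_eq_abs]
  exact ENNReal.ofReal_le_ofReal
    (K_mul_mul_sq_le hM.exponents hM.coeff hx (abs_nonneg c) (norm_nonneg _))

theorem MemEnergy.add (hM : IsMedium U α a) (hq : MemEnergy U α a q) (hr : MemEnergy U α a r) :
    MemEnergy U α a (q + r) :=
  ⟨hq.1.add hr.1, (energy_add_le hM hq.1).trans_lt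
    (ENNReal.mul_lt_top (by simp) (ENNReal.add_lt_top.2 ⟨hq.2, hr.2⟩))⟩

theorem MemEnergy.sub (hM : IsMedium U α a) (hq : MemEnergy U α a q) (hr : MemEnergy U α a r) :
    MemEnergy U α a (q - r) :=
  ⟨hq.1.sub hr.1, (energy_sub_le hM hq.1).trans_lt
    (ENNReal.mul_lt_top (by simp) (ENNReal.add_lt_top.2 ⟨hq.2, hr.2⟩))⟩

theorem MemEnergy.const_smul (hM : IsMedium U α a) (hq : MemEnergy U α a q) (c : ℝ) :
    MemEnergy U α a (c • q) :=
  ⟨hq.1.const_smul c, (energy_smul_le hM c).trans_lt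
    (ENNReal.mul_lt_top ENNReal.ofReal_lt_top hq.2)⟩

theorem energyReal_sub_le (hM : IsMedium U α a) (hq : MemEnergy U α a q)
    (hr : MemEnergy U α a r) :
    energyReal U α a (q - r) ≤ 4 * (energyReal U α a q + energyReal U α a r) := by
  have hadd := ENNReal.add_lt_top.2 ⟨hq.2, hr.2⟩
  have h := ENNReal.toReal_mono (ENNReal.mul_lt_top (by simp) hadd).ne
    (energy_sub_le hM hq.1 (r := r))
  rwa [ENNReal.toReal_mul, ENNReal.toReal_add hq.2.ne hr.2.ne, ENNReal.toReal_ofNat] at h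

theorem energyReal_smul_le (hM : IsMedium U α a) (hq : MemEnergy U α a q) (c : ℝ) :
    energyReal U α a (c • q) ≤ (|c| ^ (2 - degExp α) + |c| ^ 2) * energyReal U α a q := by
  have h := ENNReal.toReal_mono (ENNReal.mul_lt_top ENNReal.ofReal_lt_top hq.2).ne
    (energy_smul_le hM c)
  rwa [ENNReal.toReal_mul, ENNReal.toReal_ofReal (by positivity)] at h

theorem abs_K_mul_inner_le {E : Type*} [SeminormedAddCommGroup E] [InnerProductSpace ℝ E]
    (hα : IsExponents α) (ha : IsCoeff U a) {x : Space n} (hx : x ∈ U) (u v : E) {δ : ℝ}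
    (hδ : 0 < δ) (hδ1 : δ ≤ 1) :
    |K α a x ‖u‖ * inner ℝ u v|
      ≤ δ * (K α a x ‖u‖ * ‖u‖ ^ 2) + δ⁻¹ * (K α a x ‖v‖ * ‖v‖ ^ 2) := by
  have hK := K_pos hα ha hx (norm_nonneg u)
  rw [abs_mul, abs_of_pos hK]
  exact (mul_le_mul_of_nonneg_left (abs_real_inner_le_norm u v) hK.le).trans
    (K_mul_mul_le_add hα ha hx hδ hδ1 (norm_nonneg u) (norm_nonneg v))

theorem MemEnergy.integrable_flux (hM : IsMedium U α a) (hq : MemEnergy U α a q)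
    (hr : MemEnergy U α a r) :
    Integrable (fun x => K α a x ‖q x‖ * inner ℝ (q x) (r x)) (volume.restrict U) := by
  refine (((hq.integrable hM).const_mul 1).add ((hr.integrable hM).const_mul 1⁻¹)).mono' ?_ ?_
  · exact (hM.aemeasurable_K hq.1.norm.aemeasurable
      fun _ => norm_nonneg _).aestronglyMeasurable.mul (hq.1.inner hr.1)
  · exact ae_restrict_of_forall_mem hM.measurableSet fun x hx =>
      abs_K_mul_inner_le hM.exponents hM.coeff hx (q x) (r x) one_pos le_rfl

theorem abs_fluxPairing_le (hM : IsMedium U α a) (hq : MemEnergy U α a q)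
    (hr : MemEnergy U α a r) {δ : ℝ} (hδ : 0 < δ) (hδ1 : δ ≤ 1) :
    |fluxPairing U α a q r| ≤ δ * energyReal U α a q + δ⁻¹ * energyReal U α a r := by
  have hqi := (hq.integrable hM).const_mul δ
  have hri := (hr.integrable hM).const_mul δ⁻¹
  rw [energyReal_eq_integral hM hq.1, energyReal_eq_integral hM hr.1, ← integral_const_mul,
    ← integral_const_mul, ← integral_add hqi hri]
  exact norm_integral_le_of_norm_le (f := fun x => K α a x ‖q x‖ * inner ℝ (q x) (r x))
    (hqi.add hri) (ae_restrict_of_forall_mem hM.measurableSet fun x hx =>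
      abs_K_mul_inner_le hM.exponents hM.coeff hx (q x) (r x) hδ hδ1)

theorem fluxPairing_sub (hM : IsMedium U α a) (hq : MemEnergy U α a q) (hr : MemEnergy U α a r)
    (hw : MemEnergy U α a w) :
    fluxPairing U α a q (r - w) = fluxPairing U α a q r - fluxPairing U α a q w := by
  rw [fluxPairing, fluxPairing, fluxPairing,
    ← integral_sub (hq.integrable_flux hM hr) (hq.integrable_flux hM hw)]
  simp only [Pi.sub_apply, inner_sub_right, mul_sub]

theorem fluxPairing_smul (c : ℝ) :
    fluxPairing U α a q (c • r) = c * fluxPairing U α a q r := by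
  rw [fluxPairing, fluxPairing, ← integral_const_mul]
  simp only [Pi.smul_apply, real_inner_smul_right, mul_left_comm]

theorem fluxPairing_self (hM : IsMedium U α a)
    (hq : AEStronglyMeasurable q (volume.restrict U)) :
    fluxPairing U α a q q = energyReal U α a q := by
  simp only [energyReal_eq_integral hM hq, fluxPairing, real_inner_self_eq_norm_sq]

theorem tendsto_zero_of_young {ι : Type*} {l : Filter ι} {u e : ι → ℝ} {A : ℝ}
    (he : Tendsto e l (𝓝 0))
    (h : ∀ δ : ℝ, 0 < δ → δ ≤ 1 → ∀ᶠ k in l, |u k| ≤ δ * A + δ⁻¹ * e k) :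
    Tendsto u l (𝓝 0) := by
  rw [Metric.tendsto_nhds]
  intro ε hε
  have hsmall : ∀ᶠ δ in 𝓝[>] (0 : ℝ), δ * A < ε / 2 := by
    have hlim : Tendsto (fun δ : ℝ => δ * A) (𝓝 0) (𝓝 0) :=
      Continuous.tendsto' (by fun_prop) _ _ (zero_mul A)
    exact (hlim.eventually_lt_const (half_pos hε)).filter_mono nhdsWithin_le_nhds
  obtain ⟨δ, hδA, hδ0, hδ1⟩ := (hsmall.and (Ioc_mem_nhdsGT one_pos)).exists
  have hδe : Tendsto (fun k => δ⁻¹ * e k) l (𝓝 0) := by simpa using he.const_mul δ⁻¹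
  filter_upwards [h δ hδ0 hδ1, hδe.eventually_lt_const (half_pos hε)] with k hk hek
  rw [Real.dist_0_eq_abs]
  linarith

theorem tendsto_energyReal_zero {ι : Type*} {l : Filter ι} {v : ι → Space n → Space n}
    (h : Tendsto (fun k => energy U α a (v k)) l (𝓝 0)) :
    Tendsto (fun k => energyReal U α a (v k)) l (𝓝 0) :=
  (ENNReal.tendsto_toReal ENNReal.zero_ne_top).comp h

theorem tendsto_fluxPairing (hM : IsMedium U α a) {ι : Type*} {l : Filter ι}
    {v : ι → Space n → Space n} (hq : MemEnergy U α a q) (hw : MemEnergy U α a w)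
    (hv : ∀ᶠ k in l, AEStronglyMeasurable (v k) (volume.restrict U))
    (h : Tendsto (fun k => energy U α a (v k - w)) l (𝓝 0)) :
    Tendsto (fun k => fluxPairing U α a q (v k)) l (𝓝 (fluxPairing U α a q w)) := by
  rw [← tendsto_sub_nhds_zero_iff]
  refine tendsto_zero_of_young (A := energyReal U α a q) (tendsto_energyReal_zero h)
    fun δ hδ hδ1 => ?_
  filter_upwards [hv, h.eventually_lt_const ENNReal.zero_lt_top] with k hk hk_lt
  have hsub : MemEnergy U α a (v k - w) := ⟨hk.sub hw.1, hk_lt⟩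
  have hvk : MemEnergy U α a (v k) := by simpa only [sub_add_cancel] using hsub.add hM hw
  rw [← fluxPairing_sub hM hq hvk hw]
  exact abs_fluxPairing_le hM hq hsub hδ hδ1

/-- The integral of `potential` along a field: the convex functional whose differential at `q` is
`fluxPairing U α a q`. -/
noncomputable def potentialEnergy (U : Set (Space n)) (α : Fin (N + 1) → ℝ)
    (a : Fin (N + 1) → Space n → ℝ) (q : Space n → Space n) : ℝ :=
  ∫ x in U, potential α a x ‖q x‖

theorem MemEnergy.integrable_potential (hM : IsMedium U α a) (hq : MemEnergy U α a q) :
    Integrable (fun x => potential α a x ‖q x‖) (volume.restrict U) := by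
  refine (hq.integrable hM).mono' ?_ (ae_restrict_of_forall_mem hM.measurableSet fun x hx => ?_)
  · have hnorm := hq.1.norm.aemeasurable
    have hroot := hM.aemeasurable_root hnorm fun _ => norm_nonneg _
    exact ((hroot.mul hnorm).sub (Finset.aemeasurable_fun_sum _ fun i _ =>
      (hM.coeff.measurable i).mul ((hroot.pow_const _).div_const _))).aestronglyMeasurable
  · have hx0 := norm_nonneg (q x)
    rw [Real.norm_of_nonneg (by linarith [K_mul_sq_nonneg hM.exponents hM.coeff hx hx0,
      K_mul_sq_le_two_mul_potential hM.exponents hM.coeff hx hx0])]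
    exact potential_le_K_mul_sq hM.exponents hM.coeff hx hx0

theorem potentialEnergy_le_energyReal (hM : IsMedium U α a) (hq : MemEnergy U α a q) :
    potentialEnergy U α a q ≤ energyReal U α a q := by
  rw [energyReal_eq_integral hM hq.1]
  exact setIntegral_mono_on (hq.integrable_potential hM) (hq.integrable hM) hM.measurableSet
    fun x hx => potential_le_K_mul_sq hM.exponents hM.coeff hx (norm_nonneg (q x))

theorem energyReal_le_two_mul_potentialEnergy (hM : IsMedium U α a) (hq : MemEnergy U α a q) :
    energyReal U α a q ≤ 2 * potentialEnergy U α a q := by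
  rw [energyReal_eq_integral hM hq.1, potentialEnergy, ← integral_const_mul]
  exact setIntegral_mono_on (hq.integrable hM) ((hq.integrable_potential hM).const_mul 2)
    hM.measurableSet
    fun x hx => K_mul_sq_le_two_mul_potential hM.exponents hM.coeff hx (norm_nonneg (q x))

theorem potentialEnergy_sub_le (hM : IsMedium U α a) (hq : MemEnergy U α a q)
    (hr : MemEnergy U α a r) :
    potentialEnergy U α a q - potentialEnergy U α a r ≤ fluxPairing U α a q (q - r) := by
  rw [potentialEnergy, potentialEnergy,
    ← integral_sub (hq.integrable_potential hM) (hr.integrable_potential hM)]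
  exact setIntegral_mono_on ((hq.integrable_potential hM).sub (hr.integrable_potential hM))
    (hq.integrable_flux hM (hq.sub hM hr)) hM.measurableSet
    fun x hx => potential_norm_sub_le hM.exponents hM.coeff hx (q x) (r x)

theorem fluxPairing_sub_fluxPairing_le (hM : IsMedium U α a) (hq : MemEnergy U α a q)
    (hr : MemEnergy U α a r) :
    fluxPairing U α a q (q - r) - fluxPairing U α a r (q - r) ≤ 4 * energyReal U α a (q - r) := by
  have hsub := hq.sub hM hr
  rw [fluxPairing, fluxPairing, energyReal_eq_integral hM hsub.1, ← integral_const_mul,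
    ← integral_sub (hq.integrable_flux hM hsub) (hr.integrable_flux hM hsub)]
  exact setIntegral_mono_on ((hq.integrable_flux hM hsub).sub (hr.integrable_flux hM hsub))
    ((hsub.integrable hM).const_mul 4) hM.measurableSet
    fun x hx => flux_sub_flux_le hM.exponents hM.coeff hx (q x) (r x)

theorem abs_potentialEnergy_sub_sub_le (hM : IsMedium U α a) (hq : MemEnergy U α a q)
    (hr : MemEnergy U α a r) :
    |potentialEnergy U α a q - potentialEnergy U α a r - fluxPairing U α a r (q - r)|
      ≤ 4 * energyReal U α a (q - r) := by
  have hlower := potentialEnergy_sub_le hM hr hq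
  have hneg : fluxPairing U α a r (r - q) = -fluxPairing U α a r (q - r) := by
    rw [← neg_sub, ← neg_one_smul ℝ, fluxPairing_smul, neg_one_mul]
  rw [abs_of_nonneg (by linarith)]
  linarith [potentialEnergy_sub_le hM hq hr, fluxPairing_sub_fluxPairing_le hM hq hr]

end Energy

section WeakGradient

variable {n : ℕ} {U : Set (Space n)}

theorem IsTest.continuous_gradient {η : Space n → ℝ} (hη : IsTest U η) :
    Continuous (gradient η) :=
  (InnerProductSpace.toDual ℝ (Space n)).symm.continuous.comp
    (hη.smooth.continuous_fderiv (by simp))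

theorem gradient_eq_zero_of_notMem_tsupport {η : Space n → ℝ} {x : Space n}
    (hx : x ∉ tsupport η) : gradient η x = 0 := by
  have hderiv : fderiv ℝ η x = 0 :=
    image_eq_zero_of_notMem_tsupport fun h => hx (tsupport_fderiv_subset ℝ h)
  rw [gradient, hderiv, map_zero]

theorem IsTest.integrable_smul {η : Space n → ℝ} (hη : IsTest U η) {q : Space n → Space n}
    (hq : LocallyIntegrableOn q U) : Integrable (fun x => η x • q x) := by
  have hint : IntegrableOn (fun x => η x • q x) (tsupport η) :=
    (hq.integrableOn_compact_subset hη.support hη.compact).continuousOn_smul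
      hη.smooth.continuous.continuousOn hη.compact
  rwa [integrableOn_iff_integrable_of_support_subset] at hint
  exact (Function.support_smul_subset_left η q).trans (subset_tsupport η)

theorem IsTest.integrable_smul_gradient {η : Space n → ℝ} (hη : IsTest U η) {u : Space n → ℝ}
    (hu : LocallyIntegrableOn u U) : Integrable (fun x => u x • gradient η x) := by
  have hint : IntegrableOn (fun x => u x • gradient η x) (tsupport η) :=
    (hu.integrableOn_compact_subset hη.support hη.compact).smul_continuousOn
      hη.continuous_gradient.continuousOn hη.compact
  rwa [integrableOn_iff_integrable_of_support_subset] at hint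
  refine Function.support_subset_iff'.2 fun x hx => ?_
  rw [gradient_eq_zero_of_notMem_tsupport hx, smul_zero]

theorem HasWeakGrad.sub {u v : Space n → ℝ} {q r : Space n → Space n} (hu : HasWeakGrad U u q)
    (hv : HasWeakGrad U v r) : HasWeakGrad U (u - v) (q - r) where
  locInt := hu.locInt.sub hv.locInt
  locInt_grad := hu.locInt_grad.sub hv.locInt_grad
  parts η hη := by
    simp only [Pi.sub_apply, sub_smul, smul_sub]
    rw [integral_sub (hη.integrable_smul_gradient hu.locInt).integrableOn
      (hη.integrable_smul_gradient hv.locInt).integrableOn,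
      integral_sub (hη.integrable_smul hu.locInt_grad).integrableOn
      (hη.integrable_smul hv.locInt_grad).integrableOn, hu.parts η hη, hv.parts η hη]
    abel

theorem HasWeakGrad.ae_eq (hU : IsOpen U) {u : Space n → ℝ} {q r : Space n → Space n}
    (hq : HasWeakGrad U u q) (hr : HasWeakGrad U u r) : q =ᵐ[volume.restrict U] r := by
  have hzero : ∀ᵐ x, x ∈ U → (q - r) x = 0 := by
    refine hU.ae_eq_zero_of_integral_contDiff_smul_eq_zero
      (hq.locInt_grad.sub hr.locInt_grad) fun η hsmooth hcompact hsupport => ?_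
    have hη : IsTest U η := ⟨hsmooth, hcompact, hsupport⟩
    rw [← setIntegral_eq_integral_of_forall_compl_eq_zero (s := U) fun x hx => by
      rw [image_eq_zero_of_notMem_tsupport fun h => hx (hsupport h), zero_smul]]
    simp only [Pi.sub_apply, smul_sub]
    rw [integral_sub (hη.integrable_smul hq.locInt_grad).integrableOn
      (hη.integrable_smul hr.locInt_grad).integrableOn, sub_eq_zero, ← neg_inj,
      ← hq.parts η hη, ← hr.parts η hη]
  exact ((ae_restrict_iff' hU.measurableSet).2 hzero).mono fun x => sub_eq_zero.1

theorem weakGrad_sub (hU : IsOpen U) {u v : Space n → ℝ} (hu : ∃ q, HasWeakGrad U u q)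
    (hv : ∃ q, HasWeakGrad U v q) :
    weakGrad U (u - v) =ᵐ[volume.restrict U] weakGrad U u - weakGrad U v := by
  have hsub := (hasWeakGrad_weakGrad hu).sub (hasWeakGrad_weakGrad hv)
  exact (hasWeakGrad_weakGrad ⟨_, hsub⟩).ae_eq hU hsub

end WeakGradient

section WeightedL2

variable {n : ℕ} {U : Set (Space n)} {φ : Space n → ℝ} {u v w : Space n → ℝ}

/-- The measure `φ dx` on `U`, for which `L²_φ(U)` is the usual `L²` space. -/
noncomputable def porosityMeasure (U : Set (Space n)) (φ : Space n → ℝ) : Measure (Space n) :=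
  (volume.restrict U).withDensity fun x => ENNReal.ofReal (φ x)

theorem lintegral_porosityMeasure (hφ : IsPorosity U φ) (f : Space n → ℝ≥0∞) :
    ∫⁻ x, f x ∂porosityMeasure U φ = ∫⁻ x in U, ENNReal.ofReal (φ x) * f x :=
  lintegral_withDensity_eq_lintegral_mul_non_measurable₀ _ hφ.measurable.ennreal_ofReal
    (.of_forall fun _ => ENNReal.ofReal_lt_top) f

theorem integral_porosityMeasure (hU : MeasurableSet U) (hφ : IsPorosity U φ)
    (f : Space n → ℝ) : ∫ x, f x ∂porosityMeasure U φ = ∫ x in U, φ x * f x := by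
  rw [porosityMeasure, integral_withDensity_eq_integral_toReal_smul₀ hφ.measurable.ennreal_ofReal
    (.of_forall fun _ => ENNReal.ofReal_lt_top)]
  exact setIntegral_congr_fun hU fun x hx => by
    simp only [ENNReal.toReal_ofReal (hφ.pos x hx).le, smul_eq_mul]

theorem porosityMeasure_absolutelyContinuous :
    porosityMeasure U φ ≪ volume.restrict U :=
  withDensity_absolutelyContinuous _ _

theorem absolutelyContinuous_porosityMeasure (hU : MeasurableSet U) (hφ : IsPorosity U φ) :
    volume.restrict U ≪ porosityMeasure U φ :=
  withDensity_absolutelyContinuous' hφ.measurable.ennreal_ofReal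
    (ae_restrict_of_forall_mem hU fun x hx => (ENNReal.ofReal_pos.2 (hφ.pos x hx)).ne')

theorem normSq_eq_eLpNorm_sq (hU : MeasurableSet U) (hφ : IsPorosity U φ) (u : Space n → ℝ) :
    normSq U φ u = eLpNorm u 2 (porosityMeasure U φ) ^ 2 := by
  have hpow := eLpNorm_nnreal_pow_eq_lintegral (p := 2) (f := u) (μ := porosityMeasure U φ)
    two_ne_zero
  norm_num at hpow
  rw [hpow, lintegral_porosityMeasure hφ]
  refine setLIntegral_congr_fun hU fun x hx => ?_
  simp only [ENNReal.ofReal_mul (hφ.pos x hx).le, ← sq_abs (u x),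
    ENNReal.ofReal_pow (abs_nonneg _), ← Real.enorm_eq_ofReal_abs]

theorem memL2_iff_memLp (hU : MeasurableSet U) (hφ : IsPorosity U φ) :
    MemL2 U φ u ↔ MemLp u 2 (porosityMeasure U φ) := by
  rw [MemL2, MemLp, normSq_eq_eLpNorm_sq hU hφ, ENNReal.pow_lt_top_iff]
  simp only [OfNat.ofNat_ne_zero, or_false]
  exact and_congr_left' ⟨fun h => h.mono_ac porosityMeasure_absolutelyContinuous,
    fun h => h.mono_ac (absolutelyContinuous_porosityMeasure hU hφ)⟩

theorem MemL2.sub (hU : MeasurableSet U) (hφ : IsPorosity U φ) (hu : MemL2 U φ u)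
    (hv : MemL2 U φ v) : MemL2 U φ (u - v) := by
  rw [memL2_iff_memLp hU hφ] at hu hv ⊢
  exact hu.sub hv

theorem MemL2.const_smul (hU : MeasurableSet U) (hφ : IsPorosity U φ) (hu : MemL2 U φ u)
    (c : ℝ) : MemL2 U φ (c • u) := by
  rw [memL2_iff_memLp hU hφ] at hu ⊢
  exact hu.const_smul c

open Classical in
/-- The class of `u` in `L²_φ(U)`, as an element of Mathlib's Hilbert space `Lp ℝ 2`; it is `0` if
`u` is not in `L²_φ(U)`. -/
noncomputable def toL2 (U : Set (Space n)) (φ u : Space n → ℝ) :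
    Lp ℝ 2 (porosityMeasure U φ) :=
  if h : MemLp u 2 (porosityMeasure U φ) then h.toLp u else 0

theorem toL2_eq_toLp (h : MemLp u 2 (porosityMeasure U φ)) : toL2 U φ u = h.toLp u :=
  dif_pos h

theorem toL2_sub (hU : MeasurableSet U) (hφ : IsPorosity U φ) (hu : MemL2 U φ u)
    (hv : MemL2 U φ v) : toL2 U φ (u - v) = toL2 U φ u - toL2 U φ v := by
  rw [memL2_iff_memLp hU hφ] at hu hv
  rw [toL2_eq_toLp hu, toL2_eq_toLp hv, toL2_eq_toLp (hu.sub hv), MemLp.toLp_sub]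

theorem toL2_smul (hU : MeasurableSet U) (hφ : IsPorosity U φ) (hu : MemL2 U φ u) (c : ℝ) :
    toL2 U φ (c • u) = c • toL2 U φ u := by
  rw [memL2_iff_memLp hU hφ] at hu
  rw [toL2_eq_toLp hu, toL2_eq_toLp (hu.const_smul c), MemLp.toLp_const_smul]

theorem inner_toL2 (hU : MeasurableSet U) (hφ : IsPorosity U φ) (hu : MemL2 U φ u)
    (hv : MemL2 U φ v) :
    inner ℝ (toL2 U φ u) (toL2 U φ v) = ∫ x in U, φ x * u x * v x := by
  rw [memL2_iff_memLp hU hφ] at hu hv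
  rw [toL2_eq_toLp hu, toL2_eq_toLp hv, L2.inner_def]
  simp only [mul_assoc, ← integral_porosityMeasure hU hφ fun x => u x * v x]
  refine integral_congr_ae ?_
  filter_upwards [hu.coeFn_toLp, hv.coeFn_toLp] with x hux hvx
  simp only [hux, hvx, RCLike.inner_apply, conj_trivial, mul_comm]

theorem normSq_eq_norm_toL2_sq (hU : MeasurableSet U) (hφ : IsPorosity U φ)
    (hu : MemL2 U φ u) : normSq U φ u = ENNReal.ofReal (‖toL2 U φ u‖ ^ 2) := by
  rw [memL2_iff_memLp hU hφ] at hu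
  rw [normSq_eq_eLpNorm_sq hU hφ, toL2_eq_toLp hu, Lp.norm_toLp, ← ENNReal.toReal_pow,
    ENNReal.ofReal_toReal (ENNReal.pow_ne_top hu.2.ne)]

theorem tendsto_normSq_zero_iff (hU : MeasurableSet U) (hφ : IsPorosity U φ) {ι : Type*}
    {l : Filter ι} {v : ι → Space n → ℝ} :
    Tendsto (fun k => normSq U φ (v k)) l (𝓝 0) ↔
      Tendsto (fun k => eLpNorm (v k) 2 (porosityMeasure U φ)) l (𝓝 0) := by
  simp only [normSq_eq_eLpNorm_sq hU hφ]
  constructor <;> intro h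
  · simpa [← ENNReal.rpow_natCast_mul] using h.ennrpow_const (1 / 2 : ℝ)
  · simpa using h.ennrpow_const 2

theorem tendsto_toL2 (hU : MeasurableSet U) (hφ : IsPorosity U φ) {ι : Type*} {l : Filter ι}
    {v : ι → Space n → ℝ} (hv : ∀ᶠ k in l, MemL2 U φ (v k)) (hw : MemL2 U φ w)
    (h : Tendsto (fun k => normSq U φ (v k - w)) l (𝓝 0)) :
    Tendsto (fun k => toL2 U φ (v k)) l (𝓝 (toL2 U φ w)) := by
  rw [tendsto_normSq_zero_iff hU hφ] at h
  rw [tendsto_iff_norm_sub_tendsto_zero]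
  refine ((ENNReal.tendsto_toReal ENNReal.zero_ne_top).comp h).congr' ?_
  filter_upwards [hv] with k hk
  rw [← toL2_sub hU hφ hk hw, toL2_eq_toLp ((memL2_iff_memLp hU hφ).1 (hk.sub hU hφ hw)),
    Lp.norm_toLp, Function.comp]

theorem memL2_of_normSq_sub_lt_top (hU : MeasurableSet U) (hφ : IsPorosity U φ)
    (hu : AEStronglyMeasurable u (volume.restrict U)) (hw : MemL2 U φ w)
    (h : normSq U φ (u - w) < ⊤) : MemL2 U φ u := by
  have hsub : MemL2 U φ (u - w) := ⟨hu.sub hw.1, h⟩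
  rw [memL2_iff_memLp hU hφ] at hsub hw ⊢
  simpa only [sub_add_cancel] using hsub.add hw

end WeightedL2

section TimeDerivative

variable {n : ℕ} {U : Set (Space n)} {φ : Space n → ℝ} {u v : ℝ → Space n → ℝ}
  {u' v' : Space n → ℝ} {t : ℝ}

theorem hasTimeDeriv_iff_eLpNorm (hU : MeasurableSet U) (hφ : IsPorosity U φ) :
    HasTimeDeriv U φ u t u' ↔ MemL2 U φ u' ∧
      Tendsto (fun s => eLpNorm ((s - t)⁻¹ • (u s - u t) - u') 2 (porosityMeasure U φ)) (𝓝[≠] t)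
        (𝓝 0) := by
  rw [HasTimeDeriv, ← tendsto_normSq_zero_iff hU hφ]
  simp only [div_eq_inv_mul]
  rfl

theorem HasTimeDeriv.sub (hU : MeasurableSet U) (hφ : IsPorosity U φ)
    (hu : HasTimeDeriv U φ u t u') (hv : HasTimeDeriv U φ v t v')
    (hut : ∀ᶠ s in 𝓝 t, AEStronglyMeasurable (u s) (volume.restrict U))
    (hvt : ∀ᶠ s in 𝓝 t, AEStronglyMeasurable (v s) (volume.restrict U)) :
    HasTimeDeriv U φ (u - v) t (u' - v') := by
  rw [hasTimeDeriv_iff_eLpNorm hU hφ] at hu hv ⊢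
  refine ⟨hu.1.sub hU hφ hv.1, tendsto_of_tendsto_of_tendsto_of_le_of_le' tendsto_const_nhds
    (by simpa using hu.2.add hv.2) (.of_forall fun _ => zero_le) ?_⟩
  filter_upwards [hut.filter_mono nhdsWithin_le_nhds, hvt.filter_mono nhdsWithin_le_nhds]
    with s hus hvs
  have hquot {f : ℝ → Space n → ℝ} {f' : Space n → ℝ} (hf' : MemL2 U φ f')
      (hfs : AEStronglyMeasurable (f s) (volume.restrict U))
      (hft : AEStronglyMeasurable (f t) (volume.restrict U)) :
      AEStronglyMeasurable ((s - t)⁻¹ • (f s - f t) - f') (porosityMeasure U φ) :=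
    (((hfs.sub hft).const_smul _).sub hf'.1).mono_ac porosityMeasure_absolutelyContinuous
  have hsplit : (s - t)⁻¹ • ((u - v) s - (u - v) t) - (u' - v')
      = ((s - t)⁻¹ • (u s - u t) - u') - ((s - t)⁻¹ • (v s - v t) - v') := by
    rw [Pi.sub_apply, Pi.sub_apply, sub_sub_sub_comm (u s), smul_sub]
    abel
  rw [hsplit]
  exact eLpNorm_sub_le (hquot hu.1 hus hut.self_of_nhds) (hquot hv.1 hvs hvt.self_of_nhds)
    one_le_two

theorem HasTimeDeriv.ae_eq (hU : MeasurableSet U) (hφ : IsPorosity U φ)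
    (hu : HasTimeDeriv U φ u t u') (hv : HasTimeDeriv U φ u t v')
    (hut : ∀ᶠ s in 𝓝 t, AEStronglyMeasurable (u s) (volume.restrict U)) :
    u' =ᵐ[volume.restrict U] v' := by
  have hsub := hu.sub hU hφ hv hut hut
  rw [hasTimeDeriv_iff_eLpNorm hU hφ] at hsub
  have hnorm : eLpNorm (u' - v') 2 (porosityMeasure U φ) = 0 := by
    simpa only [sub_self, Pi.zero_apply, smul_zero, zero_sub, eLpNorm_neg,
      tendsto_const_nhds_iff] using hsub.2
  have hae := (eLpNorm_eq_zero_iff (hsub.1.1.mono_ac porosityMeasure_absolutelyContinuous)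
    two_ne_zero).1 hnorm
  filter_upwards [(absolutelyContinuous_porosityMeasure hU hφ).ae_eq hae] with x
    using sub_eq_zero.1

theorem HasTimeDeriv.hasDerivAt_toL2 (hU : MeasurableSet U) (hφ : IsPorosity U φ)
    (hu : HasTimeDeriv U φ u t u') (hut : ∀ᶠ s in 𝓝 t, MemL2 U φ (u s)) :
    HasDerivAt (fun s => toL2 U φ (u s)) (toL2 U φ u') t := by
  rw [hasDerivAt_iff_tendsto_slope]
  rw [hasTimeDeriv_iff_eLpNorm hU hφ, ← tendsto_normSq_zero_iff hU hφ] at hu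
  have ht := hut.self_of_nhds
  have hquot : ∀ᶠ s in 𝓝[≠] t, MemL2 U φ (u s - u t) :=
    (hut.filter_mono nhdsWithin_le_nhds).mono fun s hs => hs.sub hU hφ ht
  refine (tendsto_toL2 hU hφ (hquot.mono fun s hs => hs.const_smul hU hφ _) hu.1 hu.2).congr' ?_
  filter_upwards [hquot, hut.filter_mono nhdsWithin_le_nhds] with s hs hus
  rw [toL2_smul hU hφ hs, toL2_sub hU hφ hus ht, slope_def_module]

end TimeDerivative

section EnergyDerivative

variable {n N : ℕ} {U : Set (Space n)} {α : Fin (N + 1) → ℝ} {a : Fin (N + 1) → Space n → ℝ}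
  {q r : ℝ → Space n → Space n} {q' r' w : Space n → Space n} {t : ℝ}

/-- `q'` is the time derivative at `t` of the curve `q` of fields of finite energy, with respect to
convergence in energy. The energy is not a norm, so this is not an instance of `HasDerivAt`. -/
structure HasEnergyDeriv (U : Set (Space n)) (α : Fin (N + 1) → ℝ) (a : Fin (N + 1) → Space n → ℝ)
    (q : ℝ → Space n → Space n) (q' : Space n → Space n) (t : ℝ) : Prop where
  eventually_memEnergy : ∀ᶠ s in 𝓝 t, MemEnergy U α a (q s)
  aestronglyMeasurable : AEStronglyMeasurable q' (volume.restrict U)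
  tendsto : Tendsto (fun s => energy U α a ((s - t)⁻¹ • (q s - q t) - q')) (𝓝[≠] t) (𝓝 0)

namespace HasEnergyDeriv

theorem eventually_memEnergy_quotient (hM : IsMedium U α a) (hq : HasEnergyDeriv U α a q q' t) :
    ∀ᶠ s in 𝓝[≠] t, MemEnergy U α a ((s - t)⁻¹ • (q s - q t)) :=
  (hq.eventually_memEnergy.filter_mono nhdsWithin_le_nhds).mono fun _ hs =>
    (hs.sub hM hq.eventually_memEnergy.self_of_nhds).const_smul hM _

theorem memEnergy (hM : IsMedium U α a) (hq : HasEnergyDeriv U α a q q' t) :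
    MemEnergy U α a q' := by
  obtain ⟨s, hs, hsub⟩ := ((hq.eventually_memEnergy_quotient hM).and
    (hq.tendsto.eventually_lt_const ENNReal.zero_lt_top)).exists
  simpa only [sub_sub_cancel] using hs.sub hM ⟨hs.1.sub hq.aestronglyMeasurable, hsub⟩

theorem sub (hM : IsMedium U α a) (hq : HasEnergyDeriv U α a q q' t)
    (hr : HasEnergyDeriv U α a r r' t) : HasEnergyDeriv U α a (q - r) (q' - r') t where
  eventually_memEnergy := (hq.eventually_memEnergy.and hr.eventually_memEnergy).mono
    fun _ hs => hs.1.sub hM hs.2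
  aestronglyMeasurable := hq.aestronglyMeasurable.sub hr.aestronglyMeasurable
  tendsto := by
    have hlim := ENNReal.Tendsto.const_mul (a := 4) (hq.tendsto.add hr.tendsto)
      (Or.inr (by simp))
    rw [add_zero, mul_zero] at hlim
    refine tendsto_of_tendsto_of_tendsto_of_le_of_le' tendsto_const_nhds hlim
      (.of_forall fun _ => zero_le) ?_
    filter_upwards [hq.eventually_memEnergy_quotient hM] with s hs
    have hsplit : (s - t)⁻¹ • ((q - r) s - (q - r) t) - (q' - r')
        = ((s - t)⁻¹ • (q s - q t) - q') - ((s - t)⁻¹ • (r s - r t) - r') := by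
      rw [Pi.sub_apply, Pi.sub_apply, sub_sub_sub_comm (q s), smul_sub]
      abel
    rw [hsplit]
    exact energy_sub_le hM (hs.1.sub hq.aestronglyMeasurable)

theorem tendsto_fluxPairing (hM : IsMedium U α a) (hq : HasEnergyDeriv U α a q q' t)
    (hw : MemEnergy U α a w) :
    Tendsto (fun s => fluxPairing U α a w ((s - t)⁻¹ • (q s - q t))) (𝓝[≠] t)
      (𝓝 (fluxPairing U α a w q')) :=
  Forchheimer.tendsto_fluxPairing hM hw (hq.memEnergy hM)
    ((hq.eventually_memEnergy_quotient hM).mono fun _ hs => hs.1) hq.tendsto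

theorem eventually_energyReal_quotient_le (hM : IsMedium U α a)
    (hq : HasEnergyDeriv U α a q q' t) :
    ∀ᶠ s in 𝓝[≠] t, energyReal U α a ((s - t)⁻¹ • (q s - q t))
      ≤ 4 * (1 + energyReal U α a q') := by
  have hq' := hq.memEnergy hM
  filter_upwards [hq.eventually_memEnergy_quotient hM,
    (tendsto_energyReal_zero hq.tendsto).eventually_lt_const one_pos] with s hs hlt
  have hneg : MemEnergy U α a (-q') := ⟨hq'.1.neg, by simpa only [energy_neg] using hq'.2⟩
  have hle := energyReal_sub_le hM (hs.sub hM hq') hneg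
  rw [sub_neg_eq_add, sub_add_cancel, energyReal, energyReal, energyReal, energy_neg] at hle
  rw [energyReal] at hlt
  simp only [energyReal]
  linarith

theorem eventually_abs_slope_potentialEnergy_sub_le (hM : IsMedium U α a)
    (hq : HasEnergyDeriv U α a q q' t) :
    ∀ᶠ s in 𝓝[≠] t, |slope (fun s => potentialEnergy U α a (q s)) t s
        - fluxPairing U α a (q t) ((s - t)⁻¹ • (q s - q t))|
      ≤ (|s - t| ^ (1 - degExp α) + |s - t|) * (4 * (4 * (1 + energyReal U α a q'))) := by
  have hqt := hq.eventually_memEnergy.self_of_nhds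
  filter_upwards [hq.eventually_memEnergy_quotient hM, hq.eventually_energyReal_quotient_le hM,
    hq.eventually_memEnergy.filter_mono nhdsWithin_le_nhds, self_mem_nhdsWithin]
    with s hquot hbound hqs hst
  have hst0 : s - t ≠ 0 := sub_ne_zero.2 hst
  have habs : 0 < |s - t| := abs_pos.2 hst0
  have hhom := energyReal_smul_le hM hquot (s - t)
  have hpow : |s - t| ^ (2 - degExp α) = |s - t| * |s - t| ^ (1 - degExp α) := by
    rw [← Real.rpow_one_add' habs.le (by linarith [degExp_lt_one hM.exponents])]
    ring_nf
  rw [smul_inv_smul₀ hst0, hpow] at hhom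
  rw [slope_def_module, smul_eq_mul, fluxPairing_smul, ← mul_sub, abs_mul, abs_inv,
    inv_mul_le_iff₀ habs]
  calc _ ≤ 4 * energyReal U α a (q s - q t) := abs_potentialEnergy_sub_sub_le hM hqs hqt
    _ ≤ 4 * _ := mul_le_mul_of_nonneg_left hhom zero_le_four
    _ = |s - t| * ((|s - t| ^ (1 - degExp α) + |s - t|)
          * (4 * energyReal U α a ((s - t)⁻¹ • (q s - q t)))) := by
      ring
    _ ≤ _ := by gcongr

theorem hasDerivAt_potentialEnergy (hM : IsMedium U α a) (hq : HasEnergyDeriv U α a q q' t) :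
    HasDerivAt (fun s => potentialEnergy U α a (q s)) (fluxPairing U α a (q t) q') t := by
  have hvanish : Tendsto (fun s => (|s - t| ^ (1 - degExp α) + |s - t|)
      * (4 * (4 * (1 + energyReal U α a q')))) (𝓝[≠] t) (𝓝 0) := by
    have hexp : 0 < 1 - degExp α := sub_pos.2 (degExp_lt_one hM.exponents)
    refine (Continuous.tendsto' ?_ _ _ ?_).mono_left nhdsWithin_le_nhds
    · exact (((continuous_abs.comp (continuous_sub_right t)).rpow_const fun _ =>
        Or.inr hexp.le).add (by fun_prop)).mul continuous_const
    · simp [Real.zero_rpow hexp.ne']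
  rw [hasDerivAt_iff_tendsto_slope]
  simpa using (squeeze_zero_norm' (hq.eventually_abs_slope_potentialEnergy_sub_le hM)
    hvanish).add (hq.tendsto_fluxPairing hM hq.eventually_memEnergy.self_of_nhds)

end HasEnergyDeriv

end EnergyDerivative

section Comparison

variable {f f' : ℝ → ℝ} {Y δ T : ℝ}

theorem exists_le_of_hasDerivAt (hδ : 0 < δ) (hf : ∀ t, T < t → HasDerivAt f (f' t) t)
    (hdecay : ∀ t, T < t → Y ≤ f t → f' t ≤ -δ) : ∃ t, T < t ∧ f t ≤ Y := by
  by_contra! habove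
  have hT {x : ℝ} (hx : T + 1 ≤ x) : T < x := (lt_add_one T).trans_le hx
  have hgap : 0 < (f (T + 1) - Y) / (δ / 2) :=
    div_pos (sub_pos.2 (habove _ (lt_add_one T))) (half_pos hδ)
  have hdescent : f (T + 1 + (f (T + 1) - Y) / (δ / 2))
      ≤ f (T + 1) - δ / 2 * (T + 1 + (f (T + 1) - Y) / (δ / 2) - (T + 1)) := by
    refine image_le_of_deriv_right_lt_deriv_boundary (f' := f') (B' := fun _ => -(δ / 2))
      (B := fun b => f (T + 1) - δ / 2 * (b - (T + 1)))
      (fun x hx => (hf x (hT hx.1)).continuousAt.continuousWithinAt)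
      (fun x hx => (hf x (hT hx.1)).hasDerivWithinAt) (by simp) (fun x => ?_)
      (fun x hx _ => ?_) ⟨by linarith, le_rfl⟩
    · simpa using (((hasDerivAt_id x).sub_const (T + 1)).const_mul (δ / 2)).const_sub (f (T + 1))
    · linarith [hdecay x (hT hx.1) (habove x (hT hx.1)).le]
  rw [add_sub_cancel_left, mul_div_cancel₀ _ (half_pos hδ).ne', sub_sub_cancel] at hdescent
  exact (habove _ (hT (le_add_of_nonneg_right hgap.le))).not_ge hdescent

theorem eventually_le_of_hasDerivAt (hδ : 0 < δ)
    (hf : ∀ᶠ t in atTop, HasDerivAt f (f' t) t)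
    (hdecay : ∀ᶠ t in atTop, Y ≤ f t → f' t ≤ -δ) : ∀ᶠ t in atTop, f t ≤ Y := by
  obtain ⟨T, hT⟩ := eventually_atTop.1 (hf.and hdecay)
  obtain ⟨t₁, ht₁, hft₁⟩ := exists_le_of_hasDerivAt hδ (fun t ht => (hT t ht.le).1)
    fun t ht => (hT t ht.le).2
  filter_upwards [eventually_ge_atTop t₁] with b hb
  have hderiv (x : ℝ) (hx : t₁ ≤ x) : HasDerivAt f (f' x) x := (hT x (ht₁.le.trans hx)).1
  refine image_le_of_deriv_right_lt_deriv_boundary (f' := f') (B := fun _ => Y) (B' := fun _ => 0)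
    (fun x hx => (hderiv x hx.1).continuousAt.continuousWithinAt)
    (fun x hx => (hderiv x hx.1).hasDerivWithinAt) hft₁
    (fun x => hasDerivAt_const x Y) (fun x hx hfx => ?_) ⟨hb, le_rfl⟩
  linarith [(hT x (ht₁.le.trans hx.1)).2 hfx.ge]

end Comparison

section Regular

variable {n N : ℕ} {U : Set (Space n)} {φ : Space n → ℝ} {α : Fin (N + 1) → ℝ}
  {a : Fin (N + 1) → Space n → ℝ} {u : ℝ → Space n → ℝ} {t : ℝ}

namespace IsRegular

theorem aestronglyMeasurable (hu : IsRegular U φ α a u) (ht : 0 < t) :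
    AEStronglyMeasurable (u t) (volume.restrict U) :=
  (hasWeakGrad_weakGrad (hu.grad t ht)).locInt.aestronglyMeasurable

theorem eventually_aestronglyMeasurable (hu : IsRegular U φ α a u) (ht : 0 < t) :
    ∀ᶠ s in 𝓝 t, AEStronglyMeasurable (u s) (volume.restrict U) :=
  (eventually_gt_nhds ht).mono fun _ => hu.aestronglyMeasurable

theorem hasTimeDeriv (hu : IsRegular U φ α a u) (ht : 0 < t) :
    HasTimeDeriv U φ u t (timeDeriv U φ u t) :=
  hasTimeDeriv_timeDeriv (hu.deriv t ht)

theorem memL2_timeDeriv (hu : IsRegular U φ α a u) (ht : 0 < t) :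
    MemL2 U φ (timeDeriv U φ u t) :=
  (hu.hasTimeDeriv ht).1

theorem memEnergy (hu : IsRegular U φ α a u) (ht : 0 < t) :
    MemEnergy U α a (weakGrad U (u t)) where
  aestronglyMeasurable := (hasWeakGrad_weakGrad (hu.grad t ht)).locInt_grad.aestronglyMeasurable
  energy_lt_top := hu.energy_lt_top t ht

theorem hasEnergyDeriv (hu : IsRegular U φ α a u) (ht : 0 < t) :
    HasEnergyDeriv U α a (fun s => weakGrad U (u s)) (weakGrad U (timeDeriv U φ u t)) t where
  eventually_memEnergy := (eventually_gt_nhds ht).mono fun _ => hu.memEnergy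
  aestronglyMeasurable :=
    (hasWeakGrad_weakGrad (hu.grad_deriv t ht)).locInt_grad.aestronglyMeasurable
  tendsto := hu.deriv_grad t ht

end IsRegular

end Regular

section Solutions

variable {n N : ℕ} {U : Set (Space n)} {φ : Space n → ℝ} {α : Fin (N + 1) → ℝ}
  {a : Fin (N + 1) → Space n → ℝ} {Ψ p Ψ' p' : ℝ → Space n → ℝ} {p₀ p₀' v : Space n → ℝ}
  {r : Space n → Space n} {t s : ℝ}

namespace IsSolution

theorem hasDerivAt_toL2 (hU : MeasurableSet U) (hφ : IsPorosity U φ)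
    (hp : IsSolution U φ α a Ψ p₀ p) (hΨ : IsRegular U φ α a Ψ) (ht : 0 < t) :
    HasDerivAt (fun s => toL2 U φ (p s - Ψ s))
      (toL2 U φ (timeDeriv U φ p t) - toL2 U φ (timeDeriv U φ Ψ t)) t := by
  rw [← toL2_sub hU hφ (hp.regular.memL2_timeDeriv ht) (hΨ.memL2_timeDeriv ht)]
  exact ((hp.regular.hasTimeDeriv ht).sub hU hφ (hΨ.hasTimeDeriv ht)
    (hp.regular.eventually_aestronglyMeasurable ht)
    (hΨ.eventually_aestronglyMeasurable ht)).hasDerivAt_toL2 hU hφ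
    ((eventually_ge_nhds ht).mono hp.memL2)

theorem inner_toL2_of_vanishesOnBoundary (hM : IsMedium U α a) (hφ : IsPorosity U φ)
    (hp : IsSolution U φ α a Ψ p₀ p) (ht : 0 < t) (hv : MemL2 U φ v) (hr : MemEnergy U α a r)
    (hvr : weakGrad U v =ᵐ[volume.restrict U] r) (hboundary : VanishesOnBoundary U φ α a v) :
    inner ℝ (toL2 U φ (timeDeriv U φ p t)) (toL2 U φ v)
      = -fluxPairing U α a (weakGrad U (p t)) r := by
  obtain ⟨η, hη, hηv, hηr⟩ := hboundary
  have hU := hM.measurableSet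
  have hgrad : Tendsto (fun k => energy U α a (gradient (η k) - r)) atTop (𝓝 0) :=
    hηr.congr fun k => energy_congr (hvr.mono fun x hx => by rw [hx, Pi.sub_apply])
  have hgrad_meas (k : ℕ) : AEStronglyMeasurable (gradient (η k)) (volume.restrict U) :=
    (hη k).continuous_gradient.aestronglyMeasurable
  have hmem : ∀ᶠ k in atTop, MemL2 U φ (η k) :=
    (hηv.eventually_lt_const ENNReal.zero_lt_top).mono fun k =>
      memL2_of_normSq_sub_lt_top hU hφ (hη k).smooth.continuous.aestronglyMeasurable hv
  have hmem_grad : ∀ᶠ k in atTop, MemEnergy U α a (gradient (η k)) := by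
    filter_upwards [hgrad.eventually_lt_const ENNReal.zero_lt_top] with k hk
    have hsub : MemEnergy U α a (gradient (η k) - r) := ⟨(hgrad_meas k).sub hr.1, hk⟩
    simpa only [sub_add_cancel] using hsub.add hM hr
  refine tendsto_nhds_unique (tendsto_const_nhds.inner (tendsto_toL2 hU hφ hmem hv hηv))
    ((tendsto_fluxPairing hM (hp.regular.memEnergy ht) hr (.of_forall hgrad_meas)
      hgrad).neg.congr' ?_)
  filter_upwards [hmem, hmem_grad] with k hk hk'
  rw [inner_toL2 hU hφ (hp.regular.memL2_timeDeriv ht) hk]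
  exact (hp.equation t ht (η k) (hη k) hk'.energy_lt_top).symm

theorem inner_toL2_solution (hM : IsMedium U α a) (hUo : IsOpen U) (hφ : IsPorosity U φ)
    (hp : IsSolution U φ α a Ψ p₀ p) (hΨ' : IsRegular U φ α a Ψ')
    (hp' : IsSolution U φ α a Ψ' p₀' p') (ht : 0 < t) (hs : 0 < s) :
    inner ℝ (toL2 U φ (timeDeriv U φ p t)) (toL2 U φ (p' s - Ψ' s))
      = -fluxPairing U α a (weakGrad U (p t)) (weakGrad U (p' s) - weakGrad U (Ψ' s)) :=
  hp.inner_toL2_of_vanishesOnBoundary hM hφ ht (hp'.memL2 s hs.le)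
    ((hp'.regular.memEnergy hs).sub hM (hΨ'.memEnergy hs))
    (weakGrad_sub hUo (hp'.regular.grad s hs) (hΨ'.grad s hs)) (hp'.boundary s hs)

theorem inner_toL2_timeDeriv (hM : IsMedium U α a) (hUo : IsOpen U) (hφ : IsPorosity U φ)
    (hp : IsSolution U φ α a Ψ p₀ p) (hΨ : IsRegular U φ α a Ψ) (ht : 0 < t) :
    inner ℝ (toL2 U φ (timeDeriv U φ p t))
        (toL2 U φ (timeDeriv U φ p t) - toL2 U φ (timeDeriv U φ Ψ t))
      = -fluxPairing U α a (weakGrad U (p t))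
        (weakGrad U (timeDeriv U φ p t) - weakGrad U (timeDeriv U φ Ψ t)) := by
  have hq := hp.regular.memEnergy ht
  have hgrad (s : ℝ) (hs : 0 < s) : MemEnergy U α a (weakGrad U (p s) - weakGrad U (Ψ s)) :=
    (hp.regular.memEnergy hs).sub hM (hΨ.memEnergy hs)
  refine tendsto_nhds_unique (tendsto_const_nhds.inner
    (hp.hasDerivAt_toL2 hM.measurableSet hφ hΨ ht).tendsto_slope)
    ((((hp.regular.hasEnergyDeriv ht).sub hM (hΨ.hasEnergyDeriv ht)).tendsto_fluxPairing hM
      hq).neg.congr' ?_)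
  filter_upwards [nhdsWithin_le_nhds (eventually_gt_nhds ht)] with s hs
  rw [fluxPairing_smul, slope_def_module, real_inner_smul_right, inner_sub_right,
    hp.inner_toL2_solution hM hUo hφ hΨ hp ht hs, hp.inner_toL2_solution hM hUo hφ hΨ hp ht ht]
  simp only [Pi.sub_apply]
  rw [fluxPairing_sub hM hq (hgrad s hs) (hgrad t ht)]
  ring

end IsSolution

end Solutions

section Data

variable {n N : ℕ} {U : Set (Space n)} {φ : Space n → ℝ} {α : Fin (N + 1) → ℝ}
  {a : Fin (N + 1) → Space n → ℝ}

theorem integrable_of_lintegral_ofReal_le {Ω : Type*} [MeasurableSpace Ω] {μ : Measure Ω}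
    {f : Ω → ℝ} {B : ℝ} (hB : 0 ≤ B) (hf : AEStronglyMeasurable f μ) (hf0 : 0 ≤ᵐ[μ] f)
    (h : ∫⁻ x, ENNReal.ofReal (f x) ∂μ ≤ ENNReal.ofReal B) :
    Integrable f μ ∧ ∫ x, f x ∂μ ≤ B := by
  refine ⟨(lintegral_ofReal_ne_top_iff_integrable hf hf0).1
    (h.trans_lt ENNReal.ofReal_lt_top).ne, ?_⟩
  rw [integral_eq_lintegral_of_nonneg_ae hf0 hf]
  exact ENNReal.toReal_le_of_le_ofReal hB h

theorem integrable_inv_coeff_zero_mul_sq (hM : IsMedium U α a) {r : Space n → Space n} {B : ℝ}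
    (hB : 0 ≤ B) (hr : AEStronglyMeasurable r (volume.restrict U))
    (h : darcySq U a r ≤ ENNReal.ofReal B) :
    IntegrableOn (fun x => (a 0 x)⁻¹ * ‖r x‖ ^ 2) U ∧ ∫ x in U, (a 0 x)⁻¹ * ‖r x‖ ^ 2 ≤ B :=
  integrable_of_lintegral_ofReal_le hB
    ((hM.coeff.measurable 0).inv.mul (hr.norm.aemeasurable.pow_const 2)).aestronglyMeasurable
    (ae_restrict_of_forall_mem hM.measurableSet fun x hx =>
      mul_nonneg (inv_nonneg.2 (hM.coeff.pos_zero x hx).le) (sq_nonneg _)) h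

theorem two_mul_abs_K_mul_inner_le {E : Type*} [SeminormedAddCommGroup E] [InnerProductSpace ℝ E]
    (hα : IsExponents α) (ha : IsCoeff U a) {x : Space n} (hx : x ∈ U) {θ : ℝ} (hθ : 0 < θ)
    (u v : E) :
    2 * |K α a x ‖u‖ * inner ℝ u v| ≤
      θ * (K α a x ‖u‖ * ‖u‖ ^ 2) + θ⁻¹ * ((a 0 x)⁻¹ * ‖v‖ ^ 2) := by
  have hK := K_pos hα ha hx (norm_nonneg u)
  calc 2 * |K α a x ‖u‖ * inner ℝ u v|
      = K α a x ‖u‖ * (2 * |inner ℝ u v|) := by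
        rw [abs_mul, abs_of_pos hK]
        ring
    _ ≤ K α a x ‖u‖ * (θ * ‖u‖ ^ 2 + θ⁻¹ * ‖v‖ ^ 2) := by
        gcongr
        linarith [abs_real_inner_le_norm u v, two_mul_le_add_mul_sq (a := ‖u‖) (b := ‖v‖) hθ]
    _ = θ * (K α a x ‖u‖ * ‖u‖ ^ 2) + θ⁻¹ * (K α a x ‖u‖ * ‖v‖ ^ 2) := by ring
    _ ≤ _ := by
        gcongr
        exact K_le_inv_coeff_zero hα ha hx (norm_nonneg u)

theorem two_mul_abs_fluxPairing_le (hM : IsMedium U α a) {q r : Space n → Space n} {B θ : ℝ}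
    (hB : 0 ≤ B) (hθ : 0 < θ) (hq : MemEnergy U α a q)
    (hr : AEStronglyMeasurable r (volume.restrict U)) (h : darcySq U a r ≤ ENNReal.ofReal B) :
    2 * |fluxPairing U α a q r| ≤ θ * energyReal U α a q + θ⁻¹ * B := by
  obtain ⟨hrint, hrB⟩ := integrable_inv_coeff_zero_mul_sq hM hB hr h
  have hqint := (hq.integrable hM).const_mul θ
  have hflux : |∫ x in U, 2 * (K α a x ‖q x‖ * inner ℝ (q x) (r x))| ≤
      ∫ x in U, (θ * (K α a x ‖q x‖ * ‖q x‖ ^ 2) + θ⁻¹ * ((a 0 x)⁻¹ * ‖r x‖ ^ 2)) := by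
    rw [← Real.norm_eq_abs]
    refine norm_integral_le_of_norm_le (hqint.add (hrint.const_mul θ⁻¹))
      (ae_restrict_of_forall_mem hM.measurableSet fun x hx => ?_)
    rw [norm_mul, Real.norm_two, Real.norm_eq_abs]
    exact two_mul_abs_K_mul_inner_le hM.exponents hM.coeff hx hθ _ _
  rw [integral_const_mul, abs_mul, abs_two, integral_add hqint (hrint.const_mul _),
    integral_const_mul, integral_const_mul,
    ← energyReal_eq_integral hM hq.aestronglyMeasurable] at hflux
  exact hflux.trans (by gcongr)

theorem integrable_coeff_last (hM : IsMedium U α a) {A : ℝ} (hA : 0 ≤ A)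
    (h : BStar U a ≤ ENNReal.ofReal A) :
    IntegrableOn (a (Fin.last N)) U ∧ ∫ x in U, a (Fin.last N) x ≤ A :=
  integrable_of_lintegral_ofReal_le hA (hM.coeff.measurable _).aestronglyMeasurable
    (ae_restrict_of_forall_mem hM.measurableSet fun x hx => (hM.coeff.pos_last x hx).le)
    ((le_max_left _ _).trans h)

theorem IsMedium.aemeasurable_W1 (hM : IsMedium U α a) :
    AEMeasurable (W1 α a) (volume.restrict U) := by
  have hmax : AEMeasurable (maxCoeff a) (volume.restrict U) := by
    have hsup : maxCoeff a = Finset.univ.sup' Finset.univ_nonempty a := by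
      funext x
      simp only [maxCoeff, Finset.sup'_apply]
    rw [hsup]
    exact Finset.sup'_induction _ _ (p := fun f => AEMeasurable f (volume.restrict U))
      (fun _ hf _ hg => hf.sup hg) fun i _ => hM.coeff.measurable i
  exact ((hM.coeff.measurable _).pow_const _).div (hmax.const_mul _)

theorem integrable_W1_mul_rpow (hM : IsMedium U α a) {r : Space n → Space n} {A : ℝ} (hA : 0 ≤ A)
    (hr : AEStronglyMeasurable r (volume.restrict U))
    (h : ∫⁻ x in U, ENNReal.ofReal (W1 α a x * ‖r x‖ ^ (2 - degExp α)) ≤ ENNReal.ofReal A) :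
    IntegrableOn (fun x => W1 α a x * ‖r x‖ ^ (2 - degExp α)) U ∧
      ∫ x in U, W1 α a x * ‖r x‖ ^ (2 - degExp α) ≤ A :=
  integrable_of_lintegral_ofReal_le hA
    (hM.aemeasurable_W1.mul (hr.norm.aemeasurable.pow_const _)).aestronglyMeasurable
    (ae_restrict_of_forall_mem hM.measurableSet fun _ hx =>
      mul_nonneg (W1_pos hM.exponents hM.coeff hx).le (by positivity)) h

theorem normSq_rpow_half (hU : MeasurableSet U) (hφ : IsPorosity U φ) {u : Space n → ℝ}
    (hu : MemL2 U φ u) : normSq U φ u ^ (1 / 2 : ℝ) = ENNReal.ofReal ‖toL2 U φ u‖ := by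
  rw [normSq_eq_norm_toL2_sq hU hφ hu, ENNReal.ofReal_rpow_of_nonneg (by positivity) (by norm_num),
    ← Real.sqrt_eq_rpow, Real.sqrt_sq (norm_nonneg _)]

theorem PoincareSobolev.norm_toL2_rpow_le (hM : IsMedium U α a) (hφ : IsPorosity U φ) {c : ℝ}
    (hc : 0 ≤ c) {u f : Space n → ℝ} (hP : PoincareSobolev U φ α a c u) (hu : MemL2 U φ u)
    (hf : IntegrableOn f U)
    (h : ∀ᵐ x ∂(volume.restrict U), W1 α a x * ‖weakGrad U u x‖ ^ (2 - degExp α) ≤ f x) :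
    ‖toL2 U φ u‖ ^ (2 - degExp α) ≤ c ^ (2 - degExp α) * ∫ x in U, f x := by
  have hγ : 0 < 2 - degExp α := by linarith [degExp_lt_one hM.exponents]
  have hf0 : 0 ≤ᵐ[volume.restrict U] f := by
    filter_upwards [h, ae_restrict_mem hM.measurableSet] with x hfx hx
    exact (mul_nonneg (W1_pos hM.exponents hM.coeff hx).le (by positivity)).trans hfx
  have hint := integral_nonneg_of_ae hf0
  have hlint : ∫⁻ x in U, ENNReal.ofReal (W1 α a x * ‖weakGrad U u x‖ ^ (2 - degExp α))
      ≤ ENNReal.ofReal (∫ x in U, f x) := by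
    rw [ofReal_integral_eq_lintegral_ofReal hf hf0]
    exact lintegral_mono_ae (h.mono fun _ hfx => ENNReal.ofReal_le_ofReal hfx)
  have hnorm : ‖toL2 U φ u‖ ≤ c * (∫ x in U, f x) ^ (1 / (2 - degExp α)) := by
    have := hP.trans (mul_le_mul_right (ENNReal.rpow_le_rpow hlint (one_div_pos.2 hγ).le) _)
    rwa [normSq_rpow_half hM.measurableSet hφ hu,
      ENNReal.ofReal_rpow_of_nonneg hint (one_div_pos.2 hγ).le, ← ENNReal.ofReal_mul hc,
      ENNReal.ofReal_le_ofReal_iff (by positivity)] at this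
  calc ‖toL2 U φ u‖ ^ (2 - degExp α)
      ≤ (c * (∫ x in U, f x) ^ (1 / (2 - degExp α))) ^ (2 - degExp α) := by gcongr
    _ = c ^ (2 - degExp α) * ∫ x in U, f x := by
        rw [Real.mul_rpow hc (by positivity), ← Real.rpow_mul hint, one_div_mul_cancel hγ.ne',
          Real.rpow_one]

variable {Ψ : ℝ → Space n → ℝ} {t : ℝ}

theorem BStar_le_G : BStar U a ≤ G U φ α a Ψ t :=
  le_add_right (le_add_right le_self_add)

theorem one_le_G : 1 ≤ G U φ α a Ψ t :=
  (le_max_right _ _).trans BStar_le_G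

theorem darcySq_weakGrad_le_G : darcySq U a (weakGrad U (Ψ t)) ≤ G U φ α a Ψ t :=
  le_add_right (le_add_right le_add_self)

theorem lintegral_W1_mul_rpow_le_G :
    ∫⁻ x in U, ENNReal.ofReal (W1 α a x * ‖weakGrad U (Ψ t) x‖ ^ (2 - degExp α))
      ≤ G U φ α a Ψ t :=
  le_add_right le_add_self

theorem norm_toL2_timeDeriv_le (hM : IsMedium U α a) (hφ : IsPorosity U φ) {m : ℝ} (hm : 0 ≤ m)
    (hΨ : MemL2 U φ (timeDeriv U φ Ψ t))
    (hG : G U φ α a Ψ t ≤ ENNReal.ofReal (m ^ (2 - degExp α))) :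
    ‖toL2 U φ (timeDeriv U φ Ψ t)‖ ≤ m ^ (1 - degExp α) := by
  have ha : 0 < 1 - degExp α := by linarith [degExp_lt_one hM.exponents]
  have hγ : 0 < 2 - degExp α := by linarith
  have hpow : normSq U φ (timeDeriv U φ Ψ t) ^ ((2 - degExp α) / (2 * (1 - degExp α))) ≤
      ENNReal.ofReal (m ^ (2 - degExp α)) := le_add_self.trans hG
  rw [show (2 - degExp α) / (2 * (1 - degExp α)) = 1 / 2 * ((2 - degExp α) / (1 - degExp α)) by
      field_simp, ENNReal.rpow_mul, normSq_rpow_half hM.measurableSet hφ hΨ,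
    ENNReal.ofReal_rpow_of_nonneg (norm_nonneg _) (by positivity),
    ENNReal.ofReal_le_ofReal_iff (by positivity)] at hpow
  calc ‖toL2 U φ (timeDeriv U φ Ψ t)‖
      = (‖toL2 U φ (timeDeriv U φ Ψ t)‖ ^ ((2 - degExp α) / (1 - degExp α))) ^
          ((1 - degExp α) / (2 - degExp α)) := by
        rw [← Real.rpow_mul (norm_nonneg _), div_mul_div_cancel₀ ha.ne', div_self hγ.ne',
          Real.rpow_one]
    _ ≤ (m ^ (2 - degExp α)) ^ ((1 - degExp α) / (2 - degExp α)) := by gcongr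
    _ = m ^ (1 - degExp α) := by
        rw [← Real.rpow_mul hm, mul_div_cancel₀ _ hγ.ne']

end Data

section SingleSolution

variable {n N : ℕ} {U : Set (Space n)} {φ : Space n → ℝ} {α : Fin (N + 1) → ℝ}
  {a : Fin (N + 1) → Space n → ℝ} {Ψ p : ℝ → Space n → ℝ} {p₀ : Space n → ℝ} {t c m B R : ℝ}

theorem norm_sub_rpow_le {E : Type*} [SeminormedAddCommGroup E] {γ : ℝ} (hγ1 : 1 ≤ γ)
    (hγ2 : γ ≤ 2) (u v : E) : ‖u - v‖ ^ γ ≤ 2 * (‖u‖ ^ γ + ‖v‖ ^ γ) := by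
  have hmean : (‖u‖ + ‖v‖) ^ γ ≤ 2 ^ (γ - 1) * (‖u‖ ^ γ + ‖v‖ ^ γ) :=
    mod_cast NNReal.rpow_add_le_mul_rpow_add_rpow ‖u‖₊ ‖v‖₊ hγ1
  have htwo : (2 : ℝ) ^ (γ - 1) ≤ 2 := by
    simpa using Real.rpow_le_rpow_of_exponent_le one_le_two (by linarith : γ - 1 ≤ 1)
  calc ‖u - v‖ ^ γ ≤ (‖u‖ + ‖v‖) ^ γ := by gcongr; exact norm_sub_le u v
    _ ≤ 2 ^ (γ - 1) * (‖u‖ ^ γ + ‖v‖ ^ γ) := hmean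
    _ ≤ 2 * (‖u‖ ^ γ + ‖v‖ ^ γ) := by gcongr

theorem exists_forall_affine_le_rpow {γ : ℝ} (hγ : 1 < γ) (c : ℝ) :
    ∃ R : ℝ, 1 ≤ R ∧ ∀ r, R ≤ r → c * (3 + 2 * r) ≤ r ^ γ := by
  obtain ⟨R, hR⟩ := eventually_atTop.1
    ((tendsto_rpow_atTop (sub_pos.2 hγ)).eventually_ge_atTop (|c| * 5))
  refine ⟨max R 1, le_max_right _ _, fun r hr => ?_⟩
  have hr1 : 1 ≤ r := (le_max_right _ _).trans hr
  calc c * (3 + 2 * r) ≤ |c| * (3 + 2 * r) := by gcongr; exact le_abs_self c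
    _ ≤ |c| * (5 * r) := by gcongr; linarith
    _ = |c| * 5 * r := by ring
    _ ≤ r ^ (γ - 1) * r := by gcongr; exact hR r ((le_max_left _ _).trans hr)
    _ = r ^ γ := by rw [← Real.rpow_add_one (by linarith), sub_add_cancel]

namespace IsSolution

theorem norm_toL2_rpow_le (hM : IsMedium U α a) (hUo : IsOpen U) (hφ : IsPorosity U φ)
    (hΨ : IsRegular U φ α a Ψ) (hp : IsSolution U φ α a Ψ p₀ p) (hc : 0 ≤ c)
    (hP : PoincareSobolev U φ α a c (p t - Ψ t)) (ht : 0 < t) (hm : 0 ≤ m)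
    (hG : G U φ α a Ψ t ≤ ENNReal.ofReal (m ^ (2 - degExp α))) :
    ‖toL2 U φ (p t - Ψ t)‖ ^ (2 - degExp α) ≤ 4 * c ^ (2 - degExp α) *
      (energyReal U α a (weakGrad U (p t)) + m ^ (2 - degExp α)) := by
  have ha0 := degExp_pos hM.exponents
  have ha1 := degExp_lt_one hM.exponents
  have hA : 0 ≤ m ^ (2 - degExp α) := by positivity
  have hq := hp.regular.memEnergy ht
  obtain ⟨hlast, hlast_le⟩ := integrable_coeff_last hM hA (BStar_le_G.trans hG)
  obtain ⟨hW, hW_le⟩ := integrable_W1_mul_rpow hM hA (hΨ.memEnergy ht).aestronglyMeasurable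
    (lintegral_W1_mul_rpow_le_G.trans hG)
  have hqint := (hq.integrable hM).const_mul 2
  have hbound : ∀ᵐ x ∂(volume.restrict U),
      W1 α a x * ‖weakGrad U (p t - Ψ t) x‖ ^ (2 - degExp α) ≤
        2 * (2 * (K α a x ‖weakGrad U (p t) x‖ * ‖weakGrad U (p t) x‖ ^ 2) + a (Fin.last N) x
          + W1 α a x * ‖weakGrad U (Ψ t) x‖ ^ (2 - degExp α)) := by
    filter_upwards [weakGrad_sub hUo (hp.regular.grad t ht) (hΨ.grad t ht),
      ae_restrict_mem hM.measurableSet] with x hgrad hx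
    have hWx := W1_pos hM.exponents hM.coeff hx
    have hsub := mul_le_mul_of_nonneg_left (norm_sub_rpow_le (by linarith : 1 ≤ 2 - degExp α)
      (by linarith) (weakGrad U (p t) x) (weakGrad U (Ψ t) x)) hWx.le
    rw [hgrad, Pi.sub_apply]
    linarith [W1_mul_rpow_le hM.exponents hM.coeff hx (norm_nonneg (weakGrad U (p t) x))]
  have hnorm := hP.norm_toL2_rpow_le hM hφ hc (hp.memL2 t ht.le)
    (((hqint.add hlast).add hW).const_mul 2) hbound
  rw [integral_const_mul, integral_add' (hqint.add hlast) hW, integral_add' hqint hlast,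
    integral_const_mul, ← energyReal_eq_integral hM hq.aestronglyMeasurable] at hnorm
  calc _ ≤ _ := hnorm
    _ ≤ c ^ (2 - degExp α) *
        (2 * (2 * energyReal U α a (weakGrad U (p t)) + m ^ (2 - degExp α)
          + m ^ (2 - degExp α))) := by gcongr
    _ = _ := by ring

theorem two_mul_inner_toL2_le (hM : IsMedium U α a) (hUo : IsOpen U) (hφ : IsPorosity U φ)
    (hΨ : IsRegular U φ α a Ψ) (hp : IsSolution U φ α a Ψ p₀ p) (ht : 0 < t) (hm : 0 ≤ m)
    (hG : G U φ α a Ψ t ≤ ENNReal.ofReal (m ^ (2 - degExp α))) :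
    2 * inner ℝ (toL2 U φ (p t - Ψ t))
        (toL2 U φ (timeDeriv U φ p t) - toL2 U φ (timeDeriv U φ Ψ t)) ≤
      -energyReal U α a (weakGrad U (p t)) + m ^ (2 - degExp α)
        + 2 * (‖toL2 U φ (p t - Ψ t)‖ * m ^ (1 - degExp α)) := by
  have hq := hp.regular.memEnergy ht
  have hψ := hΨ.memEnergy ht
  have hflux := two_mul_abs_fluxPairing_le hM (by positivity) one_pos hq hψ.aestronglyMeasurable
    (darcySq_weakGrad_le_G.trans hG)
  have hcauchy : -inner ℝ (toL2 U φ (p t - Ψ t)) (toL2 U φ (timeDeriv U φ Ψ t)) ≤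
      ‖toL2 U φ (p t - Ψ t)‖ * m ^ (1 - degExp α) :=
    ((neg_le_abs _).trans (abs_real_inner_le_norm _ _)).trans (mul_le_mul_of_nonneg_left
      (norm_toL2_timeDeriv_le hM hφ hm (hΨ.memL2_timeDeriv ht) hG) (norm_nonneg _))
  rw [inner_sub_right, real_inner_comm, hp.inner_toL2_solution hM hUo hφ hΨ hp ht ht,
    fluxPairing_sub hM hq hq hψ, fluxPairing_self hM hq.aestronglyMeasurable]
  linarith [le_abs_self (fluxPairing U α a (weakGrad U (p t)) (weakGrad U (Ψ t)))]

theorem fluxPairing_timeDeriv_le (hM : IsMedium U α a) (hUo : IsOpen U) (hφ : IsPorosity U φ)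
    (hΨ : IsRegular U φ α a Ψ) (hp : IsSolution U φ α a Ψ p₀ p) (ht : 0 < t) (hm : 0 ≤ m)
    (hB : 0 ≤ B) (hG : G U φ α a Ψ t ≤ ENNReal.ofReal (m ^ (2 - degExp α)))
    (hG1 : G1 U φ a Ψ t ≤ ENNReal.ofReal B) :
    fluxPairing U α a (weakGrad U (p t)) (weakGrad U (timeDeriv U φ p t)) ≤
      energyReal U α a (weakGrad U (p t)) / 2 + B / 2 + (m ^ (1 - degExp α)) ^ 2 / 2 := by
  have hq := hp.regular.memEnergy ht
  have hψ' := (hΨ.hasEnergyDeriv ht).memEnergy hM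
  have hflux := two_mul_abs_fluxPairing_le hM hB one_pos hq hψ'.aestronglyMeasurable hG1
  have htest := hp.inner_toL2_timeDeriv hM hUo hφ hΨ ht
  rw [fluxPairing_sub hM hq ((hp.regular.hasEnergyDeriv ht).memEnergy hM) hψ', inner_sub_right,
    real_inner_self_eq_norm_sq] at htest
  have hinner := real_inner_le_norm (toL2 U φ (timeDeriv U φ p t)) (toL2 U φ (timeDeriv U φ Ψ t))
  have hnorm := norm_toL2_timeDeriv_le hM hφ hm (hΨ.memL2_timeDeriv ht) hG
  have hsq := pow_le_pow_left₀ (norm_nonneg _) hnorm 2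
  linarith [le_abs_self (fluxPairing U α a (weakGrad U (p t)) (weakGrad U (timeDeriv U φ Ψ t))),
    two_mul_le_add_sq ‖toL2 U φ (timeDeriv U φ p t)‖ ‖toL2 U φ (timeDeriv U φ Ψ t)‖,
    sq_nonneg ‖toL2 U φ (timeDeriv U φ p t)‖]

theorem two_mul_inner_toL2_le_neg_one (hM : IsMedium U α a) (hUo : IsOpen U)
    (hφ : IsPorosity U φ) (hΨ : IsRegular U φ α a Ψ) (hp : IsSolution U φ α a Ψ p₀ p) (hc : 0 < c)
    (hP : PoincareSobolev U φ α a c (p t - Ψ t)) (hm : 1 ≤ m)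
    (hR : ∀ r, R ≤ r → 4 * c ^ (2 - degExp α) * (3 + 2 * r) ≤ r ^ (2 - degExp α)) (ht : 0 < t)
    (hG : G U φ α a Ψ t ≤ ENNReal.ofReal (m ^ (2 - degExp α)))
    (hlarge : R * m ≤ ‖toL2 U φ (p t - Ψ t)‖) :
    2 * inner ℝ (toL2 U φ (p t - Ψ t))
      (toL2 U φ (timeDeriv U φ p t) - toL2 U φ (timeDeriv U φ Ψ t)) ≤ -1 := by
  have hm0 : 0 < m := by linarith
  have hA : 1 ≤ m ^ (2 - degExp α) :=
    Real.one_le_rpow hm (by linarith [degExp_lt_one hM.exponents])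
  obtain ⟨r, hr⟩ : ∃ r, ‖toL2 U φ (p t - Ψ t)‖ = r * m :=
    ⟨_, (div_mul_cancel₀ _ hm0.ne').symm⟩
  have hRr : R ≤ r := le_of_mul_le_mul_right (hlarge.trans_eq hr) hm0
  have hr0 : 0 ≤ r := nonneg_of_mul_nonneg_left (hr ▸ norm_nonneg _) hm0
  have hcoercive := hp.norm_toL2_rpow_le hM hUo hφ hΨ hc.le hP ht hm0.le hG
  rw [hr, Real.mul_rpow hr0 hm0.le] at hcoercive
  have henergy : (3 + 2 * r) * m ^ (2 - degExp α) ≤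
      energyReal U α a (weakGrad U (p t)) + m ^ (2 - degExp α) := by
    refine le_of_mul_le_mul_left (?_ : 4 * c ^ (2 - degExp α) * _ ≤ _) (by positivity)
    rw [← mul_assoc]
    exact (mul_le_mul_of_nonneg_right (hR r hRr) (by positivity)).trans hcoercive
  have hderiv := hp.two_mul_inner_toL2_le hM hUo hφ hΨ ht hm0.le hG
  have hpow : m * m ^ (1 - degExp α) = m ^ (2 - degExp α) := by
    rw [← Real.rpow_one_add' hm0.le (by linarith [degExp_lt_one hM.exponents])]
    ring_nf
  rw [hr, mul_assoc r, hpow] at hderiv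
  linarith

theorem eventually_norm_toL2_le (hM : IsMedium U α a) (hUo : IsOpen U) (hφ : IsPorosity U φ)
    (hΨ : IsRegular U φ α a Ψ) (hp : IsSolution U φ α a Ψ p₀ p) (hc : 0 < c)
    (hP : ∀ t, 0 < t → PoincareSobolev U φ α a c (p t - Ψ t)) (hm : 1 ≤ m) (hR0 : 0 ≤ R)
    (hR : ∀ r, R ≤ r → 4 * c ^ (2 - degExp α) * (3 + 2 * r) ≤ r ^ (2 - degExp α))
    (hG : ∀ᶠ t in atTop, G U φ α a Ψ t ≤ ENNReal.ofReal (m ^ (2 - degExp α))) :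
    ∀ᶠ t in atTop, ‖toL2 U φ (p t - Ψ t)‖ ≤ R * m := by
  have hRm : 0 ≤ R * m := by positivity
  have hsq : ∀ᶠ t in atTop, ‖toL2 U φ (p t - Ψ t)‖ ^ 2 ≤ (R * m) ^ 2 := by
    refine eventually_le_of_hasDerivAt one_pos ((eventually_gt_atTop 0).mono fun t ht =>
      (hp.hasDerivAt_toL2 hM.measurableSet hφ hΨ ht).norm_sq) ?_
    filter_upwards [hG, eventually_gt_atTop 0] with t hGt ht hlarge
    exact hp.two_mul_inner_toL2_le_neg_one hM hUo hφ hΨ hc (hP t ht) hm hR ht hGt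
      (le_of_sq_le_sq hlarge (norm_nonneg _))
  exact hsq.mono fun t h => le_of_sq_le_sq h hRm

theorem eventually_energyReal_add_norm_sq_le (hM : IsMedium U α a) (hUo : IsOpen U)
    (hφ : IsPorosity U φ) (hΨ : IsRegular U φ α a Ψ) (hp : IsSolution U φ α a Ψ p₀ p)
    (hm : 1 ≤ m) (hR : 0 ≤ R) (hB : 0 ≤ B)
    (hG : ∀ᶠ t in atTop, G U φ α a Ψ t ≤ ENNReal.ofReal (m ^ (2 - degExp α)))
    (hG1 : ∀ᶠ t in atTop, G1 U φ a Ψ t ≤ ENNReal.ofReal B)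
    (hnorm : ∀ᶠ t in atTop, ‖toL2 U φ (p t - Ψ t)‖ ≤ R * m) :
    ∀ᶠ t in atTop, energyReal U α a (weakGrad U (p t)) / 2 + ‖toL2 U φ (p t - Ψ t)‖ ^ 2 ≤
      (6 + 4 * R + R ^ 2) * (m ^ 2 + B) := by
  have hm0 : 0 ≤ m := by linarith
  have ha0 := degExp_pos hM.exponents
  have hm_sq : 1 ≤ m ^ 2 := one_le_pow₀ hm
  have hm_gamma : m ^ (2 - degExp α) ≤ m ^ 2 := by
    rw [← Real.rpow_two]
    exact Real.rpow_le_rpow_of_exponent_le hm (by linarith)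
  have hm_le : m ^ (1 - degExp α) ≤ m := by
    simpa using Real.rpow_le_rpow_of_exponent_le hm (by linarith : 1 - degExp α ≤ 1)
  suffices hlyapunov : ∀ᶠ t in atTop,
      potentialEnergy U α a (weakGrad U (p t)) + ‖toL2 U φ (p t - Ψ t)‖ ^ 2 ≤
        (6 + 4 * R + R ^ 2) * (m ^ 2 + B) by
    filter_upwards [hlyapunov, eventually_gt_atTop 0] with t h ht
    linarith [energyReal_le_two_mul_potentialEnergy hM (hp.regular.memEnergy ht)]
  refine eventually_le_of_hasDerivAt one_pos ((eventually_gt_atTop 0).mono fun t ht =>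
    ((hp.regular.hasEnergyDeriv ht).hasDerivAt_potentialEnergy hM).add
      (hp.hasDerivAt_toL2 hM.measurableSet hφ hΨ ht).norm_sq) ?_
  filter_upwards [hG, hG1, hnorm, eventually_gt_atTop 0] with t hGt hG1t hnormt ht hlarge
  have hflux := hp.fluxPairing_timeDeriv_le hM hUo hφ hΨ ht hm0 hB hGt hG1t
  have hinner := hp.two_mul_inner_toL2_le hM hUo hφ hΨ ht hm0 hGt
  have hpotential := potentialEnergy_le_energyReal hM (hp.regular.memEnergy ht)
  have hnorm_sq : ‖toL2 U φ (p t - Ψ t)‖ ^ 2 ≤ R ^ 2 * m ^ 2 := by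
    rw [← mul_pow]
    gcongr
  have hsq : (m ^ (1 - degExp α)) ^ 2 ≤ m ^ 2 := by gcongr
  have hprod : ‖toL2 U φ (p t - Ψ t)‖ * m ^ (1 - degExp α) ≤ R * m * m := by gcongr
  have hRB : 0 ≤ (4 * R + R ^ 2) * B := by positivity
  nlinarith

end IsSolution

end SingleSolution

section Dissipation

variable {n N : ℕ} {U : Set (Space n)} {φ : Space n → ℝ} {α : Fin (N + 1) → ℝ}
  {a : Fin (N + 1) → Space n → ℝ} {q r f : Space n → Space n} {u : Space n → ℝ}

/-- The part of the dissipation of the difference of two fields that strong monotonicity of the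
flux controls. -/
noncomputable def fluxDissipation (U : Set (Space n)) (α : Fin (N + 1) → ℝ)
    (a : Fin (N + 1) → Space n → ℝ) (q r : Space n → Space n) : ℝ :=
  ∫ x in U, K α a x (max ‖q x‖ ‖r x‖) * ‖q x - r x‖ ^ 2

theorem fluxDissipation_density_nonneg (hM : IsMedium U α a) (q r : Space n → Space n) :
    ∀ᵐ x ∂(volume.restrict U), 0 ≤ K α a x (max ‖q x‖ ‖r x‖) * ‖q x - r x‖ ^ 2 :=
  ae_restrict_of_forall_mem hM.measurableSet fun x hx => mul_nonneg
    (K_pos hM.exponents hM.coeff hx (le_max_of_le_left (norm_nonneg (q x)))).le (sq_nonneg _)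

theorem fluxDissipation_nonneg (hM : IsMedium U α a) : 0 ≤ fluxDissipation U α a q r :=
  integral_nonneg_of_ae (fluxDissipation_density_nonneg hM q r)

theorem ae_flux_strongly_monotone (hM : IsMedium U α a) (q r : Space n → Space n) :
    ∀ᵐ x ∂(volume.restrict U),
      (1 - degExp α) * (K α a x (max ‖q x‖ ‖r x‖) * ‖q x - r x‖ ^ 2) ≤
        K α a x ‖q x‖ * inner ℝ (q x) ((q - r) x) - K α a x ‖r x‖ * inner ℝ (r x) ((q - r) x) :=
  ae_restrict_of_forall_mem hM.measurableSet fun x hx =>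
    flux_strongly_monotone hM.exponents hM.coeff hx (q x) (r x)

theorem MemEnergy.integrable_fluxDissipation (hM : IsMedium U α a) (hq : MemEnergy U α a q)
    (hr : MemEnergy U α a r) :
    IntegrableOn (fun x => K α a x (max ‖q x‖ ‖r x‖) * ‖q x - r x‖ ^ 2) U := by
  have hone : 0 < 1 - degExp α := sub_pos.2 (degExp_lt_one hM.exponents)
  have hqr := hq.sub hM hr
  refine (((hq.integrable_flux hM hqr).sub (hr.integrable_flux hM hqr)).const_mul
    (1 - degExp α)⁻¹).mono' ?_ ?_
  · exact ((hM.aemeasurable_K (hq.1.norm.aemeasurable.max hr.1.norm.aemeasurable)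
      fun x => le_max_of_le_left (norm_nonneg (q x))).mul
      (hqr.1.norm.aemeasurable.pow_const 2)).aestronglyMeasurable
  · filter_upwards [ae_flux_strongly_monotone hM q r, fluxDissipation_density_nonneg hM q r]
      with x hmono hnonneg
    rw [Real.norm_of_nonneg hnonneg, inv_mul_eq_div, le_div_iff₀' hone]
    exact hmono

theorem one_sub_degExp_mul_fluxDissipation_le (hM : IsMedium U α a) (hq : MemEnergy U α a q)
    (hr : MemEnergy U α a r) :
    (1 - degExp α) * fluxDissipation U α a q r ≤
      fluxPairing U α a q (q - r) - fluxPairing U α a r (q - r) := by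
  have hqflux := hq.integrable_flux hM (hq.sub hM hr)
  have hrflux := hr.integrable_flux hM (hq.sub hM hr)
  rw [fluxDissipation, fluxPairing, fluxPairing, ← integral_const_mul,
    ← integral_sub hqflux hrflux]
  exact integral_mono_ae ((hq.integrable_fluxDissipation hM hr).const_mul _)
    (hqflux.sub hrflux) (ae_flux_strongly_monotone hM q r)

theorem sq_le_of_forall_young {e y P S M : ℝ} (he : e < 2) (hy : 0 ≤ y)
    (hP : 0 < P) (hM : 0 < M) (hS : 0 ≤ S)
    (h : ∀ σ, 0 < σ → y ^ (2 - e) ≤ P * (σ ^ (-e) * S + σ ^ (2 - e) * M)) :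
    y ^ 2 ≤ 2 * P * (2 * P * M) ^ (e / (2 - e)) * S := by
  rcases hy.eq_or_lt with rfl | hy
  · rw [zero_pow two_ne_zero]
    positivity
  have hγ : 0 < 2 - e := by linarith
  -- With this `σ` the second term is half of the left-hand side.
  set σ := y / (2 * P * M) ^ (1 / (2 - e)) with hσ
  have hσ0 : 0 < σ := by positivity
  have hσγ : P * (σ ^ (2 - e) * M) = y ^ (2 - e) / 2 := by
    rw [hσ, Real.div_rpow hy.le (by positivity), ← Real.rpow_mul (by positivity),
      one_div_mul_cancel hγ.ne', Real.rpow_one]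
    field_simp
  have hσe : σ ^ e = y ^ e / (2 * P * M) ^ (e / (2 - e)) := by
    rw [hσ, Real.div_rpow hy.le (by positivity), ← Real.rpow_mul (by positivity),
      one_div_mul_eq_div]
  have habsorb : y ^ (2 - e) ≤ 2 * P * S / σ ^ e := by
    rw [mul_div_assoc, div_eq_inv_mul, ← Real.rpow_neg hσ0.le]
    linarith [h σ hσ0]
  have hsq : y ^ 2 = y ^ (2 - e) * y ^ e := by
    rw [← Real.rpow_add hy, sub_add_cancel, Real.rpow_two]
  calc y ^ 2 ≤ 2 * P * S / σ ^ e * y ^ e := by rw [hsq]; gcongr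
    _ = 2 * P * (2 * P * M) ^ (e / (2 - e)) * S := by
        rw [hσe]
        field_simp

theorem W1_mul_norm_sub_sub_rpow_le {E : Type*} [SeminormedAddCommGroup E] (hα : IsExponents α)
    (ha : IsCoeff U a) {x : Space n} (hx : x ∈ U) {σ : ℝ} (hσ : 0 < σ) (u v w : E) :
    W1 α a x * ‖u - v - w‖ ^ (2 - degExp α) ≤
      4 * σ ^ (-degExp α) *
          (K α a x (max ‖u‖ ‖v‖) * ‖u - v‖ ^ 2 + (a 0 x)⁻¹ * ‖w‖ ^ 2)
        + 2 * σ ^ (2 - degExp α) *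
          (K α a x ‖u‖ * ‖u‖ ^ 2 + K α a x ‖v‖ * ‖v‖ ^ 2 + a (Fin.last N) x) := by
  have hmax : 0 ≤ max ‖u‖ ‖v‖ := le_max_of_le_left (norm_nonneg u)
  have hK := (K_pos hα ha hx hmax).le
  have hsq : ‖u - v - w‖ ^ 2 ≤ 2 * (‖u - v‖ ^ 2 + ‖w‖ ^ 2) :=
    (pow_le_pow_left₀ (norm_nonneg _) (norm_sub_le _ _) 2).trans (add_sq_le ..)
  have hKsq : K α a x (max ‖u‖ ‖v‖) * ‖u - v - w‖ ^ 2 ≤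
      2 * (K α a x (max ‖u‖ ‖v‖) * ‖u - v‖ ^ 2 + (a 0 x)⁻¹ * ‖w‖ ^ 2) := by
    have hKw := mul_le_mul_of_nonneg_right (K_le_inv_coeff_zero hα ha hx hmax) (sq_nonneg ‖w‖)
    linarith [mul_le_mul_of_nonneg_left hsq hK]
  have hKmax : K α a x (max ‖u‖ ‖v‖) * max ‖u‖ ‖v‖ ^ 2 ≤
      K α a x ‖u‖ * ‖u‖ ^ 2 + K α a x ‖v‖ * ‖v‖ ^ 2 := by
    have hu := K_mul_sq_nonneg hα ha hx (norm_nonneg u)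
    have hv := K_mul_sq_nonneg hα ha hx (norm_nonneg v)
    rcases max_cases ‖u‖ ‖v‖ with ⟨h, -⟩ | ⟨h, -⟩ <;> rw [h] <;> linarith
  calc W1 α a x * ‖u - v - w‖ ^ (2 - degExp α)
      ≤ 2 * σ ^ (-degExp α) * (K α a x (max ‖u‖ ‖v‖) * ‖u - v - w‖ ^ 2)
        + 2 * σ ^ (2 - degExp α) *
          (K α a x (max ‖u‖ ‖v‖) * max ‖u‖ ‖v‖ ^ 2 + a (Fin.last N) x) :=
        W1_mul_rpow_le_young hα ha hx hmax (norm_nonneg _) hσ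
    _ ≤ 2 * σ ^ (-degExp α) *
          (2 * (K α a x (max ‖u‖ ‖v‖) * ‖u - v‖ ^ 2 + (a 0 x)⁻¹ * ‖w‖ ^ 2))
        + 2 * σ ^ (2 - degExp α) *
          (K α a x ‖u‖ * ‖u‖ ^ 2 + K α a x ‖v‖ * ‖v‖ ^ 2 + a (Fin.last N) x) := by gcongr
    _ = _ := by ring

theorem PoincareSobolev.norm_toL2_sq_le (hM : IsMedium U α a) (hφ : IsPorosity U φ)
    {c A B M : ℝ} (hc : 0 < c) (hA : 0 ≤ A) (hB : 0 ≤ B) (hM0 : 0 < M)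
    (hP : PoincareSobolev U φ α a c u) (hu : MemL2 U φ u) (hq : MemEnergy U α a q)
    (hr : MemEnergy U α a r) (hf : AEStronglyMeasurable f (volume.restrict U))
    (hgrad : weakGrad U u =ᵐ[volume.restrict U] q - r - f)
    (hstar : BStar U a ≤ ENNReal.ofReal A)
    (hsum : energyReal U α a q + energyReal U α a r + A ≤ M)
    (hdarcy : darcySq U a f ≤ ENNReal.ofReal B) :
    ‖toL2 U φ u‖ ^ 2 ≤ 8 * c ^ (2 - degExp α) *
      (4 * c ^ (2 - degExp α) * M) ^ (degExp α / (2 - degExp α)) *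
      (fluxDissipation U α a q r + B) := by
  have hlt := degExp_lt_one hM.exponents
  have hJ := hq.integrable_fluxDissipation hM hr
  have hJ0 := fluxDissipation_nonneg hM (q := q) (r := r)
  obtain ⟨hfint, hfB⟩ := integrable_inv_coeff_zero_mul_sq hM hB hf hdarcy
  obtain ⟨hlast, hlastA⟩ := integrable_coeff_last hM hA hstar
  have hqr := (hq.integrable hM).add (hr.integrable hM)
  have hyoung := sq_le_of_forall_young (e := degExp α) (y := ‖toL2 U φ u‖) (P := c ^ (2 - degExp α))
    (S := 4 * (fluxDissipation U α a q r + B)) (M := 2 * M) (by linarith)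
    (norm_nonneg _) (by positivity) (by positivity) (by positivity) fun σ hσ => ?_
  · calc _ ≤ _ := hyoung
      _ = _ := by ring_nf
  have hnorm := hP.norm_toL2_rpow_le hM hφ hc.le hu
    (((hJ.add hfint).const_mul (4 * σ ^ (-degExp α))).add
      ((hqr.add hlast).const_mul (2 * σ ^ (2 - degExp α)))) (by
    filter_upwards [hgrad, ae_restrict_mem hM.measurableSet] with x hgradx hx
    rw [hgradx]
    exact W1_mul_norm_sub_sub_rpow_le hM.exponents hM.coeff hx hσ (q x) (r x) (f x))
  rw [integral_add' ((hJ.add hfint).const_mul _) ((hqr.add hlast).const_mul _),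
    integral_const_mul, integral_const_mul, integral_add' hJ hfint, integral_add' hqr hlast,
    integral_add' (hq.integrable hM) (hr.integrable hM),
    ← energyReal_eq_integral hM hq.aestronglyMeasurable,
    ← energyReal_eq_integral hM hr.aestronglyMeasurable, ← fluxDissipation] at hnorm
  calc _ ≤ _ := hnorm
    _ ≤ c ^ (2 - degExp α) * (4 * σ ^ (-degExp α) * (fluxDissipation U α a q r + B)
        + 2 * σ ^ (2 - degExp α) * M) := by
      gcongr
      linarith
    _ = _ := by ring

end Dissipation

section BoundaryDifference

variable {n N : ℕ} {U : Set (Space n)} {φ : Space n → ℝ} {α : Fin (N + 1) → ℝ}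
  {a : Fin (N + 1) → Space n → ℝ} {Ψ₁ Ψ₂ : ℝ → Space n → ℝ} {t d : ℝ}

namespace IsRegular

theorem timeDeriv_sub (hU : MeasurableSet U) (hφ : IsPorosity U φ) (hΨ₁ : IsRegular U φ α a Ψ₁)
    (hΨ₂ : IsRegular U φ α a Ψ₂) (ht : 0 < t) :
    timeDeriv U φ (Ψ₁ - Ψ₂) t =ᵐ[volume.restrict U] timeDeriv U φ Ψ₁ t - timeDeriv U φ Ψ₂ t := by
  have hmeas₁ := hΨ₁.eventually_aestronglyMeasurable ht
  have hmeas₂ := hΨ₂.eventually_aestronglyMeasurable ht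
  have hsub := (hΨ₁.hasTimeDeriv ht).sub hU hφ (hΨ₂.hasTimeDeriv ht) hmeas₁ hmeas₂
  exact (hasTimeDeriv_timeDeriv ⟨_, hsub⟩).ae_eq hU hφ hsub
    (hmeas₁.mp (hmeas₂.mono fun _ h₂ h₁ => h₁.sub h₂))

theorem darcySq_weakGrad_sub (hUo : IsOpen U) (hΨ₁ : IsRegular U φ α a Ψ₁)
    (hΨ₂ : IsRegular U φ α a Ψ₂) (ht : 0 < t) :
    darcySq U a (weakGrad U (Ψ₁ t) - weakGrad U (Ψ₂ t)) =
      darcySq U a (weakGrad U ((Ψ₁ - Ψ₂) t)) :=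
  lintegral_congr_ae ((weakGrad_sub hUo (hΨ₁.grad t ht) (hΨ₂.grad t ht)).mono fun x hx => by
    simp only [Pi.sub_apply Ψ₁, hx])

theorem darcySq_weakGrad_sub_le (hUo : IsOpen U) (hΨ₁ : IsRegular U φ α a Ψ₁)
    (hΨ₂ : IsRegular U φ α a Ψ₂) (ht : 0 < t)
    (hD : D U φ a (Ψ₁ - Ψ₂) t ≤ ENNReal.ofReal d) :
    darcySq U a (weakGrad U (Ψ₁ t) - weakGrad U (Ψ₂ t)) ≤ ENNReal.ofReal d :=
  (hΨ₁.darcySq_weakGrad_sub hUo hΨ₂ ht).trans_le ((le_add_right le_self_add).trans hD)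

theorem darcySq_weakGrad_sub_le_sq (hUo : IsOpen U) (hΨ₁ : IsRegular U φ α a Ψ₁)
    (hΨ₂ : IsRegular U φ α a Ψ₂) (ht : 0 < t) (hd : 0 ≤ d)
    (hD : D U φ a (Ψ₁ - Ψ₂) t ≤ ENNReal.ofReal d) :
    darcySq U a (weakGrad U (Ψ₁ t) - weakGrad U (Ψ₂ t)) ≤ ENNReal.ofReal (d ^ 2) := by
  have hroot : darcySq U a (weakGrad U ((Ψ₁ - Ψ₂) t)) ^ (1 / 2 : ℝ) ≤ ENNReal.ofReal d :=
    (le_add_right le_add_self).trans hD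
  rw [hΨ₁.darcySq_weakGrad_sub hUo hΨ₂ ht, ENNReal.ofReal_pow hd]
  rwa [one_div, ENNReal.rpow_inv_le_iff two_pos, ENNReal.rpow_two] at hroot

theorem norm_toL2_timeDeriv_sub_le (hU : MeasurableSet U) (hφ : IsPorosity U φ)
    (hΨ₁ : IsRegular U φ α a Ψ₁) (hΨ₂ : IsRegular U φ α a Ψ₂) (ht : 0 < t) (hd : 0 ≤ d)
    (hD : D U φ a (Ψ₁ - Ψ₂) t ≤ ENNReal.ofReal d) :
    ‖toL2 U φ (timeDeriv U φ Ψ₁ t) - toL2 U φ (timeDeriv U φ Ψ₂ t)‖ ≤ d := by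
  have hmem := (hΨ₁.memL2_timeDeriv ht).sub hU hφ (hΨ₂.memL2_timeDeriv ht)
  have hnormSq : normSq U φ (timeDeriv U φ (Ψ₁ - Ψ₂) t) =
      normSq U φ (timeDeriv U φ Ψ₁ t - timeDeriv U φ Ψ₂ t) :=
    lintegral_congr_ae ((hΨ₁.timeDeriv_sub hU hφ hΨ₂ ht).mono fun x hx => by simp only [hx])
  have hroot : normSq U φ (timeDeriv U φ (Ψ₁ - Ψ₂) t) ^ (1 / 2 : ℝ) ≤ ENNReal.ofReal d :=
    le_add_self.trans hD
  rwa [hnormSq, normSq_rpow_half hU hφ hmem, ENNReal.ofReal_le_ofReal_iff hd,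
    toL2_sub hU hφ (hΨ₁.memL2_timeDeriv ht) (hΨ₂.memL2_timeDeriv ht)] at hroot

end IsRegular

end BoundaryDifference

section Difference

variable {n N : ℕ} {U : Set (Space n)} {φ : Space n → ℝ} {α : Fin (N + 1) → ℝ}
  {a : Fin (N + 1) → Space n → ℝ} {Ψ p Ψ₁ Ψ₂ p₁ p₂ : ℝ → Space n → ℝ}
  {p₀ p₁₀ p₂₀ : Space n → ℝ} {t c d E C X : ℝ}

theorem rpow_kappa (hα : IsExponents α) (hX : 0 < X) :
    X ^ kappa α = X ^ (degExp α / (2 - degExp α)) * √X := by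
  have hγ : 2 - degExp α ≠ 0 := by linarith [degExp_lt_one hα]
  rw [Real.sqrt_eq_rpow, ← Real.rpow_add hX, kappa]
  congr 1
  field_simp
  ring

theorem kappa_nonneg (hα : IsExponents α) : 0 ≤ kappa α := by
  have ha0 := degExp_pos hα
  have ha1 := degExp_lt_one hα
  exact div_nonneg (by linarith) (by linarith)

namespace IsSolution

theorem inner_toL2_sub_solution (hM : IsMedium U α a) (hUo : IsOpen U) (hφ : IsPorosity U φ)
    (hp : IsSolution U φ α a Ψ p₀ p) (hΨ₁ : IsRegular U φ α a Ψ₁) (hΨ₂ : IsRegular U φ α a Ψ₂)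
    (hp₁ : IsSolution U φ α a Ψ₁ p₁₀ p₁) (hp₂ : IsSolution U φ α a Ψ₂ p₂₀ p₂) (ht : 0 < t) :
    inner ℝ (toL2 U φ (p₁ t - Ψ₁ t) - toL2 U φ (p₂ t - Ψ₂ t)) (toL2 U φ (timeDeriv U φ p t)) =
      fluxPairing U α a (weakGrad U (p t)) (weakGrad U (Ψ₁ t) - weakGrad U (Ψ₂ t))
        - fluxPairing U α a (weakGrad U (p t)) (weakGrad U (p₁ t) - weakGrad U (p₂ t)) := by
  have hq := hp.regular.memEnergy ht
  have hq₁ := hp₁.regular.memEnergy ht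
  have hq₂ := hp₂.regular.memEnergy ht
  have hψ₁ := hΨ₁.memEnergy ht
  have hψ₂ := hΨ₂.memEnergy ht
  rw [real_inner_comm, inner_sub_right, hp.inner_toL2_solution hM hUo hφ hΨ₁ hp₁ ht ht,
    hp.inner_toL2_solution hM hUo hφ hΨ₂ hp₂ ht ht, fluxPairing_sub hM hq hq₁ hψ₁,
    fluxPairing_sub hM hq hq₂ hψ₂, fluxPairing_sub hM hq hψ₁ hψ₂, fluxPairing_sub hM hq hq₁ hq₂]
  ring

theorem two_mul_inner_toL2_sub_le (hM : IsMedium U α a) (hUo : IsOpen U) (hφ : IsPorosity U φ)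
    (hΨ₁ : IsRegular U φ α a Ψ₁) (hΨ₂ : IsRegular U φ α a Ψ₂)
    (hp₁ : IsSolution U φ α a Ψ₁ p₁₀ p₁) (hp₂ : IsSolution U φ α a Ψ₂ p₂₀ p₂) (ht : 0 < t)
    {θ : ℝ} (hθ : 0 < θ) (hd : 0 ≤ d) (hD : D U φ a (Ψ₁ - Ψ₂) t ≤ ENNReal.ofReal d)
    (hE₁ : energyReal U α a (weakGrad U (p₁ t)) / 2 + ‖toL2 U φ (p₁ t - Ψ₁ t)‖ ^ 2 ≤ E)
    (hE₂ : energyReal U α a (weakGrad U (p₂ t)) / 2 + ‖toL2 U φ (p₂ t - Ψ₂ t)‖ ^ 2 ≤ E) :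
    2 * inner ℝ (toL2 U φ (p₁ t - Ψ₁ t) - toL2 U φ (p₂ t - Ψ₂ t))
        ((toL2 U φ (timeDeriv U φ p₁ t) - toL2 U φ (timeDeriv U φ Ψ₁ t))
          - (toL2 U φ (timeDeriv U φ p₂ t) - toL2 U φ (timeDeriv U φ Ψ₂ t))) ≤
      -(2 * ((1 - degExp α) * fluxDissipation U α a (weakGrad U (p₁ t)) (weakGrad U (p₂ t))))
        + 4 * (θ * E) + 3 * (θ⁻¹ * d ^ 2) := by
  have hq₁ := hp₁.regular.memEnergy ht
  have hq₂ := hp₂.regular.memEnergy ht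
  have hψ := ((hΨ₁.memEnergy ht).sub hM (hΨ₂.memEnergy ht)).aestronglyMeasurable
  have hdarcy := hΨ₁.darcySq_weakGrad_sub_le_sq hUo hΨ₂ ht hd hD
  have hflux₁ := two_mul_abs_fluxPairing_le hM (sq_nonneg d) hθ hq₁ hψ hdarcy
  have hflux₂ := two_mul_abs_fluxPairing_le hM (sq_nonneg d) hθ hq₂ hψ hdarcy
  have hmono := one_sub_degExp_mul_fluxDissipation_le hM hq₁ hq₂
  set z₁ := toL2 U φ (p₁ t - Ψ₁ t)
  set z₂ := toL2 U φ (p₂ t - Ψ₂ t)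
  set w := toL2 U φ (timeDeriv U φ Ψ₁ t) - toL2 U φ (timeDeriv U φ Ψ₂ t)
  have hw : ‖w‖ ≤ d := hΨ₁.norm_toL2_timeDeriv_sub_le hM.measurableSet hφ hΨ₂ ht hd hD
  have hz : ‖z₁ - z₂‖ ^ 2 ≤ 2 * (‖z₁‖ ^ 2 + ‖z₂‖ ^ 2) :=
    (pow_le_pow_left₀ (norm_nonneg _) (norm_sub_le _ _) 2).trans (add_sq_le ..)
  have hcauchy : -(2 * inner ℝ (z₁ - z₂) w) ≤ θ * ‖z₁ - z₂‖ ^ 2 + θ⁻¹ * d ^ 2 := by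
    have hinner : |inner ℝ (z₁ - z₂) w| ≤ ‖z₁ - z₂‖ * d :=
      (abs_real_inner_le_norm _ _).trans (by gcongr)
    linarith [neg_abs_le (inner ℝ (z₁ - z₂) w),
      two_mul_le_add_mul_sq (a := ‖z₁ - z₂‖) (b := d) hθ]
  have henergy := mul_le_mul_of_nonneg_left (add_le_add hE₁ hE₂) hθ.le
  have hzθ := mul_le_mul_of_nonneg_left hz hθ.le
  rw [sub_sub_sub_comm, inner_sub_right, inner_sub_right,
    hp₁.inner_toL2_sub_solution hM hUo hφ hΨ₁ hΨ₂ hp₁ hp₂ ht,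
    hp₂.inner_toL2_sub_solution hM hUo hφ hΨ₁ hΨ₂ hp₁ hp₂ ht]
  linarith [le_abs_self (fluxPairing U α a (weakGrad U (p₁ t))
      (weakGrad U (Ψ₁ t) - weakGrad U (Ψ₂ t))),
    neg_abs_le (fluxPairing U α a (weakGrad U (p₂ t)) (weakGrad U (Ψ₁ t) - weakGrad U (Ψ₂ t)))]

theorem norm_toL2_sub_sq_le (hM : IsMedium U α a) (hUo : IsOpen U) (hφ : IsPorosity U φ)
    (hΨ₁ : IsRegular U φ α a Ψ₁) (hΨ₂ : IsRegular U φ α a Ψ₂)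
    (hp₁ : IsSolution U φ α a Ψ₁ p₁₀ p₁) (hp₂ : IsSolution U φ α a Ψ₂ p₂₀ p₂) (ht : 0 < t)
    (hc : 0 < c) (hP : PoincareSobolev U φ α a c ((p₁ t - Ψ₁ t) - (p₂ t - Ψ₂ t)))
    (hX : 0 < X) (hC : 0 ≤ C) (hd : 0 ≤ d) (hstar : BStar U a ≤ ENNReal.ofReal X)
    (hD : D U φ a (Ψ₁ - Ψ₂) t ≤ ENNReal.ofReal d)
    (hE₁ : energyReal U α a (weakGrad U (p₁ t)) / 2 ≤ C * X)
    (hE₂ : energyReal U α a (weakGrad U (p₂ t)) / 2 ≤ C * X) :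
    ‖toL2 U φ (p₁ t - Ψ₁ t) - toL2 U φ (p₂ t - Ψ₂ t)‖ ^ 2 ≤
      8 * c ^ (2 - degExp α) *
        (4 * c ^ (2 - degExp α) * ((4 * C + 1) * X)) ^ (degExp α / (2 - degExp α)) *
        (fluxDissipation U α a (weakGrad U (p₁ t)) (weakGrad U (p₂ t)) + d) := by
  have hz₁ := hp₁.memL2 t ht.le
  have hz₂ := hp₂.memL2 t ht.le
  have hψ := ((hΨ₁.memEnergy ht).sub hM (hΨ₂.memEnergy ht)).aestronglyMeasurable
  have hgrad₁ := (hasWeakGrad_weakGrad (hp₁.regular.grad t ht)).sub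
    (hasWeakGrad_weakGrad (hΨ₁.grad t ht))
  have hgrad₂ := (hasWeakGrad_weakGrad (hp₂.regular.grad t ht)).sub
    (hasWeakGrad_weakGrad (hΨ₂.grad t ht))
  have hgrad := hgrad₁.sub hgrad₂
  rw [sub_sub_sub_comm (weakGrad U (p₁ t))] at hgrad
  rw [← toL2_sub hM.measurableSet hφ hz₁ hz₂]
  exact hP.norm_toL2_sq_le hM hφ hc hX.le hd (by positivity)
    (hz₁.sub hM.measurableSet hφ hz₂) (hp₁.regular.memEnergy ht) (hp₂.regular.memEnergy ht) hψ
    ((hasWeakGrad_weakGrad ⟨_, hgrad⟩).ae_eq hUo hgrad) hstar (by linarith)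
    (hΨ₁.darcySq_weakGrad_sub_le hUo hΨ₂ ht hD)

end IsSolution

/-- The constant in the bound for the difference of two solutions, in terms of the
Poincaré–Sobolev constant `c` and a constant `C` in the energy bounds for the two solutions. The
last factor is how much dissipation is needed to beat the data in the estimate for the derivative
of the squared norm. -/
noncomputable def differenceConst (α : Fin (N + 1) → ℝ) (c C : ℝ) : ℝ :=
  8 * c ^ (2 - degExp α) *
    (4 * c ^ (2 - degExp α) * (4 * C + 1)) ^ (degExp α / (2 - degExp α)) *
    (1 + (2 * C + 2) / (1 - degExp α))

theorem differenceConst_pos (hα : IsExponents α) (hc : 0 < c) (hC : 0 ≤ C) :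
    0 < differenceConst α c C := by
  have hone : 0 < 1 - degExp α := sub_pos.2 (degExp_lt_one hα)
  rw [differenceConst]
  positivity

theorem le_of_differenceConst_mul_le (hα : IsExponents α) (hc : 0 < c) (hC : 0 ≤ C) (hX : 0 < X)
    {J y : ℝ} (hlarge : differenceConst α c C * X ^ kappa α * d ≤ y)
    (hy : y ≤ 8 * c ^ (2 - degExp α) *
      (4 * c ^ (2 - degExp α) * ((4 * C + 1) * X)) ^ (degExp α / (2 - degExp α)) * (J + d)) :
    (1 - degExp α + (2 * C + 2)) * (√X * d) ≤ (1 - degExp α) * (J + d) := by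
  have hone : 0 < 1 - degExp α := sub_pos.2 (degExp_lt_one hα)
  set S := 8 * c ^ (2 - degExp α) *
    (4 * c ^ (2 - degExp α) * (4 * C + 1)) ^ (degExp α / (2 - degExp α)) *
    X ^ (degExp α / (2 - degExp α))
  have hS0 : 0 < S := by positivity
  have hle : S * ((1 + (2 * C + 2) / (1 - degExp α)) * (√X * d)) ≤ S * (J + d) := by
    calc S * ((1 + (2 * C + 2) / (1 - degExp α)) * (√X * d))
        = differenceConst α c C * X ^ kappa α * d := by
          rw [rpow_kappa hα hX, differenceConst]
          ring
      _ ≤ y := hlarge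
      _ ≤ _ := hy
      _ = S * (J + d) := by
          rw [← mul_assoc (4 * c ^ (2 - degExp α)), Real.mul_rpow (by positivity) hX.le]
          ring
  have hJ := mul_le_mul_of_nonneg_left (le_of_mul_le_mul_left hle hS0) hone.le
  calc _ = (1 - degExp α) * ((1 + (2 * C + 2) / (1 - degExp α)) * (√X * d)) := by
        field_simp
    _ ≤ _ := hJ

namespace IsSolution

theorem two_mul_inner_toL2_sub_le_neg (hM : IsMedium U α a) (hUo : IsOpen U)
    (hφ : IsPorosity U φ) (hΨ₁ : IsRegular U φ α a Ψ₁) (hΨ₂ : IsRegular U φ α a Ψ₂)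
    (hp₁ : IsSolution U φ α a Ψ₁ p₁₀ p₁) (hp₂ : IsSolution U φ α a Ψ₂ p₂₀ p₂) (ht : 0 < t)
    (hc : 0 < c) (hP : PoincareSobolev U φ α a c ((p₁ t - Ψ₁ t) - (p₂ t - Ψ₂ t)))
    (hX : 1 ≤ X) (hC : 0 ≤ C) (hd : 0 < d) (hstar : BStar U a ≤ ENNReal.ofReal X)
    (hD : D U φ a (Ψ₁ - Ψ₂) t ≤ ENNReal.ofReal d)
    (hE₁ : energyReal U α a (weakGrad U (p₁ t)) / 2 + ‖toL2 U φ (p₁ t - Ψ₁ t)‖ ^ 2 ≤ C * X)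
    (hE₂ : energyReal U α a (weakGrad U (p₂ t)) / 2 + ‖toL2 U φ (p₂ t - Ψ₂ t)‖ ^ 2 ≤ C * X)
    (hlarge : differenceConst α c C * X ^ kappa α * d ≤
      ‖toL2 U φ (p₁ t - Ψ₁ t) - toL2 U φ (p₂ t - Ψ₂ t)‖ ^ 2) :
    2 * inner ℝ (toL2 U φ (p₁ t - Ψ₁ t) - toL2 U φ (p₂ t - Ψ₂ t))
        ((toL2 U φ (timeDeriv U φ p₁ t) - toL2 U φ (timeDeriv U φ Ψ₁ t))
          - (toL2 U φ (timeDeriv U φ p₂ t) - toL2 U φ (timeDeriv U φ Ψ₂ t))) ≤ -d := by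
  have hX0 : 0 < X := one_pos.trans_le hX
  have hsqrt : 1 ≤ √X := Real.one_le_sqrt.2 hX
  have hcoercive := hp₁.norm_toL2_sub_sq_le hM hUo hφ hΨ₁ hΨ₂ hp₂ ht hc hP hX0 hC hd.le hstar hD
    ((le_add_of_nonneg_right (sq_nonneg _)).trans hE₁)
    ((le_add_of_nonneg_right (sq_nonneg _)).trans hE₂)
  have hdissipation := le_of_differenceConst_mul_le hM.exponents hc hC hX0 hlarge hcoercive
  -- `θ = d / √X` balances the two error terms: both become multiples of `√X * d`.
  have hderiv := hp₁.two_mul_inner_toL2_sub_le hM hUo hφ hΨ₁ hΨ₂ hp₂ ht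
    (div_pos hd (by positivity : 0 < √X)) hd.le hD hE₁ hE₂
  have hθE : d / √X * (C * X) = C * (√X * d) := by
    rw [div_mul_eq_mul_div, div_eq_iff (by positivity)]
    linear_combination (-C * d) * Real.mul_self_sqrt hX0.le
  have hθd : (d / √X)⁻¹ * d ^ 2 = √X * d := by field_simp
  rw [hθE, hθd] at hderiv
  have hdX : d ≤ √X * d := le_mul_of_one_le_left hd.le hsqrt
  have hone : 0 ≤ 1 - degExp α := (sub_pos.2 (degExp_lt_one hM.exponents)).le
  linarith [mul_le_mul_of_nonneg_left hdX hone]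

theorem eventually_normSq_sub_le (hM : IsMedium U α a) (hUo : IsOpen U) (hφ : IsPorosity U φ)
    (hΨ₁ : IsRegular U φ α a Ψ₁) (hΨ₂ : IsRegular U φ α a Ψ₂)
    (hp₁ : IsSolution U φ α a Ψ₁ p₁₀ p₁) (hp₂ : IsSolution U φ α a Ψ₂ p₂₀ p₂) (hc : 0 < c)
    (hP : ∀ t, 0 < t → PoincareSobolev U φ α a c ((p₁ t - Ψ₁ t) - (p₂ t - Ψ₂ t)))
    (hX : 1 ≤ X) (hC : 0 ≤ C) (hd : 0 < d) (hstar : BStar U a ≤ ENNReal.ofReal X)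
    (hD : ∀ᶠ t in atTop, D U φ a (Ψ₁ - Ψ₂) t ≤ ENNReal.ofReal d)
    (hE₁ : ∀ᶠ t in atTop,
      energyReal U α a (weakGrad U (p₁ t)) / 2 + ‖toL2 U φ (p₁ t - Ψ₁ t)‖ ^ 2 ≤ C * X)
    (hE₂ : ∀ᶠ t in atTop,
      energyReal U α a (weakGrad U (p₂ t)) / 2 + ‖toL2 U φ (p₂ t - Ψ₂ t)‖ ^ 2 ≤ C * X) :
    ∀ᶠ t in atTop, normSq U φ ((p₁ t - Ψ₁ t) - (p₂ t - Ψ₂ t)) ≤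
      ENNReal.ofReal (differenceConst α c C * X ^ kappa α * d) := by
  have hU := hM.measurableSet
  have hnorm : ∀ᶠ t in atTop, ‖toL2 U φ (p₁ t - Ψ₁ t) - toL2 U φ (p₂ t - Ψ₂ t)‖ ^ 2 ≤
      differenceConst α c C * X ^ kappa α * d := by
    refine eventually_le_of_hasDerivAt hd ((eventually_gt_atTop 0).mono fun t ht =>
      ((hp₁.hasDerivAt_toL2 hU hφ hΨ₁ ht).sub (hp₂.hasDerivAt_toL2 hU hφ hΨ₂ ht)).norm_sq) ?_
    filter_upwards [hD, hE₁, hE₂, eventually_gt_atTop 0] with t hDt hE₁t hE₂t ht hlarge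
    exact hp₁.two_mul_inner_toL2_sub_le_neg hM hUo hφ hΨ₁ hΨ₂ hp₂ ht hc (hP t ht) hX hC hd hstar
      hDt hE₁t hE₂t hlarge
  filter_upwards [hnorm, eventually_ge_atTop 0] with t ht ht0
  have hz₁ := hp₁.memL2 t ht0
  have hz₂ := hp₂.memL2 t ht0
  rw [normSq_eq_norm_toL2_sq hU hφ (hz₁.sub hU hφ hz₂), toL2_sub hU hφ hz₁ hz₂]
  exact ENNReal.ofReal_le_ofReal ht

end IsSolution

end Difference

section Limsup

variable {ι : Type*} {l : Filter ι} {f g : ι → ℝ≥0∞}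

theorem eventually_le_limsup_add {c : ℝ≥0∞} (hc : c ≠ 0) (hf : limsup f l ≠ ⊤) :
    ∀ᶠ t in l, f t ≤ limsup f l + c :=
  (eventually_lt_of_limsup_lt (ENNReal.lt_add_right hf hc)).mono fun _ h => h.le

theorem limsup_le_mul_limsup {k : ℝ≥0∞} (hk0 : k ≠ 0) (hk : k ≠ ⊤)
    (h : ∀ d : ℝ, 0 < d → (∀ᶠ t in l, f t ≤ ENNReal.ofReal d) →
      ∀ᶠ t in l, g t ≤ k * ENNReal.ofReal d) :
    limsup g l ≤ k * limsup f l := by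
  rw [mul_comm, ← ENNReal.div_le_iff hk0 hk]
  refine le_of_forall_gt_imp_ge_of_dense fun d hd => ?_
  rcases eq_or_ne d ⊤ with rfl | hd_top
  · exact le_top
  rw [ENNReal.div_le_iff hk0 hk, mul_comm]
  have hlt := eventually_lt_of_limsup_lt hd
  lift d to NNReal using hd_top
  have hd0 : 0 < d := ENNReal.coe_pos.1 (bot_le.trans_lt hd)
  rw [← ENNReal.ofReal_coe_nnreal] at hlt ⊢
  exact limsup_le_of_le (by isBoundedDefault) (h d hd0 (hlt.mono fun _ ht => ht.le))

end Limsup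

section DataLimits

variable {n N : ℕ} {U : Set (Space n)} {φ : Space n → ℝ} {α : Fin (N + 1) → ℝ}
  {a : Fin (N + 1) → Space n → ℝ} {Ψ Ψ₁ Ψ₂ : ℝ → Space n → ℝ}

theorem one_le_limsup_G : 1 ≤ limsup (G U φ α a Ψ) atTop :=
  le_limsup_of_frequently_le (Eventually.frequently (.of_forall fun _ => one_le_G))

theorem eventually_G_le_calA (hA : calA U φ α a Ψ₁ Ψ₂ ≠ ⊤) :
    (∀ᶠ t in atTop, G U φ α a Ψ₁ t ≤ calA U φ α a Ψ₁ Ψ₂) ∧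
      ∀ᶠ t in atTop, G U φ α a Ψ₂ t ≤ calA U φ α a Ψ₁ Ψ₂ := by
  obtain ⟨hA₁, hA₂⟩ := ENNReal.add_ne_top.1 hA
  exact ⟨eventually_le_limsup_add (one_pos.trans_le one_le_limsup_G).ne' hA₁,
    (eventually_le_limsup_add (one_pos.trans_le one_le_limsup_G).ne' hA₂).mono fun t ht =>
      ht.trans_eq (add_comm _ _)⟩

theorem eventually_G1_le_calG1_add_one (hG1 : calG1 U φ a Ψ₁ Ψ₂ ≠ ⊤) :
    (∀ᶠ t in atTop, G1 U φ a Ψ₁ t ≤ calG1 U φ a Ψ₁ Ψ₂ + 1) ∧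
      ∀ᶠ t in atTop, G1 U φ a Ψ₂ t ≤ calG1 U φ a Ψ₁ Ψ₂ + 1 := by
  obtain ⟨h₁, h₂⟩ := ENNReal.add_ne_top.1 hG1
  exact ⟨(eventually_le_limsup_add one_ne_zero h₁).mono fun t ht =>
      ht.trans (add_le_add_left le_self_add 1),
    (eventually_le_limsup_add one_ne_zero h₂).mono fun t ht =>
      ht.trans (add_le_add_left le_add_self 1)⟩

theorem exists_calA_eq_ofReal_rpow (hα : IsExponents α) (hA : calA U φ α a Ψ₁ Ψ₂ ≠ ⊤) :
    ∃ m : ℝ, 1 ≤ m ∧ calA U φ α a Ψ₁ Ψ₂ = ENNReal.ofReal (m ^ (2 - degExp α)) := by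
  have hγ : 0 < 2 - degExp α := by linarith [degExp_lt_one hα]
  have hone : 1 ≤ (calA U φ α a Ψ₁ Ψ₂).toReal :=
    (ENNReal.one_le_ofReal.1 ((le_add_right one_le_limsup_G : 1 ≤ calA U φ α a Ψ₁ Ψ₂).trans_eq
      (ENNReal.ofReal_toReal hA).symm))
  refine ⟨(calA U φ α a Ψ₁ Ψ₂).toReal ^ (2 - degExp α)⁻¹, Real.one_le_rpow hone (by positivity), ?_⟩
  rw [Real.rpow_inv_rpow (by linarith) hγ.ne', ENNReal.ofReal_toReal hA]

end DataLimits

section Main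

variable {n N : ℕ} {U : Set (Space n)} {φ : Space n → ℝ} {α : Fin (N + 1) → ℝ}
  {a : Fin (N + 1) → Space n → ℝ} {Ψ₁ Ψ₂ p₁ p₂ : ℝ → Space n → ℝ}
  {p₁₀ p₂₀ : Space n → ℝ} {c R m B : ℝ}

/-- The constant of the theorem: `c` is the Poincaré–Sobolev constant, and `R` a radius beyond
which the dissipation outgrows the boundary data. The power of `2` absorbs the margin kept above
the upper limits. -/
noncomputable def limsupConst (α : Fin (N + 1) → ℝ) (c R : ℝ) : ℝ :=
  2 ^ kappa α * differenceConst α c (6 + 4 * R + R ^ 2)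

theorem limsupConst_pos (hα : IsExponents α) (hc : 0 < c) (hR : 0 ≤ R) : 0 < limsupConst α c R :=
  mul_pos (by positivity) (differenceConst_pos hα hc (by positivity))

namespace IsSolution

theorem limsup_normSq_sub_le_of_eventually (hM : IsMedium U α a) (hUo : IsOpen U)
    (hφ : IsPorosity U φ) (hΨ₁ : IsRegular U φ α a Ψ₁) (hΨ₂ : IsRegular U φ α a Ψ₂)
    (hp₁ : IsSolution U φ α a Ψ₁ p₁₀ p₁) (hp₂ : IsSolution U φ α a Ψ₂ p₂₀ p₂) (hc : 0 < c)
    (hP₁ : ∀ t, 0 < t → PoincareSobolev U φ α a c (p₁ t - Ψ₁ t))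
    (hP₂ : ∀ t, 0 < t → PoincareSobolev U φ α a c (p₂ t - Ψ₂ t))
    (hP : ∀ t, 0 < t → PoincareSobolev U φ α a c ((p₁ t - Ψ₁ t) - (p₂ t - Ψ₂ t)))
    (hR0 : 0 ≤ R)
    (hR : ∀ r, R ≤ r → 4 * c ^ (2 - degExp α) * (3 + 2 * r) ≤ r ^ (2 - degExp α))
    (hm : 1 ≤ m) (hB : 0 ≤ B)
    (hG : (∀ᶠ t in atTop, G U φ α a Ψ₁ t ≤ ENNReal.ofReal (m ^ (2 - degExp α))) ∧
      ∀ᶠ t in atTop, G U φ α a Ψ₂ t ≤ ENNReal.ofReal (m ^ (2 - degExp α)))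
    (hG1 : (∀ᶠ t in atTop, G1 U φ a Ψ₁ t ≤ ENNReal.ofReal B) ∧
      ∀ᶠ t in atTop, G1 U φ a Ψ₂ t ≤ ENNReal.ofReal B) :
    limsup (fun t => normSq U φ ((p₁ t - Ψ₁ t) - (p₂ t - Ψ₂ t))) atTop ≤
      ENNReal.ofReal (differenceConst α c (6 + 4 * R + R ^ 2) * (m ^ 2 + B) ^ kappa α) *
        calD U φ a Ψ₁ Ψ₂ := by
  have hX : 1 ≤ m ^ 2 + B := by nlinarith
  have hK := mul_pos (differenceConst_pos hM.exponents hc (by positivity : 0 ≤ 6 + 4 * R + R ^ 2))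
    (Real.rpow_pos_of_pos (one_pos.trans_le hX) (kappa α))
  have hm_le : m ^ (2 - degExp α) ≤ m ^ 2 := by
    rw [← Real.rpow_two]
    exact Real.rpow_le_rpow_of_exponent_le hm (by linarith [degExp_pos hM.exponents])
  obtain ⟨t, ht⟩ := hG.1.exists
  have hstar : BStar U a ≤ ENNReal.ofReal (m ^ 2 + B) :=
    (BStar_le_G.trans ht).trans (ENNReal.ofReal_le_ofReal (by linarith))
  have hE₁ := hp₁.eventually_energyReal_add_norm_sq_le hM hUo hφ hΨ₁ hm hR0 hB hG.1 hG1.1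
    (hp₁.eventually_norm_toL2_le hM hUo hφ hΨ₁ hc hP₁ hm hR0 hR hG.1)
  have hE₂ := hp₂.eventually_energyReal_add_norm_sq_le hM hUo hφ hΨ₂ hm hR0 hB hG.2 hG1.2
    (hp₂.eventually_norm_toL2_le hM hUo hφ hΨ₂ hc hP₂ hm hR0 hR hG.2)
  refine limsup_le_mul_limsup (ENNReal.ofReal_pos.2 hK).ne' ENNReal.ofReal_ne_top fun d hd hD => ?_
  rw [← ENNReal.ofReal_mul hK.le]
  exact hp₁.eventually_normSq_sub_le hM hUo hφ hΨ₁ hΨ₂ hp₂ hc hP hX (by positivity) hd hstar hD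
    hE₁ hE₂

theorem limsup_normSq_sub_le (hM : IsMedium U α a) (hUo : IsOpen U)
    (hφ : IsPorosity U φ) (hΨ₁ : IsRegular U φ α a Ψ₁) (hΨ₂ : IsRegular U φ α a Ψ₂)
    (hp₁ : IsSolution U φ α a Ψ₁ p₁₀ p₁) (hp₂ : IsSolution U φ α a Ψ₂ p₂₀ p₂) (hc : 0 < c)
    (hP₁ : ∀ t, 0 < t → PoincareSobolev U φ α a c (p₁ t - Ψ₁ t))
    (hP₂ : ∀ t, 0 < t → PoincareSobolev U φ α a c (p₂ t - Ψ₂ t))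
    (hP : ∀ t, 0 < t → PoincareSobolev U φ α a c ((p₁ t - Ψ₁ t) - (p₂ t - Ψ₂ t)))
    (hR0 : 0 ≤ R)
    (hR : ∀ r, R ≤ r → 4 * c ^ (2 - degExp α) * (3 + 2 * r) ≤ r ^ (2 - degExp α))
    (hA : calA U φ α a Ψ₁ Ψ₂ ≠ ⊤) (hG1 : calG1 U φ a Ψ₁ Ψ₂ ≠ ⊤) :
    limsup (fun t => normSq U φ ((p₁ t - Ψ₁ t) - (p₂ t - Ψ₂ t))) atTop ≤
      ENNReal.ofReal (limsupConst α c R) *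
        (calA U φ α a Ψ₁ Ψ₂ ^ (2 / (2 - degExp α)) + calG1 U φ a Ψ₁ Ψ₂) ^ kappa α *
        calD U φ a Ψ₁ Ψ₂ := by
  have hγ : 0 < 2 - degExp α := by linarith [degExp_lt_one hM.exponents]
  have hκ := kappa_nonneg hM.exponents
  have hK := differenceConst_pos hM.exponents hc (by positivity : 0 ≤ 6 + 4 * R + R ^ 2)
  obtain ⟨m, hm, hmA⟩ := exists_calA_eq_ofReal_rpow hM.exponents hA
  have hA_pow : calA U φ α a Ψ₁ Ψ₂ ^ (2 / (2 - degExp α)) = ENNReal.ofReal (m ^ 2) := by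
    rw [hmA, ENNReal.ofReal_rpow_of_nonneg (by positivity) (by positivity),
      ← Real.rpow_mul (by positivity), mul_div_cancel₀ _ hγ.ne', Real.rpow_two]
  have hGev := eventually_G_le_calA hA
  have hG1ev := eventually_G1_le_calG1_add_one hG1
  obtain ⟨B, hB, hBG1⟩ : ∃ B : ℝ, 0 ≤ B ∧ calG1 U φ a Ψ₁ Ψ₂ = ENNReal.ofReal B :=
    ⟨_, ENNReal.toReal_nonneg, (ENNReal.ofReal_toReal hG1).symm⟩
  rw [hmA] at hGev
  rw [hBG1, ← ENNReal.ofReal_one, ← ENNReal.ofReal_add hB zero_le_one] at hG1ev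
  refine (hp₁.limsup_normSq_sub_le_of_eventually hM hUo hφ hΨ₁ hΨ₂ hp₂ hc hP₁ hP₂ hP hR0 hR hm
    (by linarith : 0 ≤ B + 1) hGev hG1ev).trans ?_
  have hmB : m ^ 2 + (B + 1) ≤ 2 * (m ^ 2 + B) := by nlinarith
  rw [hA_pow, hBG1, ← ENNReal.ofReal_add (by positivity) hB,
    ENNReal.ofReal_rpow_of_nonneg (by positivity) hκ,
    ← ENNReal.ofReal_mul (limsupConst_pos hM.exponents hc hR0).le]
  refine mul_le_mul_left (ENNReal.ofReal_le_ofReal ?_) _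
  calc differenceConst α c (6 + 4 * R + R ^ 2) * (m ^ 2 + (B + 1)) ^ kappa α
      ≤ differenceConst α c (6 + 4 * R + R ^ 2) * (2 * (m ^ 2 + B)) ^ kappa α := by gcongr
    _ = limsupConst α c R * (m ^ 2 + B) ^ kappa α := by
      rw [Real.mul_rpow zero_le_two (by positivity), limsupConst]
      ring

end IsSolution

end Main

end Forchheimer

theorem mainTheorem7_general {N : ℕ} (α : Fin (N + 1) → ℝ) (hα : Forchheimer.IsExponents α)
    (cP : ℝ) (hcP : 0 < cP) :
    ∃ C : ℝ, 0 < C ∧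
      ∀ {n : ℕ} (U : Set (Forchheimer.Space n)), IsOpen U →
      ∀ (φ : Forchheimer.Space n → ℝ) (a : Fin (N + 1) → Forchheimer.Space n → ℝ)
        (Ψ₁ Ψ₂ p₁ p₂ : ℝ → Forchheimer.Space n → ℝ) (p₁₀ p₂₀ : Forchheimer.Space n → ℝ),
        Forchheimer.IsPorosity U φ → Forchheimer.IsCoeff U a →
        Forchheimer.IsRegular U φ α a Ψ₁ → Forchheimer.IsRegular U φ α a Ψ₂ →
        Forchheimer.IsSolution U φ α a Ψ₁ p₁₀ p₁ →
        Forchheimer.IsSolution U φ α a Ψ₂ p₂₀ p₂ →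
        (∀ t, 0 < t → Forchheimer.PoincareSobolev U φ α a cP (p₁ t - Ψ₁ t)) →
        (∀ t, 0 < t → Forchheimer.PoincareSobolev U φ α a cP (p₂ t - Ψ₂ t)) →
        (∀ t, 0 < t →
          Forchheimer.PoincareSobolev U φ α a cP ((p₁ t - Ψ₁ t) - (p₂ t - Ψ₂ t))) →
        Forchheimer.calA U φ α a Ψ₁ Ψ₂ < ⊤ → Forchheimer.calG1 U φ a Ψ₁ Ψ₂ < ⊤ →
        limsup (fun t => Forchheimer.normSq U φ ((p₁ t - Ψ₁ t) - (p₂ t - Ψ₂ t))) atTop ≤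
          ENNReal.ofReal C *
            (Forchheimer.calA U φ α a Ψ₁ Ψ₂ ^ (2 / (2 - Forchheimer.degExp α))
              + Forchheimer.calG1 U φ a Ψ₁ Ψ₂) ^ Forchheimer.kappa α *
            Forchheimer.calD U φ a Ψ₁ Ψ₂ := by
  have hγ : 1 < 2 - Forchheimer.degExp α := by linarith [Forchheimer.degExp_lt_one hα]
  obtain ⟨R, hR1, hR⟩ := Forchheimer.exists_forall_affine_le_rpow hγ
    (4 * cP ^ (2 - Forchheimer.degExp α))
  have hR0 : 0 ≤ R := zero_le_one.trans hR1
  refine ⟨_, Forchheimer.limsupConst_pos hα hcP hR0, ?_⟩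
  intro n U hUo φ a Ψ₁ Ψ₂ p₁ p₂ p₁₀ p₂₀ hφ ha hΨ₁ hΨ₂ hp₁ hp₂ hP₁ hP₂ hP hA hG1
  exact hp₁.limsup_normSq_sub_le ⟨hUo.measurableSet, hα, ha⟩ hUo hφ hΨ₁ hΨ₂ hp₂ hcP hP₁ hP₂ hP
    hR0 hR hA.ne hG1.ne

theorem mainTheorem7 {n N : ℕ} (hn : 2 ≤ n)
    (U : Set (Forchheimer.Space n)) (hUo : IsOpen U) (hUb : Bornology.IsBounded U)
    (α : Fin (N + 1) → ℝ) (hα : Forchheimer.IsExponents α) (cP : ℝ) (hcP : 0 < cP) :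
    ∃ C : ℝ, 0 < C ∧
      ∀ (φ : Forchheimer.Space n → ℝ) (a : Fin (N + 1) → Forchheimer.Space n → ℝ)
        (Ψ₁ Ψ₂ p₁ p₂ : ℝ → Forchheimer.Space n → ℝ) (p₁₀ p₂₀ : Forchheimer.Space n → ℝ),
        Forchheimer.IsPorosity U φ → Forchheimer.IsCoeff U a →
        Forchheimer.IsRegular U φ α a Ψ₁ → Forchheimer.IsRegular U φ α a Ψ₂ →
        Forchheimer.IsSolution U φ α a Ψ₁ p₁₀ p₁ →
        Forchheimer.IsSolution U φ α a Ψ₂ p₂₀ p₂ →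
        (∀ t, 0 < t → Forchheimer.PoincareSobolev U φ α a cP (p₁ t - Ψ₁ t)) →
        (∀ t, 0 < t → Forchheimer.PoincareSobolev U φ α a cP (p₂ t - Ψ₂ t)) →
        (∀ t, 0 < t →
          Forchheimer.PoincareSobolev U φ α a cP ((p₁ t - Ψ₁ t) - (p₂ t - Ψ₂ t))) →
        Forchheimer.calA U φ α a Ψ₁ Ψ₂ < ⊤ → Forchheimer.calG1 U φ a Ψ₁ Ψ₂ < ⊤ →
        limsup (fun t => Forchheimer.normSq U φ ((p₁ t - Ψ₁ t) - (p₂ t - Ψ₂ t))) atTop ≤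
          ENNReal.ofReal C *
            (Forchheimer.calA U φ α a Ψ₁ Ψ₂ ^ (2 / (2 - Forchheimer.degExp α))
              + Forchheimer.calG1 U φ a Ψ₁ Ψ₂) ^ Forchheimer.kappa α *
            Forchheimer.calD U φ a Ψ₁ Ψ₂ := by
  obtain ⟨C, hC, h⟩ := mainTheorem7_general α hα cP hcP
  exact ⟨C, hC, h U hUo⟩
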